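/- **Setting.** Let $n\ge 2$, let $U\subset\mathbb R^n$ be a bounded, open, connected set with boundary $\Gamma=\partial U$, and let $g(s)=a_0s^{\alpha_0}+a_1s^{\alpha_1}+\dots+a_Ns^{\alpha_N}$ for $s\ge 0$, where $N\ge 1$, $0=\alpha_0<\alpha_1<\dots<\alpha_N$ are real numbers, $a_0,\dots,a_N\ge 0$, $a_0>0$ and $a_N>0$ (no restriction on the degree $\alpha_N$). For $\xi\ge 0$ let $K(\xi)=1/g(s(\xi))$, where $s=s(\xi)\ge 0$ is the solution of $s\,g(s)=\xi$. Put $$a=\frac{\alpha_N}{1+\alpha_N},\qquad \alpha_*=\frac{an}{2-a},$$ and let $\alpha$ be a real number with $\alpha\ge 2$ and $\alpha>\alpha_*$. Put $$\kappa_0=\alpha\Big(1+\frac{2-a}{n}\Big)-a,\qquad \kappa_1=\Big(1-\frac{\alpha}{\kappa_0}\Big)^{-1},\qquad \kappa_2=\Big[\Big(1-\frac a\alpha\Big)\Big(1-\frac{\alpha_*}\alpha\Big)\Big]^{-1}.$$ Let $\Psi$ be continuous on $\bar U\times[0,\infty)$, with $\nabla\Psi$ and $\Psi_t$ existing and continuous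 on $U\times[0,\infty)$. Let $p$ be a solution of $$p_t=\nabla\cdot\big(K(|\nabla p|)\nabla p\big)\ \text{ in } U\times(0,\infty),\qquad p(\cdot,0)=p_0\ \text{ in }U,\qquad p=\Psi\ \text{ on }\Gamma\times(0,\infty),$$ in the following sense: $p$ is continuous on $\bar U\times(0,\infty)$; $\nabla p$ and $p_t$ exist and are continuous on $U\times(0,\infty)$; for every $t>0$ and every $\varphi\in C^1_c(U)$, $\int_U p_t\varphi\,dx=-\int_U K(|\nabla p|)\nabla p\cdot\nabla\varphi\,dx$; the boundary condition holds pointwise; and $p_0\in L^\alpha(U)$ with $p(\cdot,t)\to p_0$ in $L^\alpha(U)$ as $t\to0^+$. Write $\bar p_0=p_0-\Psi(\cdot,0)$ and, with values in $[0,\infty]$, $$A(\alpha,t)=\Big[\int_U|\nabla\Psi(x,t)|^{\frac{\alpha(2-a)}2}dx\Big]^{\frac{2(\alpha-a)}{\alpha(2-a)}}+\Big[\int_U|\Psi_t(x,t)|^\alpha dx\Big]^{\frac{\alpha-a}{\alpha(1-a)}}\quad(t\ge 0),$$ $$A(\alpha)=\limsup_{t\to\infty}A(\alpha,t),\qquad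 \beta(\alpha)=\limsup_{t\to\infty}\,[A'(\alpha,t)]^-,\qquad [r]^-=\max\{-r,0\},$$ where $A'=\partial A/\partial t$, and whenever $\beta(\alpha)$ is used it is understood that $t\mapsto A(\alpha,t)$ is finite and of class $C^1$ on $(0,\infty)$. Let $Env\,A(\alpha,\cdot)$ denote any continuous, increasing function on $[0,\infty)$ with $Env\,A(\alpha,t)\ge A(\alpha,t)$ for all $t\ge 0$. **Theorem.** Let $U'\Subset U$. There is a constant $C>0$, depending only on $n$, $g$, $U$, $U'$ and $\alpha$ (in particular, not on $p$, $p_0$, $\Psi$, the choice of $Env\,A$, or $t$), such that for all $p$, $p_0$, $\Psi$ as above the following hold. (i) For every $Env\,A(\alpha,\cdot)$ as above: if $t\in(0,1)$ then $$\|p(t)\|_{L^\infty(U')}\le C\,t^{-\frac{\kappa_1}{\alpha-a}}\Big(1+\|\bar p_0\|_{L^\alpha(U)}+[Env\,A(\alpha,t)]^{\frac1{\alpha-a}}+\|\Psi\|_{L^\alpha(U\times(0,t))}\Big)^{\kappa_2},$$ and if $t\ge1$ then $$\|p(t)\|_{L^\infty(U')}\le C\Big(1+\|\bar p_0\|_{L^\alpha(U)}+[Env\,A(\alpha,t)]^{\frac1{\alpha-a}}+\|\Psi\|_{L^\alpha(U\times(t-1,t))}\Big)^{\kappa_2}.$$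 (ii) If $A(\alpha)<\infty$ then $$\limsup_{t\to\infty}\|p(t)\|_{L^\infty(U')}\le C\Big(1+A(\alpha)^{\frac1{\alpha-a}}+\limsup_{t\to\infty}\|\Psi\|_{L^\alpha(U\times(t-1,t))}\Big)^{\kappa_2}$$ (the right-hand side may be $+\infty$). (iii) If $\beta(\alpha)<\infty$ then there is $T>0$ such that, for all $t\ge T$, $$\|p(t)\|_{L^\infty(U')}\le C\Big(1+\beta(\alpha)^{\frac1{\alpha-2a}}+\|A(\alpha,\cdot)\|_{L^{\frac{\alpha}{\alpha-a}}(t-1,t)}^{\frac1{\alpha-a}}+\|\Psi\|_{L^\alpha(U\times(t-1,t))}\Big)^{\kappa_2}.$$ -/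

import Mathlib

open MeasureTheory Filter Topology Set
open scoped ENNReal NNReal

noncomputable section

namespace Forchheimer

/-- Points of `ℝⁿ` with the Euclidean norm. -/
abbrev Pt (n : ℕ) : Type := EuclideanSpace ℝ (Fin n)

/-- A generalized Forchheimer polynomial `g(s) = a₀ s^{α₀} + ⋯ + a_N s^{α_N}` with `N ≥ 1`, real
exponents `0 = α₀ < α₁ < ⋯ < α_N`, coefficients `aᵢ ≥ 0`, `a₀ > 0` and `a_N > 0`. -/
structure Poly where
  N : ℕ
  one_le_N : 1 ≤ N
  expo : Fin (N + 1) → ℝ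
  coef : Fin (N + 1) → ℝ
  expo_zero : expo 0 = 0
  expo_strictMono : StrictMono expo
  coef_nonneg : ∀ i, 0 ≤ coef i
  coef_zero_pos : 0 < coef 0
  coef_last_pos : 0 < coef (Fin.last N)

namespace Poly

variable (g : Poly)

/-- The value `g(s)`, for `s ≥ 0`. -/
def val (s : ℝ) : ℝ := ∑ i, g.coef i * s ^ g.expo i

/-- The degree `α_N`. -/
def deg : ℝ := g.expo (Fin.last g.N)

/-- The number `a = α_N / (1 + α_N)`. -/
def a : ℝ := g.deg / (1 + g.deg)

/-- The root `s = s(ξ) ≥ 0` of `s g(s) = ξ`, for `ξ ≥ 0`; by `exists_unique_speed` the set below has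
exactly one element. -/
def speed (ξ : ℝ) : ℝ := sInf {s : ℝ | 0 ≤ s ∧ s * g.val s = ξ}

/-- The function `K(ξ) = 1 / g(s(ξ))`, for `ξ ≥ 0`. -/
def K (ξ : ℝ) : ℝ := 1 / g.val (g.speed ξ)

theorem expo_nonneg (i : Fin (g.N + 1)) : 0 ≤ g.expo i := by
  rw [← g.expo_zero]; exact g.expo_strictMono.monotone (Fin.zero_le i)

theorem coef_zero_le_val {s : ℝ} (hs : 0 ≤ s) : g.coef 0 ≤ g.val s := by
  have h := Finset.single_le_sum (f := fun i => g.coef i * s ^ g.expo i)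
    (fun i _ => mul_nonneg (g.coef_nonneg i) (Real.rpow_nonneg hs _)) (Finset.mem_univ 0)
  simpa [val, g.expo_zero] using h

theorem val_mono {s t : ℝ} (hs : 0 ≤ s) (hst : s ≤ t) : g.val s ≤ g.val t :=
  Finset.sum_le_sum fun i _ =>
    mul_le_mul_of_nonneg_left (Real.rpow_le_rpow hs hst (g.expo_nonneg i)) (g.coef_nonneg i)

theorem continuous_val : Continuous g.val :=
  continuous_finsetSum _ fun i _ =>
    continuous_const.mul (Real.continuous_rpow_const (g.expo_nonneg i))

theorem exists_unique_speed {ξ : ℝ} (hξ : 0 ≤ ξ) : ∃! s : ℝ, 0 ≤ s ∧ s * g.val s = ξ := by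
  have h0 := g.coef_zero_pos
  have hb : 0 ≤ ξ / g.coef 0 := by positivity
  obtain ⟨s, hs, hs'⟩ := intermediate_value_Icc (f := fun s => s * g.val s) hb
    (continuous_id.mul g.continuous_val).continuousOn
    (show ξ ∈ Icc _ _ from ⟨by simpa using hξ, by
      calc ξ = ξ / g.coef 0 * g.coef 0 := by field_simp
        _ ≤ _ := mul_le_mul_of_nonneg_left (g.coef_zero_le_val hb) hb⟩)
  have key : ∀ u v : ℝ, 0 ≤ u → u < v → u * g.val u < v * g.val v := fun u v hu huv => by
    have h1 := g.val_mono hu huv.le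
    have h2 := g.coef_zero_le_val hu
    nlinarith
  refine ⟨s, ⟨hs.1, hs'⟩, fun t ht => ?_⟩
  rcases lt_trichotomy t s with h | h | h
  · have h3 := key t s ht.1 h
    simp only at hs'
    linarith [ht.2]
  · exact h
  · have h3 := key s t hs.1 h
    simp only at hs'
    linarith [ht.2]

theorem speed_spec {ξ : ℝ} (hξ : 0 ≤ ξ) : 0 ≤ g.speed ξ ∧ g.speed ξ * g.val (g.speed ξ) = ξ := by
  obtain ⟨s, hs, hu⟩ := g.exists_unique_speed hξ
  have h : {s : ℝ | 0 ≤ s ∧ s * g.val s = ξ} = {s} := by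
    ext t
    exact ⟨fun ht => hu t ht, fun ht => by rw [mem_singleton_iff.1 ht]; exact hs⟩
  have h' : g.speed ξ = s := by rw [speed, h, csInf_singleton]
  rw [h']; exact hs

end Poly

/-- The threshold exponent `α_* = a n / (2 - a)`. -/
def alphaStar (n : ℕ) (a : ℝ) : ℝ := a * n / (2 - a)

/-- `κ₀ = α (1 + (2 - a) / n) - a`. -/
def kappa0 (n : ℕ) (a α : ℝ) : ℝ := α * (1 + (2 - a) / n) - a

/-- `κ₁ = 1 / δ₁` with `δ₁ = 1 - α / κ₀`. -/
def kappa1 (n : ℕ) (a α : ℝ) : ℝ := 1 / (1 - α / kappa0 n a α)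

/-- `κ₂ = 1 / δ₂` with `δ₂ = (1 - a / α) (1 - α_* / α)`. -/
def kappa2 (n : ℕ) (a α : ℝ) : ℝ := 1 / ((1 - a / α) * (1 - alphaStar n a / α))

variable {n : ℕ}

/-- The time derivative `Ψ_t(x,t)` of a function of `x` and `t ≥ 0`, one-sided at `t = 0`. -/
def timeDeriv (Ψ : Pt n → ℝ → ℝ) (x : Pt n) (t : ℝ) : ℝ := derivWithin (Ψ x) (Ici 0) t

/-- Regularity of the extension `Ψ` of the boundary data: `Ψ` is continuous on `closure U × [0,∞)`,
and `∇Ψ`, `Ψ_t` exist and are continuous on `U × [0,∞)`. -/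
structure IsBoundaryExtension (U : Set (Pt n)) (Ψ : Pt n → ℝ → ℝ) : Prop where
  continuousOn : ContinuousOn (fun z : Pt n × ℝ => Ψ z.1 z.2) (closure U ×ˢ Ici 0)
  differentiableAt_space : ∀ x ∈ U, ∀ t, 0 ≤ t → DifferentiableAt ℝ (fun y => Ψ y t) x
  differentiableWithinAt_time : ∀ x ∈ U, ∀ t, 0 ≤ t → DifferentiableWithinAt ℝ (Ψ x) (Ici 0) t
  continuousOn_gradient :
    ContinuousOn (fun z : Pt n × ℝ => gradient (fun y => Ψ y z.2) z.1) (U ×ˢ Ici 0)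
  continuousOn_timeDeriv :
    ContinuousOn (fun z : Pt n × ℝ => timeDeriv Ψ z.1 z.2) (U ×ˢ Ici 0)

/-- `p` solves `p_t = ∇·(K(|∇p|)∇p)` in `U × (0,∞)`, `p = p₀` at `t = 0`, `p = Ψ` on
`∂U × (0,∞)`. The first derivatives of `p` are continuous in `U × (0,∞)`, `p` is continuous up to
the lateral boundary for positive times, the equation holds in the sense of distributions at each
time (so that second derivatives of `p` are not required), and the initial data are attained in
`L^α(U)`. -/
structure IsSolution (g : Poly) (U : Set (Pt n)) (α : ℝ) (p : Pt n → ℝ → ℝ) (p₀ : Pt n → ℝ)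
    (Ψ : Pt n → ℝ → ℝ) : Prop where
  continuousOn : ContinuousOn (fun z : Pt n × ℝ => p z.1 z.2) (closure U ×ˢ Ioi 0)
  differentiableAt_space : ∀ x ∈ U, ∀ t, 0 < t → DifferentiableAt ℝ (fun y => p y t) x
  differentiableAt_time : ∀ x ∈ U, ∀ t, 0 < t → DifferentiableAt ℝ (p x) t
  continuousOn_gradient :
    ContinuousOn (fun z : Pt n × ℝ => gradient (fun y => p y z.2) z.1) (U ×ˢ Ioi 0)
  continuousOn_timeDeriv :
    ContinuousOn (fun z : Pt n × ℝ => deriv (p z.1) z.2) (U ×ˢ Ioi 0)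
  equation : ∀ t, 0 < t → ∀ φ : Pt n → ℝ, ContDiff ℝ 1 φ → HasCompactSupport φ → tsupport φ ⊆ U →
    ∫ x in U, deriv (p x) t * φ x =
      - ∫ x in U, g.K ‖gradient (fun y => p y t) x‖ *
          inner ℝ (gradient (fun y => p y t) x) (gradient φ x)
  boundary : ∀ x ∈ frontier U, ∀ t, 0 < t → p x t = Ψ x t
  initial : ∀ x ∈ U, p x 0 = p₀ x
  initial_memLp : MemLp p₀ (ENNReal.ofReal α) (volume.restrict U)
  initial_tendsto : Tendsto
    (fun t => eLpNorm (fun x => p x t - p₀ x) (ENNReal.ofReal α) (volume.restrict U))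
    (𝓝[>] 0) (𝓝 0)

/-- `A(α,t) = [∫_U |∇Ψ|^{α(2-a)/2} dx]^{2(α-a)/(α(2-a))} + [∫_U |Ψ_t|^α dx]^{(α-a)/(α(1-a))}`. -/
def A (U : Set (Pt n)) (a α : ℝ) (Ψ : Pt n → ℝ → ℝ) (t : ℝ) : ℝ≥0∞ :=
  (∫⁻ x in U, ‖gradient (fun y => Ψ y t) x‖ₑ ^ (α * (2 - a) / 2))
      ^ (2 * (α - a) / (α * (2 - a))) +
    (∫⁻ x in U, ‖timeDeriv Ψ x t‖ₑ ^ α) ^ ((α - a) / (α * (1 - a)))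

/-- `A(α) = limsup_{t → ∞} A(α,t)`. -/
def Alim (U : Set (Pt n)) (a α : ℝ) (Ψ : Pt n → ℝ → ℝ) : ℝ≥0∞ :=
  limsup (fun t => A U a α Ψ t) atTop

/-- `t ↦ A(α,t)` is (finite and) of class `C¹` on `(0,∞)`. -/
def AIsC1 (U : Set (Pt n)) (a α : ℝ) (Ψ : Pt n → ℝ → ℝ) : Prop :=
  (∀ t, 0 < t → A U a α Ψ t ≠ ∞) ∧ ContDiffOn ℝ 1 (fun t => (A U a α Ψ t).toReal) (Ioi 0)

/-- `β(α) = limsup_{t → ∞} [A'(α,t)]⁻`, where `[r]⁻ = max(-r, 0)`. -/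
def beta (U : Set (Pt n)) (a α : ℝ) (Ψ : Pt n → ℝ → ℝ) : ℝ≥0∞ :=
  limsup (fun t => ENNReal.ofReal (-(deriv (fun s => (A U a α Ψ s).toReal) t))) atTop

/-- `F` is an envelope of `f ≥ 0`: continuous and increasing on `[0,∞)`, with `F ≥ f` there. -/
def IsEnvelope (f : ℝ → ℝ≥0∞) (F : ℝ → ℝ≥0) : Prop :=
  ContinuousOn F (Ici 0) ∧ MonotoneOn F (Ici 0) ∧ ∀ t, 0 ≤ t → f t ≤ F t

/-- `‖f‖_{L^α(U × (t₁,t₂))}`. -/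
def spaceTimeNorm (U : Set (Pt n)) (α : ℝ) (f : Pt n → ℝ → ℝ) (t₁ t₂ : ℝ) : ℝ≥0∞ :=
  eLpNorm (fun z : Pt n × ℝ => f z.1 z.2) (ENNReal.ofReal α) (volume.restrict (U ×ˢ Ioo t₁ t₂))

/-- `‖f(t)‖_{L^∞(V)}`. -/
def supNorm (V : Set (Pt n)) (f : Pt n → ℝ → ℝ) (t : ℝ) : ℝ≥0∞ :=
  eLpNorm (fun x => f x t) ∞ (volume.restrict V)

end Forchheimer

end

/-! ### Growth, continuity and coercivity of the conductivity K. -/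

namespace Forchheimer

namespace Poly

variable (g : Poly)

/-! Write r = 2 - a. The equation is degenerate, but K ≤ 1/a₀ and K(ξ)ξ² ≥ c ξ^r - C. The bounds
come from two energy arguments, one local and one global.

Local. Testing the equation with a regularized (α-1)-th power of (p - k)₊ times a squared cutoff
gives a Caccioppoli inequality (`exists_hasDerivAt_locEnergy_le`): the L^α energy, and the time
integral of the dissipation ∫ |∇p|^r (p - k)₊^{α-2}, are controlled by the space-time L^α mass above
the level k. Sobolev's inequality for a power of the truncation, combined with Hölder's
(`exists_locMass_le`), bounds the mass above a higher level by energy^{r/n} times dissipation. The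
homogeneities differ by the surplus αr/n - a, which is positive exactly when α > α_*; it is paid for
by a negative power of the level increment. Hence one step (`exists_deGiorgi_step`) bounds the new
mass by the old one to the power 1 + r/n, and De Giorgi's iteration (`exists_local_sup_bound`)
bounds p(T) on a compact set by a power of the mass over the time window (T - 2τ, T).

Global. To bound that mass one tests with a power of (p - Ψ - 1)₊. As p = Ψ on the boundary, this
function vanishes near it, so test functions in C¹_c(U) suffice and no cutoff term survives.
Sobolev's inequality turns the dissipation into y^{(α-a)/α}, where y is the energy, while Hölder's
and Young's inequalities turn the data into exactly the two powers that make up A. The outcome is y'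
≤ -c y^{(α-a)/α} + C(1 + A) (`exists_hasDerivAt_globEnergy_le`). Constant barriers give the energy
bounds for (i) and (ii) (`exists_globEnergy_le`). For (iii) the barrier is a multiple of (L +
A)^{α/(α-a)}; it does not fall faster than the solution is forced to, provided that L is large in
terms of β, and this works because α > 2a (`exists_forall_le_rpow_of_deriv_le`).

The equation is odd in p, so the same upper bounds applied to -p, -p₀, -Ψ control |p|. The exponents
obtained are at most κ₁/(α-a) and κ₂, and those of the theorem follow because the time window is
short and the bracket is at least 1. -/

theorem deg_pos : 0 < g.deg := by
  have h : (0 : Fin (g.N + 1)) < Fin.last g.N := by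
    rw [Fin.lt_def]; simpa using Nat.lt_of_lt_of_le Nat.zero_lt_one g.one_le_N
  have := g.expo_strictMono h
  rwa [g.expo_zero] at this

theorem a_pos : 0 < g.a := div_pos g.deg_pos (by linarith [g.deg_pos])

theorem a_lt_one : g.a < 1 := by
  rw [a, div_lt_one (by linarith [g.deg_pos])]; linarith

theorem two_sub_a : 2 - g.a = 1 + 1 / (1 + g.deg) := by
  have := g.deg_pos
  rw [a]; field_simp; ring

theorem val_pos {s : ℝ} (hs : 0 ≤ s) : 0 < g.val s :=
  g.coef_zero_pos.trans_le (g.coef_zero_le_val hs)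

theorem K_pos {ξ : ℝ} (hξ : 0 ≤ ξ) : 0 < g.K ξ :=
  one_div_pos.2 (g.val_pos (g.speed_spec hξ).1)

theorem K_le {ξ : ℝ} (hξ : 0 ≤ ξ) : g.K ξ ≤ 1 / g.coef 0 :=
  one_div_le_one_div_of_le g.coef_zero_pos (g.coef_zero_le_val (g.speed_spec hξ).1)

theorem K_mul_self {ξ : ℝ} (hξ : 0 ≤ ξ) : g.K ξ * ξ = g.speed ξ := by
  obtain ⟨h0, h⟩ := g.speed_spec hξ
  have := g.val_pos h0
  rw [K]
  nth_rewrite 2 [← h]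
  field_simp

/-- Subtract the two equations s g(s) = ξ and use g ≥ a₀ together with the monotonicity of g. This
makes s(ξ) Lipschitz, hence K continuous; no derivative of K is ever needed. -/
theorem coef_zero_mul_speed_sub_le {ξ ξ' : ℝ} (hξ : 0 ≤ ξ) (h : ξ ≤ ξ') :
    g.coef 0 * (g.speed ξ' - g.speed ξ) ≤ ξ' - ξ := by
  obtain ⟨h0, h1⟩ := g.speed_spec hξ
  obtain ⟨h0', h1'⟩ := g.speed_spec (hξ.trans h)
  rcases le_total (g.speed ξ) (g.speed ξ') with hs | hs
  · have h2 := g.val_mono h0 hs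
    have h3 := g.coef_zero_le_val h0
    nlinarith
  · have := g.coef_zero_pos
    nlinarith

theorem speed_mono {ξ ξ' : ℝ} (hξ : 0 ≤ ξ) (h : ξ ≤ ξ') : g.speed ξ ≤ g.speed ξ' := by
  obtain ⟨h0, h1⟩ := g.speed_spec hξ
  obtain ⟨h0', h1'⟩ := g.speed_spec (hξ.trans h)
  by_contra! hs
  have h2 := g.val_mono h0' hs.le
  have h3 := g.val_pos h0'
  nlinarith

theorem continuousOn_speed : ContinuousOn g.speed (Ici 0) := by
  have h0 := g.coef_zero_pos
  refine (LipschitzOnWith.of_dist_le_mul (K := ⟨1 / g.coef 0, by positivity⟩) ?_).continuousOn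
  have key : ∀ x y : ℝ, 0 ≤ x → x ≤ y →
      |g.speed y - g.speed x| ≤ 1 / g.coef 0 * |y - x| := by
    intro x y hx hxy
    rw [abs_of_nonneg (sub_nonneg.2 (g.speed_mono hx hxy)), abs_of_nonneg (sub_nonneg.2 hxy),
      one_div, inv_mul_eq_div, le_div_iff₀ h0, mul_comm]
    exact g.coef_zero_mul_speed_sub_le hx hxy
  intro x hx y hy
  simp only [Real.dist_eq]
  rcases le_total x y with h | h
  · rw [abs_sub_comm, abs_sub_comm x]; exact key x y hx h
  · exact key y x hy h

theorem continuousOn_K : ContinuousOn g.K (Ici 0) := by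
  refine ContinuousOn.div continuousOn_const
    (g.continuous_val.comp_continuousOn g.continuousOn_speed) fun ξ hξ => ?_
  exact (g.val_pos (g.speed_spec hξ).1).ne'

/-- The degenerate ellipticity of `K`: `K(ξ) ξ ≤ C ξ^{1-a}`. -/
theorem exists_speed_le : ∃ C : ℝ, 0 < C ∧ ∀ ξ : ℝ, 0 ≤ ξ → g.speed ξ ≤ C * ξ ^ (1 - g.a) := by
  have hN := g.coef_last_pos
  have hd := g.deg_pos
  have he : 1 - g.a = 1 / (1 + g.deg) := by linarith [g.two_sub_a]
  refine ⟨(1 / g.coef (Fin.last g.N)) ^ (1 / (1 + g.deg)), by positivity, fun ξ hξ => ?_⟩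
  obtain ⟨h0, h1⟩ := g.speed_spec hξ
  set s := g.speed ξ
  have hval : g.coef (Fin.last g.N) * s ^ g.deg ≤ g.val s :=
    Finset.single_le_sum (f := fun i => g.coef i * s ^ g.expo i)
      (fun i _ => mul_nonneg (g.coef_nonneg i) (Real.rpow_nonneg h0 _)) (Finset.mem_univ _)
  have h2 : s ^ (1 + g.deg) ≤ 1 / g.coef (Fin.last g.N) * ξ := by
    rw [one_div, inv_mul_eq_div, le_div_iff₀ hN, ← h1, Real.rpow_add_of_nonneg h0 zero_le_one hd.le,
      Real.rpow_one]
    nlinarith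
  rw [he, ← Real.mul_rpow (by positivity) hξ]
  calc s = (s ^ (1 + g.deg)) ^ (1 / (1 + g.deg)) := by
        rw [← Real.rpow_mul h0, mul_one_div_cancel (by positivity), Real.rpow_one]
    _ ≤ _ := Real.rpow_le_rpow (by positivity) h2 (by positivity)

/-- The coercivity of `K`: `c ξ^{2-a} - C ≤ K(ξ) ξ²`. -/
theorem exists_le_speed_mul : ∃ c C : ℝ, 0 < c ∧ 0 < C ∧
    ∀ ξ : ℝ, 0 ≤ ξ → c * ξ ^ (2 - g.a) - C ≤ g.speed ξ * ξ := by
  have hd := g.deg_pos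
  have ha := g.a_lt_one
  have he : 1 - g.a = 1 / (1 + g.deg) := by linarith [g.two_sub_a]
  set S : ℝ := ∑ i, g.coef i with hS
  have hSpos : 0 < S := Finset.sum_pos' (fun i _ => g.coef_nonneg i)
    ⟨0, Finset.mem_univ _, g.coef_zero_pos⟩
  refine ⟨(1 / S) ^ (1 / (1 + g.deg)), (1 / S) ^ (1 / (1 + g.deg)) * S ^ (2 - g.a),
    by positivity, by positivity, fun ξ hξ => ?_⟩
  obtain ⟨h0, h1⟩ := g.speed_spec hξ
  set s := g.speed ξ
  rcases le_total s 1 with hs | hs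
  · have hval : g.val s ≤ S := Finset.sum_le_sum fun i _ =>
      mul_le_of_le_one_right (g.coef_nonneg i) (Real.rpow_le_one h0 hs (g.expo_nonneg i))
    -- Since g(1) = S, the case s ≤ 1 only concerns ξ ≤ S, where the additive constant makes the
    -- left-hand side nonpositive.
    have h2 : ξ ≤ S := by
      have := g.val_pos h0
      nlinarith
    have h3 : ξ ^ (2 - g.a) ≤ S ^ (2 - g.a) := Real.rpow_le_rpow hξ h2 (by linarith)
    have h4 : 0 < (1 / S) ^ (1 / (1 + g.deg)) := by positivity
    have h5 : 0 ≤ s * ξ := by positivity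
    nlinarith
  · have hval : g.val s ≤ S * s ^ g.deg := by
      rw [hS, Finset.sum_mul]
      exact Finset.sum_le_sum fun i _ => mul_le_mul_of_nonneg_left
        (Real.rpow_le_rpow_of_exponent_le hs (g.expo_strictMono.monotone (Fin.le_last i)))
        (g.coef_nonneg i)
    have h2 : 1 / S * ξ ≤ s ^ (1 + g.deg) := by
      rw [one_div, inv_mul_eq_div, div_le_iff₀ hSpos, ← h1,
        Real.rpow_add_of_nonneg h0 zero_le_one hd.le, Real.rpow_one]
      nlinarith
    have h3 : (1 / S) ^ (1 / (1 + g.deg)) * ξ ^ (1 - g.a) ≤ s := by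
      rw [he, ← Real.mul_rpow (by positivity) hξ]
      calc (1 / S * ξ) ^ (1 / (1 + g.deg)) ≤ (s ^ (1 + g.deg)) ^ (1 / (1 + g.deg)) :=
            Real.rpow_le_rpow (by positivity) h2 (by positivity)
        _ = s := by rw [← Real.rpow_mul h0, mul_one_div_cancel (by positivity), Real.rpow_one]
    have h4 : ξ ^ (2 - g.a) = ξ ^ (1 - g.a) * ξ := by
      rw [show 2 - g.a = (1 - g.a) + 1 by ring,
        Real.rpow_add_of_nonneg hξ (by linarith) zero_le_one, Real.rpow_one]
    have h5 : 0 < (1 / S) ^ (1 / (1 + g.deg)) * S ^ (2 - g.a) := by positivity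
    rw [h4]
    nlinarith

theorem exists_le_K_mul_sq : ∃ c C : ℝ, 0 < c ∧ 0 < C ∧
    ∀ ξ : ℝ, 0 ≤ ξ → c * ξ ^ (2 - g.a) - C ≤ g.K ξ * ξ ^ 2 := by
  obtain ⟨c, C, hc, hC, h⟩ := g.exists_le_speed_mul
  refine ⟨c, C, hc, hC, fun ξ hξ => (h ξ hξ).trans_eq ?_⟩
  rw [← g.K_mul_self hξ]; ring

end Poly

/-- Comparison with twice the maximum works for every p ≥ 0, including the exponents below one that
occur in the global estimate, where convexity is not available. -/
theorem add_rpow_le {p x y : ℝ} (hp : 0 ≤ p) (hx : 0 ≤ x) (hy : 0 ≤ y) :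
    (x + y) ^ p ≤ 2 ^ p * (x ^ p + y ^ p) := by
  have h1 : x + y ≤ 2 * max x y := by
    rcases le_total x y with h | h
    · rw [max_eq_right h]; linarith
    · rw [max_eq_left h]; linarith
  calc (x + y) ^ p ≤ (2 * max x y) ^ p := Real.rpow_le_rpow (by positivity) h1 hp
    _ = 2 ^ p * (max x y) ^ p := Real.mul_rpow (by norm_num) (le_max_of_le_left hx)
    _ ≤ _ := by
      gcongr
      rcases le_total x y with h | h
      · rw [max_eq_right h]; linarith [Real.rpow_nonneg hx p]
      · rw [max_eq_left h]; linarith [Real.rpow_nonneg hy p]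

/-- Coercivity of the flux tested with the gradient of the difference `p - Ψ`. -/
theorem Poly.exists_le_K_mul_inner (g : Poly) (E : Type*) [NormedAddCommGroup E]
    [InnerProductSpace ℝ E] : ∃ c C : ℝ, 0 < c ∧ 0 < C ∧ ∀ P Q : E,
      c * ‖P - Q‖ ^ (2 - g.a) - C * (1 + ‖Q‖ ^ (2 - g.a)) ≤ g.K ‖P‖ * inner ℝ P (P - Q) := by
  obtain ⟨c, C, hc, hC, h⟩ := g.exists_le_K_mul_sq
  obtain ⟨D, hD, hs⟩ := g.exists_speed_le
  have ha := g.a_lt_one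
  set r : ℝ := 2 - g.a with hr
  set ε : ℝ := c / (2 * D) with hε
  have hεpos : 0 < ε := by positivity
  set M : ℝ := D * (1 / ε) ^ (1 - g.a)
  have hM : 0 < M := by positivity
  refine ⟨c / 2 / 2 ^ r, C + c + M, by positivity, by positivity, fun P Q => ?_⟩
  have hP := norm_nonneg P
  have hQ := norm_nonneg Q
  have h1 : g.K ‖P‖ * inner ℝ P (P - Q) ≥ g.K ‖P‖ * ‖P‖ ^ 2 - g.speed ‖P‖ * ‖Q‖ := by
    rw [inner_sub_right, real_inner_self_eq_norm_sq, ← g.K_mul_self hP]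
    have := mul_le_mul_of_nonneg_left (real_inner_le_norm P Q) (g.K_pos hP).le
    nlinarith
  -- Young's inequality by cases: if ‖Q‖ ≤ ε‖P‖, the choice ε = c/(2D) costs half of the coercive
  -- term; otherwise ‖P‖ is dominated by ‖Q‖.
  have h2 : g.speed ‖P‖ * ‖Q‖ ≤ c / 2 * ‖P‖ ^ r + M * ‖Q‖ ^ r := by
    have hr1 : ∀ x : ℝ, 0 ≤ x → x ^ r = x ^ (1 - g.a) * x := fun x hx => by
      rw [hr, show 2 - g.a = (1 - g.a) + 1 by ring,
        Real.rpow_add_of_nonneg hx (by linarith) zero_le_one, Real.rpow_one]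
    have h3 := hs ‖P‖ hP
    rcases le_total ‖Q‖ (ε * ‖P‖) with hle | hle
    · calc g.speed ‖P‖ * ‖Q‖ ≤ (D * ‖P‖ ^ (1 - g.a)) * (ε * ‖P‖) := by gcongr
        _ = c / 2 * ‖P‖ ^ r := by rw [hr1 _ hP, hε]; field_simp
        _ ≤ _ := by have : 0 ≤ M * ‖Q‖ ^ r := by positivity
                    linarith
    · have h4 : ‖P‖ ≤ 1 / ε * ‖Q‖ := by
        rw [one_div, inv_mul_eq_div, le_div_iff₀ hεpos]; linarith
      calc g.speed ‖P‖ * ‖Q‖ ≤ (D * (1 / ε * ‖Q‖) ^ (1 - g.a)) * ‖Q‖ := by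
            gcongr
            refine h3.trans ?_
            gcongr
        _ = M * ‖Q‖ ^ r := by rw [hr1 _ hQ, Real.mul_rpow (by positivity) hQ]; ring
        _ ≤ _ := by have : 0 ≤ c / 2 * ‖P‖ ^ r := by positivity
                    linarith
  have h5 : ‖P - Q‖ ^ r ≤ 2 ^ r * (‖P‖ ^ r + ‖Q‖ ^ r) :=
    (Real.rpow_le_rpow (norm_nonneg _) (norm_sub_le P Q) (by linarith)).trans
      (add_rpow_le (by linarith) hP hQ)
  have h6 : c / 2 / 2 ^ r * ‖P - Q‖ ^ r ≤ c / 2 * (‖P‖ ^ r + ‖Q‖ ^ r) := by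
    calc _ ≤ c / 2 / 2 ^ r * (2 ^ r * (‖P‖ ^ r + ‖Q‖ ^ r)) := by gcongr
      _ = _ := by field_simp
  have h7 := h ‖P‖ hP
  have h8 : 0 ≤ ‖Q‖ ^ r := by positivity
  nlinarith

end Forchheimer

namespace Forchheimer

/-! ### Smoothed powers of the positive part -/

/-- The vanishing slope at 0 glues `h` to its constant extension: since |max s 0| ≤ |s|, the
first-order remainder of `h` at 0 is still small on both sides. It makes the truncated profiles C¹,
hence admissible in test functions. -/
theorem hasDerivAt_comp_max_zero {h h' : ℝ → ℝ} (hd : ∀ s, 0 ≤ s → HasDerivAt h (h' s) s)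
    (h0 : h' 0 = 0) (s : ℝ) : HasDerivAt (fun s => h (max s 0)) (h' (max s 0)) s := by
  rcases lt_trichotomy s 0 with hs | rfl | hs
  · rw [max_eq_right hs.le, h0]
    refine (hasDerivAt_const s (h 0)).congr_of_eventuallyEq ?_
    filter_upwards [Iio_mem_nhds hs] with u hu
    rw [max_eq_right (le_of_lt hu)]
  · rw [max_self, h0]
    have h1 := hd 0 le_rfl
    rw [h0, hasDerivAt_iff_isLittleO] at h1
    rw [hasDerivAt_iff_isLittleO]
    have h2 : Tendsto (fun s : ℝ => max s 0) (𝓝 0) (𝓝 0) := by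
      simpa using (continuous_id.max continuous_const : Continuous fun s : ℝ => max s 0).tendsto 0
    have h3 := h1.comp_tendsto h2
    simp only [Function.comp_def, smul_zero, sub_zero, max_self] at h3 ⊢
    refine h3.trans_le fun x => ?_
    rcases le_total x 0 with hx | hx
    · simp [max_eq_right hx]
    · simp [max_eq_left hx]
  · rw [max_eq_left hs.le]
    refine (hd s hs.le).congr_of_eventuallyEq ?_
    filter_upwards [Ioi_mem_nhds hs] with u hu
    rw [max_eq_left (le_of_lt hu)]

/-- The weight `s₊^α / (s₊ + δ)²`, a regularization of `s₊^{α-2}`. -/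
noncomputable def wt (α δ s : ℝ) : ℝ := max s 0 ^ α / (max s 0 + δ) ^ 2

/-- The test profile `s₊^{α+1} / (s₊ + δ)²`, a regularization of `s₊^{α-1}`. -/
noncomputable def eta (α δ s : ℝ) : ℝ := max s 0 * wt α δ s

/-- The derivative of `eta`. -/
noncomputable def etaDeriv (α δ s : ℝ) : ℝ :=
  wt α δ s * (((α - 1) * max s 0 + (α + 1) * δ) / (max s 0 + δ))

/-- The primitive of `eta`, a regularization of `s₊^α / α`. -/
noncomputable def Phi (α δ s : ℝ) : ℝ := ∫ u in (0 : ℝ)..s, eta α δ u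

/-- The Sobolev profile, whose derivative is comparable to `wt ^ (1 / r)`. -/
noncomputable def Wp (α r δ s : ℝ) : ℝ := max s 0 ^ (1 + α / r) * (max s 0 + δ) ^ (-(2 / r))

/-- The derivative of `Wp`. -/
noncomputable def WpDeriv (α r δ s : ℝ) : ℝ :=
  (1 + α / r) * max s 0 ^ (α / r) * (max s 0 + δ) ^ (-(2 / r)) +
    max s 0 ^ (1 + α / r) * (-(2 / r) * (max s 0 + δ) ^ (-(2 / r) - 1))

section profiles

variable {α δ r : ℝ}

theorem wt_nonneg (s : ℝ) : 0 ≤ wt α δ s := by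
  have : 0 ≤ max s 0 := le_max_right _ _
  unfold wt; positivity

theorem eta_nonneg (s : ℝ) : 0 ≤ eta α δ s := mul_nonneg (le_max_right _ _) (wt_nonneg s)

theorem continuous_wt (hα : 2 ≤ α) (hδ : 0 < δ) : Continuous (wt α δ) := by
  unfold wt
  refine Continuous.div ?_ (by fun_prop) fun s => ?_
  · exact (continuous_id.max continuous_const).rpow_const fun _ => Or.inr (by linarith)
  · have : 0 ≤ max s 0 := le_max_right _ _
    positivity

theorem continuous_eta (hα : 2 ≤ α) (hδ : 0 < δ) : Continuous (eta α δ) :=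
  (continuous_id.max continuous_const).mul (continuous_wt hα hδ)

theorem continuous_etaDeriv (hα : 2 ≤ α) (hδ : 0 < δ) : Continuous (etaDeriv α δ) := by
  refine (continuous_wt hα hδ).mul (Continuous.div (by fun_prop) (by fun_prop) fun s => ?_)
  have : 0 ≤ max s 0 := le_max_right _ _
  positivity

theorem hasDerivAt_eta (hα : 2 ≤ α) (hδ : 0 < δ) (s : ℝ) :
    HasDerivAt (eta α δ) (etaDeriv α δ s) s := by
  have := hasDerivAt_comp_max_zero (h := fun s => s * (s ^ α / (s + δ) ^ 2))
    (h' := fun s => s ^ α / (s + δ) ^ 2 * (((α - 1) * s + (α + 1) * δ) / (s + δ)))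
    (fun s hs => ?_) ?_ s
  · exact this
  · have h1 : HasDerivAt (fun s : ℝ => s ^ α) (α * s ^ (α - 1)) s :=
      Real.hasDerivAt_rpow_const (Or.inr (by linarith))
    have h2 : HasDerivAt (fun s : ℝ => (s + δ) ^ 2) (2 * (s + δ)) s := by
      simpa using! ((hasDerivAt_id s).add_const δ).pow 2
    have h3 : (s + δ) ^ 2 ≠ 0 := by positivity
    have h3' : s + δ ≠ 0 := by positivity
    refine ((hasDerivAt_id s).mul (h1.div h2 h3)).congr_deriv ?_
    have h4 : s ^ α = s * s ^ (α - 1) := by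
      rcases hs.eq_or_lt with rfl | hs
      · rw [Real.zero_rpow (by linarith), zero_mul]
      · rw [Real.rpow_sub_one hs.ne']; field_simp
    simp only [id_eq, Pi.div_apply]
    rw [h4]
    field_simp
    ring
  · simp [Real.zero_rpow (by linarith : α ≠ 0)]

/-- The quotient of the two sides lies between α - 1 and α + 1, and α ≥ 2 makes the lower bound at
least one. -/
theorem wt_le_etaDeriv (hα : 2 ≤ α) (hδ : 0 < δ) (s : ℝ) : wt α δ s ≤ etaDeriv α δ s := by
  have h : 0 ≤ max s 0 := le_max_right _ _
  refine le_mul_of_one_le_right (wt_nonneg s) ?_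
  rw [one_le_div (by positivity)]
  nlinarith

theorem etaDeriv_le (hδ : 0 < δ) (s : ℝ) :
    etaDeriv α δ s ≤ (α + 1) * wt α δ s := by
  have h : 0 ≤ max s 0 := le_max_right _ _
  rw [etaDeriv, mul_comm]
  refine mul_le_mul_of_nonneg_right ?_ (wt_nonneg s)
  rw [div_le_iff₀ (by positivity)]
  nlinarith

theorem wt_of_nonpos (hα : 2 ≤ α) {s : ℝ} (hs : s ≤ 0) : wt α δ s = 0 := by
  rw [wt, max_eq_right hs, Real.zero_rpow (by linarith), zero_div]

theorem eta_of_nonpos {s : ℝ} (hs : s ≤ 0) : eta α δ s = 0 := by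
  rw [eta, max_eq_right hs, zero_mul]

theorem etaDeriv_of_nonpos (hα : 2 ≤ α) {s : ℝ} (hs : s ≤ 0) : etaDeriv α δ s = 0 := by
  rw [etaDeriv, wt_of_nonpos hα hs, zero_mul]

theorem Wp_of_nonpos (hα : 2 ≤ α) (hr : 0 < r) {s : ℝ} (hs : s ≤ 0) : Wp α r δ s = 0 := by
  rw [Wp, max_eq_right hs, Real.zero_rpow (by positivity), zero_mul]

theorem Phi_of_nonpos {s : ℝ} (hs : s ≤ 0) : Phi α δ s = 0 := by
  rw [Phi, intervalIntegral.integral_symm, intervalIntegral.integral_congr (g := fun _ => 0)]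
  · simp
  · intro u hu
    rw [uIcc_of_le hs] at hu
    exact eta_of_nonpos hu.2

theorem hasDerivAt_Phi (hα : 2 ≤ α) (hδ : 0 < δ) (s : ℝ) :
    HasDerivAt (Phi α δ) (eta α δ s) s :=
  (continuous_eta hα hδ).integral_hasStrictDerivAt 0 s |>.hasDerivAt

theorem continuous_Phi (hα : 2 ≤ α) (hδ : 0 < δ) : Continuous (Phi α δ) :=
  continuous_iff_continuousAt.2 fun s => (hasDerivAt_Phi hα hδ s).continuousAt

theorem sq_mul_wt_le (hδ : 0 < δ) (s : ℝ) :
    max s 0 ^ 2 * wt α δ s ≤ max s 0 ^ α := by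
  have h : 0 ≤ max s 0 := le_max_right _ _
  rw [wt, mul_div_assoc', div_le_iff₀ (by positivity), mul_comm]
  gcongr
  linarith

theorem wt_le_rpow (hα : 2 ≤ α) (hδ : 0 < δ) (s : ℝ) : wt α δ s ≤ max s 0 ^ (α - 2) := by
  rcases le_or_gt s 0 with hs | hs
  · rw [wt_of_nonpos hα hs]; exact Real.rpow_nonneg (le_max_right _ _) _
  · have h : 0 < max s 0 := lt_max_of_lt_left hs
    rw [wt, div_le_iff₀ (by positivity), Real.rpow_sub h, Real.rpow_two, div_mul_eq_mul_div,
      le_div_iff₀ (by positivity)]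
    gcongr
    linarith

/-- This is what the regularization buys. The additive constant in the coercivity of K leaves an
integral of the weight, and with the pure power s₊^{α-2} it could not be bounded by the L^α mass;
here it can, at the price 1/δ². -/
theorem wt_le_div (hδ : 0 < δ) (s : ℝ) : wt α δ s ≤ max s 0 ^ α / δ ^ 2 := by
  have h : 0 ≤ max s 0 := le_max_right _ _
  rw [wt]
  gcongr
  linarith

theorem eta_le_rpow (hα : 2 ≤ α) (hδ : 0 < δ) (s : ℝ) : eta α δ s ≤ max s 0 ^ (α - 1) := by
  have h : 0 ≤ max s 0 := le_max_right _ _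
  calc eta α δ s ≤ max s 0 * max s 0 ^ (α - 2) :=
        mul_le_mul_of_nonneg_left (wt_le_rpow hα hδ s) h
    _ = max s 0 ^ (α - 1) := by
      rw [show α - 1 = 1 + (α - 2) by ring, Real.rpow_add_of_nonneg h zero_le_one (by linarith),
        Real.rpow_one]

theorem Phi_nonneg (s : ℝ) : 0 ≤ Phi α δ s := by
  rcases le_total s 0 with hs | hs
  · rw [Phi_of_nonpos hs]
  · exact intervalIntegral.integral_nonneg hs fun u _ => eta_nonneg u

theorem Phi_le (hα : 2 ≤ α) (hδ : 0 < δ) (s : ℝ) : Phi α δ s ≤ max s 0 ^ α := by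
  rcases le_or_gt s 0 with hs | hs
  · rw [Phi_of_nonpos hs]; exact Real.rpow_nonneg (le_max_right _ _) _
  · calc Phi α δ s ≤ ∫ _ in (0 : ℝ)..s, s ^ (α - 1) := by
          refine intervalIntegral.integral_mono_on hs.le
            ((continuous_eta hα hδ).intervalIntegrable _ _) (by simp) fun u hu => ?_
          refine (eta_le_rpow hα hδ u).trans ?_
          rw [max_eq_left hu.1]
          exact Real.rpow_le_rpow hu.1 hu.2 (by linarith)
      _ = max s 0 ^ α := by
          rw [intervalIntegral.integral_const, max_eq_left hs.le, Real.rpow_sub_one hs.ne']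
          simp; field_simp

theorem wt_ge (hδ : 0 < δ) {s : ℝ} (hs : δ ≤ s) : s ^ (α - 2) / 4 ≤ wt α δ s := by
  have h : 0 < s := hδ.trans_le hs
  rw [wt, max_eq_left h.le, Real.rpow_sub h, Real.rpow_two, div_div]
  gcongr
  nlinarith

/-- Only the upper half [s/2, s] of the interval of integration is used; there u ≥ δ, so the weight
is comparable to u^{α-2}. -/
theorem Phi_ge (hα : 2 ≤ α) (hδ : 0 < δ) {s : ℝ} (hs : 2 * δ ≤ s) :
    s ^ α / (4 * 2 ^ α) ≤ Phi α δ s := by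
  have h : 0 < s := by linarith
  have hi := fun u v => (continuous_eta hα hδ).intervalIntegrable (μ := volume) u v
  rw [Phi, ← intervalIntegral.integral_add_adjacent_intervals (hi 0 (s / 2)) (hi (s / 2) s)]
  have h1 : 0 ≤ ∫ u in (0 : ℝ)..(s / 2), eta α δ u :=
    intervalIntegral.integral_nonneg (by linarith) fun u _ => eta_nonneg u
  have h2 : ∫ _ in (s / 2)..s, (s / 2) ^ (α - 1) / 4 ≤ ∫ u in (s / 2)..s, eta α δ u := by
    refine intervalIntegral.integral_mono_on (by linarith) (by simp) (hi _ _) fun u hu => ?_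
    have hu0 : 0 < u := by linarith [hu.1]
    calc (s / 2) ^ (α - 1) / 4 ≤ u ^ (α - 1) / 4 := by
          gcongr
          · linarith
          · exact hu.1
      _ = u * (u ^ (α - 2) / 4) := by
          rw [show α - 1 = 1 + (α - 2) by ring, Real.rpow_add hu0, Real.rpow_one]; ring
      _ ≤ _ := by
          rw [eta, max_eq_left hu0.le]
          exact mul_le_mul_of_nonneg_left (wt_ge hδ (by linarith [hu.1])) hu0.le
  rw [intervalIntegral.integral_const] at h2
  have h3 : (s - s / 2) • ((s / 2) ^ (α - 1) / 4) = s ^ α / (4 * 2 ^ α) := by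
    rw [Real.rpow_sub_one (by positivity), Real.div_rpow h.le (by norm_num), smul_eq_mul]
    field_simp
    ring
  linarith

theorem Wp_nonneg (hδ : 0 < δ) (s : ℝ) : 0 ≤ Wp α r δ s := by
  have h : 0 ≤ max s 0 := le_max_right _ _
  unfold Wp; positivity

theorem continuous_WpDeriv (hα : 2 ≤ α) (hr : 0 < r) (hδ : 0 < δ) :
    Continuous (WpDeriv α r δ) := by
  have h1 : Continuous fun s : ℝ => max s 0 := continuous_id.max continuous_const
  have h2 : ∀ q : ℝ, 0 ≤ q → Continuous fun s : ℝ => max s 0 ^ q := fun q hq =>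
    h1.rpow_const fun _ => Or.inr hq
  have h3 : ∀ q : ℝ, Continuous fun s : ℝ => (max s 0 + δ) ^ q := fun q =>
    (h1.add continuous_const).rpow_const fun s => 
      Or.inl (add_pos_of_nonneg_of_pos (le_max_right _ _) hδ).ne'
  unfold WpDeriv
  exact ((continuous_const.mul (h2 (α / r) (by positivity))).mul (h3 _)).add
    ((h2 (1 + α / r) (by positivity)).mul (continuous_const.mul (h3 _)))

theorem hasDerivAt_Wp (hα : 2 ≤ α) (hr : 0 < r) (hδ : 0 < δ) (s : ℝ) :
    HasDerivAt (Wp α r δ) (WpDeriv α r δ s) s := by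
  have hαr : 0 < α / r := by positivity
  refine hasDerivAt_comp_max_zero (h := fun s => s ^ (1 + α / r) * (s + δ) ^ (-(2 / r)))
    (h' := fun s => (1 + α / r) * s ^ (α / r) * (s + δ) ^ (-(2 / r)) +
      s ^ (1 + α / r) * (-(2 / r) * (s + δ) ^ (-(2 / r) - 1))) (fun s hs => ?_) ?_ s
  · have h1 : HasDerivAt (fun s : ℝ => s ^ (1 + α / r)) ((1 + α / r) * s ^ (α / r)) s := by
      convert! Real.hasDerivAt_rpow_const (x := s) (p := 1 + α / r) (Or.inr (by linarith)) using 2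
      ring_nf
    have h2 : HasDerivAt (fun s : ℝ => (s + δ) ^ (-(2 / r)))
        (-(2 / r) * (s + δ) ^ (-(2 / r) - 1)) s := by
      have := ((hasDerivAt_id s).add_const δ).rpow_const (p := -(2 / r))
        (Or.inl (by simp only [id]; positivity))
      simpa using this
    exact h1.mul h2
  · rw [Real.zero_rpow hαr.ne', Real.zero_rpow (by positivity)]
    simp

theorem rpow_mul_rpow_rpow_eq_wt (hr : 0 < r) (hδ : 0 < δ) (s : ℝ) :
    (max s 0 ^ (α / r) * (max s 0 + δ) ^ (-(2 / r))) ^ r = wt α δ s := by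
  have h : 0 ≤ max s 0 := le_max_right _ _
  rw [Real.mul_rpow (by positivity) (by positivity), ← Real.rpow_mul h,
    ← Real.rpow_mul (by positivity), div_mul_cancel₀ _ hr.ne', neg_mul, div_mul_cancel₀ _ hr.ne',
    Real.rpow_neg (by positivity), wt, Real.rpow_two, div_eq_mul_inv]

theorem Wp_rpow (hα : 2 ≤ α) (hr : 0 < r) (hδ : 0 < δ) (s : ℝ) :
    Wp α r δ s ^ r = max s 0 ^ r * wt α δ s := by
  have h : 0 ≤ max s 0 := le_max_right _ _
  rw [← rpow_mul_rpow_rpow_eq_wt hr hδ, Wp,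
    Real.rpow_add_of_nonneg h zero_le_one (by positivity), Real.rpow_one, mul_assoc,
    Real.mul_rpow h (by positivity)]

/-- The derivative equals X(1 + α/r - (2/r) s₊/(s₊ + δ)) with X^r equal to the weight, and α ≥ 2
keeps the bracket between 0 and 1 + α/r. Consequently the dissipation controls the r-th power of the
gradient of the Sobolev profile of p. -/
theorem abs_WpDeriv_rpow_le (hα : 2 ≤ α) (hr : 0 < r) (hδ : 0 < δ) (s : ℝ) :
    |WpDeriv α r δ s| ^ r ≤ (1 + α / r) ^ r * wt α δ s := by
  have h : 0 ≤ max s 0 := le_max_right _ _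
  have h' : 0 < max s 0 + δ := by positivity
  set X := max s 0 ^ (α / r) * (max s 0 + δ) ^ (-(2 / r)) with hX
  have hX0 : 0 ≤ X := by positivity
  have h1 : WpDeriv α r δ s = X * (1 + α / r - 2 / r * (max s 0 / (max s 0 + δ))) := by
    rw [WpDeriv, Real.rpow_sub_one h'.ne', Real.rpow_add_of_nonneg h zero_le_one (by positivity),
      Real.rpow_one, hX]
    field_simp
    ring
  have h2 : max s 0 / (max s 0 + δ) ≤ 1 := by rw [div_le_one h']; linarith
  have h3 : 0 ≤ max s 0 / (max s 0 + δ) := by positivity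
  have h4 : 2 / r ≤ α / r := by gcongr
  have h5 : 0 < 2 / r := by positivity
  have h6 : 0 ≤ 1 + α / r - 2 / r * (max s 0 / (max s 0 + δ)) := by nlinarith
  have h7 : |WpDeriv α r δ s| ≤ (1 + α / r) * X := by
    rw [h1, abs_of_nonneg (by positivity), mul_comm]
    refine mul_le_mul_of_nonneg_right ?_ hX0
    nlinarith
  calc |WpDeriv α r δ s| ^ r ≤ ((1 + α / r) * X) ^ r :=
        Real.rpow_le_rpow (abs_nonneg _) h7 hr.le
    _ = _ := by rw [Real.mul_rpow (by positivity) hX0, hX, rpow_mul_rpow_rpow_eq_wt hr hδ]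

theorem rpow_le_one_add_sq {s : ℝ} (hs : 0 ≤ s) (hr : 0 < r) (hr2 : r ≤ 2) :
    s ^ r ≤ 1 + s ^ 2 := by
  rcases le_total s 1 with h | h
  · have := Real.rpow_le_one hs h hr.le
    nlinarith [sq_nonneg s]
  · have := Real.rpow_le_rpow_of_exponent_le h hr2
    rw [Real.rpow_two] at this
    linarith

theorem Wp_rpow_ge (hα : 2 ≤ α) (hr : 0 < r) (hδ : 0 < δ) {s : ℝ} (hs : δ ≤ s) :
    s ^ (α - 2 + r) / 4 ≤ Wp α r δ s ^ r := by
  have h : 0 < s := hδ.trans_le hs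
  rw [Wp_rpow hα hr hδ, max_eq_left h.le, Real.rpow_add h]
  have := wt_ge (α := α) hδ hs
  have h2 : 0 ≤ s ^ r := by positivity
  nlinarith

/-- Powers above the level `2 δ` are controlled by the product that the parabolic Sobolev
inequality bounds. -/
theorem max_sub_rpow_le (hα : 2 ≤ α) (hr : 0 < r) {μ : ℝ} (hμ : 0 ≤ μ)
    (hκ : 2 ≤ r + α * μ) (hδ : 0 < δ) (s : ℝ) :
    max (s - 2 * δ) 0 ^ α ≤
      4 * (4 * 2 ^ α) ^ μ * δ ^ (2 - (r + α * μ)) * (Wp α r δ s ^ r * Phi α δ s ^ μ) := by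
  have hW : 0 ≤ Wp α r δ s := Wp_nonneg hδ s
  have hP : 0 ≤ Phi α δ s := Phi_nonneg s
  rcases le_or_gt s (2 * δ) with hs | hs
  · rw [max_eq_right (by linarith), Real.zero_rpow (by linarith)]
    positivity
  · have h : 0 < s := by linarith
    have h1 := Wp_rpow_ge (α := α) (r := r) hα hr hδ (s := s) (by linarith)
    have h2 := Phi_ge hα hδ hs.le
    rw [max_eq_left (by linarith)]
    have h3 : (s ^ α / (4 * 2 ^ α)) ^ μ ≤ Phi α δ s ^ μ := Real.rpow_le_rpow (by positivity) h2 hμ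
    -- The product being bounded from below grows like s^{α-2+r+αμ}; its surplus r + αμ - 2 over the
    -- power α is nonnegative and, because s > δ, can be traded for a power of δ.
    have h4 : s ^ (2 - (r + α * μ)) ≤ δ ^ (2 - (r + α * μ)) :=
      Real.rpow_le_rpow_of_nonpos hδ (by linarith) (by linarith)
    calc (s - 2 * δ) ^ α ≤ s ^ α := Real.rpow_le_rpow (by linarith) (by linarith) (by linarith)
      _ = 4 * (4 * 2 ^ α) ^ μ * s ^ (2 - (r + α * μ)) *
            ((s ^ (α - 2 + r) / 4) * (s ^ α / (4 * 2 ^ α)) ^ μ) := by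
          rw [Real.div_rpow (by positivity) (by positivity), ← Real.rpow_mul h.le]
          have : s ^ α = s ^ (2 - (r + α * μ)) * (s ^ (α - 2 + r) * s ^ (α * μ)) := by
            rw [← Real.rpow_add h, ← Real.rpow_add h]; ring_nf
          rw [this]
          field_simp
      _ ≤ _ := by gcongr

end profiles

end Forchheimer

namespace Forchheimer

/-! ### Integral inequalities -/

/-- Hölder's inequality in multiplicative form for integrable functions. -/
theorem integral_rpow_mul_rpow_le {X : Type*} [MeasurableSpace X] {μ : Measure X} {f g : X → ℝ}
    (hf : Integrable f μ) (hg : Integrable g μ) (hf0 : ∀ x, 0 ≤ f x) (hg0 : ∀ x, 0 ≤ g x)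
    {θ θ' : ℝ} (hθ : 0 ≤ θ) (hθ' : 0 ≤ θ') (h : θ + θ' = 1) :
    Integrable (fun x => f x ^ θ * g x ^ θ') μ ∧
      ∫ x, f x ^ θ * g x ^ θ' ∂μ ≤ (∫ x, f x ∂μ) ^ θ * (∫ x, g x ∂μ) ^ θ' := by
  have hm : AEStronglyMeasurable (fun x => f x ^ θ * g x ^ θ') μ :=
    ((hf.1.aemeasurable.pow_const θ).mul (hg.1.aemeasurable.pow_const θ')).aestronglyMeasurable
  have hn : ∀ x, 0 ≤ f x ^ θ * g x ^ θ' := fun x =>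
    mul_nonneg (Real.rpow_nonneg (hf0 x) _) (Real.rpow_nonneg (hg0 x) _)
  have key : ∫⁻ x, ENNReal.ofReal (f x ^ θ * g x ^ θ') ∂μ ≤
      ENNReal.ofReal ((∫ x, f x ∂μ) ^ θ * (∫ x, g x ∂μ) ^ θ') := by
    have h1 := ENNReal.lintegral_mul_norm_pow_le (μ := μ) (f := fun x => ENNReal.ofReal (f x))
      (g := fun x => ENNReal.ofReal (g x)) hf.1.aemeasurable.ennreal_ofReal
      hg.1.aemeasurable.ennreal_ofReal hθ hθ' h
    rw [← ofReal_integral_eq_lintegral_ofReal hf (ae_of_all _ hf0),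
      ← ofReal_integral_eq_lintegral_ofReal hg (ae_of_all _ hg0),
      ENNReal.ofReal_rpow_of_nonneg (integral_nonneg hf0) hθ,
      ENNReal.ofReal_rpow_of_nonneg (integral_nonneg hg0) hθ',
      ← ENNReal.ofReal_mul (Real.rpow_nonneg (integral_nonneg hf0) _)] at h1
    refine le_trans (le_of_eq (lintegral_congr fun x => ?_)) h1
    rw [ENNReal.ofReal_mul (Real.rpow_nonneg (hf0 x) _), ENNReal.ofReal_rpow_of_nonneg (hf0 x) hθ,
      ENNReal.ofReal_rpow_of_nonneg (hg0 x) hθ']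
  have hfin : Integrable (fun x => f x ^ θ * g x ^ θ') μ := by
    refine ⟨hm, ?_⟩
    rw [hasFiniteIntegral_iff_ofReal (ae_of_all _ hn)]
    exact key.trans_lt ENNReal.ofReal_lt_top
  refine ⟨hfin, ?_⟩
  rw [← ofReal_integral_eq_lintegral_ofReal hfin (ae_of_all _ hn)] at key
  refine (ENNReal.ofReal_le_ofReal_iff ?_).1 key
  exact mul_nonneg (Real.rpow_nonneg (integral_nonneg hf0) _)
    (Real.rpow_nonneg (integral_nonneg hg0) _)

variable {n : ℕ}

theorem norm_gradient_eq (f : Pt n → ℝ) (x : Pt n) : ‖gradient f x‖ = ‖fderiv ℝ f x‖ := by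
  rw [gradient, LinearIsometryEquiv.norm_map]

/-- The Sobolev–Poincaré inequality for compactly supported `C¹` functions in a bounded set. -/
theorem exists_sobolev {U : Set (Pt n)} (hU : Bornology.IsBounded U) {r q : ℝ} (hr : 1 ≤ r)
    (hrn : r < n) (hq : 0 < q) (hrq : r⁻¹ - (n : ℝ)⁻¹ ≤ q⁻¹) :
    ∃ C : ℝ, 0 < C ∧ ∀ u : Pt n → ℝ, ContDiff ℝ 1 u → HasCompactSupport u →
      Function.support u ⊆ U →
        (∫ x, |u x| ^ q) ^ (r / q) ≤ C * ∫ x, ‖gradient u x‖ ^ r := by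
  have hr0 : 0 < r := by linarith
  lift r to ℝ≥0 using hr0.le
  lift q to ℝ≥0 using hq.le
  set S := eLpNormLESNormFDerivOfLeConst ℝ (volume : Measure (Pt n)) U r q
  refine ⟨(S : ℝ) ^ (r : ℝ) + 1, by positivity, fun u hu hc hs => ?_⟩
  have h1 := eLpNorm_le_eLpNorm_fderiv_of_le (μ := volume) hu hs (p := r)
    (q := q) (by exact_mod_cast hr) (by rw [finrank_euclideanSpace_fin]; exact_mod_cast hrn)
    (by rw [finrank_euclideanSpace_fin]; exact hrq) hU
  have hrE : (r : ℝ≥0∞) ≠ 0 := by exact_mod_cast hr0.ne'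
  have hqE : (q : ℝ≥0∞) ≠ 0 := by exact_mod_cast hq.ne'
  have hm1 : MemLp u q volume := hu.continuous.memLp_of_hasCompactSupport hc
  have hm2 : MemLp (fderiv ℝ u) r volume :=
    (hu.continuous_fderiv one_ne_zero).memLp_of_hasCompactSupport (hc.fderiv ℝ)
  rw [hm1.eLpNorm_eq_integral_rpow_norm hqE ENNReal.coe_ne_top,
    hm2.eLpNorm_eq_integral_rpow_norm hrE ENNReal.coe_ne_top] at h1
  simp only [ENNReal.coe_toReal, Real.norm_eq_abs] at h1
  have hI1 : 0 ≤ ∫ x, |u x| ^ (q : ℝ) := integral_nonneg fun x => by positivity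
  have hI2 : 0 ≤ ∫ x, ‖fderiv ℝ u x‖ ^ (r : ℝ) := integral_nonneg fun x => by positivity
  rw [← ENNReal.ofReal_coe_nnreal, ← ENNReal.ofReal_mul (by positivity),
    ENNReal.ofReal_le_ofReal_iff (by positivity)] at h1
  have h2 := Real.rpow_le_rpow (by positivity) h1 hr0.le
  rw [← Real.rpow_mul hI1, Real.mul_rpow (by positivity) (by positivity), ← Real.rpow_mul hI2,
    inv_mul_cancel₀ hr0.ne', Real.rpow_one, inv_mul_eq_div] at h2
  simp only [norm_gradient_eq]
  refine h2.trans ?_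
  gcongr
  exact le_add_of_nonneg_right zero_le_one

/-! ### Cutoff functions -/

/-- A weight localized in `U`. -/
structure IsWeight (U : Set (Pt n)) (c : Pt n → ℝ) : Prop where
  continuous : Continuous c
  compact : HasCompactSupport c
  subset : tsupport c ⊆ U

/-- A `C¹` cutoff function with values in `[0,1]`, localized in `U`. -/
structure IsCutoff (U : Set (Pt n)) (χ : Pt n → ℝ) : Prop where
  contDiff : ContDiff ℝ 1 χ
  compact : HasCompactSupport χ
  subset : tsupport χ ⊆ U
  nonneg : ∀ x, 0 ≤ χ x
  le_one : ∀ x, χ x ≤ 1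

theorem continuous_gradient {f : Pt n → ℝ} (hf : ContDiff ℝ 1 f) : Continuous (gradient f) :=
  (LinearIsometryEquiv.continuous _).comp (hf.continuous_fderiv one_ne_zero)

theorem gradient_eq_zero_of_notMem_tsupport {f : Pt n → ℝ} {x : Pt n} (hx : x ∉ tsupport f) :
    gradient f x = 0 := by
  have : f =ᶠ[𝓝 x] fun _ => 0 := notMem_tsupport_iff_eventuallyEq.1 hx
  rw [gradient, this.fderiv_eq]; simp

theorem tsupport_gradient_subset (f : Pt n → ℝ) : tsupport (gradient f) ⊆ tsupport f :=
  closure_minimal (fun x hx => by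
    by_contra h
    exact hx (gradient_eq_zero_of_notMem_tsupport h)) (isClosed_tsupport f)

variable {U : Set (Pt n)}

theorem IsWeight.of_tsupport_subset {c d : Pt n → ℝ} (hc : IsWeight U c) (hd : Continuous d)
    (h : tsupport d ⊆ tsupport c) : IsWeight U d :=
  ⟨hd, hc.compact.of_isClosed_subset (isClosed_tsupport d) h, h.trans hc.subset⟩

theorem IsWeight.of_support {c d : Pt n → ℝ} (hc : IsWeight U c) (hd : Continuous d)
    (h : ∀ x, c x = 0 → d x = 0) : IsWeight U d :=
  hc.of_tsupport_subset hd (closure_mono fun x hx hcx => hx (h x hcx))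

namespace IsCutoff

variable {χ : Pt n → ℝ} (hχ : IsCutoff U χ)
include hχ

theorem isWeight : IsWeight U χ := ⟨hχ.contDiff.continuous, hχ.compact, hχ.subset⟩

theorem sq : IsCutoff U fun x => χ x ^ 2 where
  contDiff := hχ.contDiff.pow 2
  compact := (hχ.isWeight.of_support (hχ.contDiff.continuous.pow 2) (by simp +contextual)).compact
  subset := (hχ.isWeight.of_support (hχ.contDiff.continuous.pow 2) (by simp +contextual)).subset
  nonneg x := sq_nonneg _
  le_one x := pow_le_one₀ (hχ.nonneg x) (hχ.le_one x)

end IsCutoff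

theorem exists_isCutoff {K : Set (Pt n)} (hK : IsCompact K) (hU : IsOpen U) (hKU : K ⊆ U) :
    ∃ χ, IsCutoff U χ ∧ ∀ x ∈ K, χ x = 1 := by
  obtain ⟨L, hL, hKL, hLU⟩ := exists_compact_between hK hU hKU
  obtain ⟨f, hf, hr, h0, h1⟩ := exists_contMDiff_zero_iff_one_iff_of_isClosed (n := 1)
    (modelWithCornersSelf ℝ (Pt n)) (s := (interior L)ᶜ) (t := K) isOpen_interior.isClosed_compl
    hK.isClosed (disjoint_compl_left_iff_subset.2 hKL)
  have hs : tsupport f ⊆ L := closure_minimal (fun x hx => by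
    by_contra h
    exact hx ((h0 x).1 fun h' => h (interior_subset h'))) hL.isClosed
  refine ⟨f, ⟨hf.contDiff, hL.of_isClosed_subset (isClosed_tsupport f) hs, hs.trans hLU,
    fun x => (hr ⟨x, rfl⟩).1, fun x => (hr ⟨x, rfl⟩).2⟩, fun x hx => (h1 x).1 hx⟩

/-! ### Integrals against a localized weight -/

section localized

variable {E : Type*} [NormedAddCommGroup E]

theorem continuous_of_continuousOn_tsupport {k : Pt n → E} (hU : IsOpen U)
    (hk : ContinuousOn k U) (hs : tsupport k ⊆ U) : Continuous k :=
  continuous_of_tsupport fun _ hx => hk.continuousAt (hU.mem_nhds (hs hx))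

theorem continuous_mul_weight {f c : Pt n → ℝ} (hU : IsOpen U) (hf : ContinuousOn f U)
    (hc : IsWeight U c) : Continuous fun x => f x * c x :=
  continuous_of_continuousOn_tsupport hU (hf.mul hc.continuous.continuousOn)
    ((tsupport_mul_subset_right (f := f) (g := c)).trans hc.subset)

theorem hasCompactSupport_mul_weight {f c : Pt n → ℝ} (hc : IsWeight U c) :
    HasCompactSupport fun x => f x * c x :=
  hc.compact.mul_left

theorem integrable_mul_weight {f c : Pt n → ℝ} (hU : IsOpen U) (hf : ContinuousOn f U)
    (hc : IsWeight U c) : Integrable fun x => f x * c x :=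
  (continuous_mul_weight hU hf hc).integrable_of_hasCompactSupport
    (hasCompactSupport_mul_weight hc)

/-- Nothing is known about `f` outside U, but every such point has a neighbourhood where the weight
vanishes, so the product is jointly continuous over the whole space. Integrals depending on t can
then be treated without a boundary. -/
theorem continuousOn_mul_weight {S : Set ℝ} {f : Pt n → ℝ → ℝ} {c : Pt n → ℝ} (hU : IsOpen U)
    (hf : ContinuousOn (fun z : Pt n × ℝ => f z.1 z.2) (U ×ˢ S)) (hc : IsWeight U c) :
    ContinuousOn (fun z : ℝ × Pt n => f z.2 z.1 * c z.2) (S ×ˢ univ) := by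
  rintro ⟨t, x⟩ ⟨ht, -⟩
  by_cases hx : x ∈ U
  · have h1 : ContinuousWithinAt (fun z : ℝ × Pt n => f z.2 z.1) (S ×ˢ U) (t, x) := by
      have h2 : ContinuousWithinAt (fun z : Pt n × ℝ => f z.1 z.2) (U ×ˢ S) (Prod.swap (t, x)) :=
        hf (x, t) ⟨hx, ht⟩
      exact h2.comp continuous_swap.continuousWithinAt (t := U ×ˢ S) fun z hz => ⟨hz.2, hz.1⟩
    have h3 : ContinuousWithinAt (fun z : ℝ × Pt n => f z.2 z.1 * c z.2) (S ×ˢ U) (t, x) :=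
      h1.mul (hc.continuous.comp continuous_snd).continuousWithinAt
    refine h3.mono_of_mem_nhdsWithin ?_
    rw [nhdsWithin_prod_eq, nhdsWithin_univ]
    exact prod_mem_prod self_mem_nhdsWithin (hU.mem_nhds hx)
  · have hx' : x ∉ tsupport c := fun h => hx (hc.subset h)
    have h0 : ∀ᶠ z : ℝ × Pt n in 𝓝 (t, x), f z.2 z.1 * c z.2 = 0 := by
      have := (continuous_snd (X := ℝ) (Y := Pt n)).tendsto (t, x)
        |>.eventually (notMem_tsupport_iff_eventuallyEq.1 hx')
      filter_upwards [this] with z hz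
      simp only [Pi.zero_apply] at hz
      rw [hz, mul_zero]
    have : ContinuousAt (fun z : ℝ × Pt n => f z.2 z.1 * c z.2) (t, x) :=
      continuousAt_const.congr (h0.mono fun z hz => hz.symm)
    exact this.continuousWithinAt

theorem continuousOn_integral_mul_weight {S : Set ℝ} {f : Pt n → ℝ → ℝ} {c : Pt n → ℝ}
    (hU : IsOpen U) (hf : ContinuousOn (fun z : Pt n × ℝ => f z.1 z.2) (U ×ˢ S))
    (hc : IsWeight U c) : ContinuousOn (fun t => ∫ x, f x t * c x) S :=
  continuousOn_integral_of_compact_support hc.compact (continuousOn_mul_weight hU hf hc)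
    fun t x _ hx => by rw [image_eq_zero_of_notMem_tsupport hx, mul_zero]

theorem continuousOn_slice {S : Set ℝ} {F : Pt n → ℝ → E}
    (hf : ContinuousOn (fun z : Pt n × ℝ => F z.1 z.2) (U ×ˢ S)) {t : ℝ} (ht : t ∈ S) :
    ContinuousOn (fun x => F x t) U :=
  hf.comp (continuous_id.prodMk continuous_const).continuousOn fun _ hx => ⟨hx, ht⟩

theorem hasDerivAt_integral_mul_weight {S : Set ℝ} (hS : IsOpen S) {F F' : Pt n → ℝ → ℝ}
    {c : Pt n → ℝ} (hU : IsOpen U)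
    (hF : ContinuousOn (fun z : Pt n × ℝ => F z.1 z.2) (U ×ˢ S))
    (hF' : ContinuousOn (fun z : Pt n × ℝ => F' z.1 z.2) (U ×ˢ S))
    (hd : ∀ x ∈ U, ∀ t ∈ S, HasDerivAt (F x) (F' x t) t) (hc : IsWeight U c) {t : ℝ}
    (ht : t ∈ S) :
    HasDerivAt (fun t => ∫ x, F x t * c x) (∫ x, F' x t * c x) t := by
  obtain ⟨ε, hε, hεS⟩ := Metric.nhds_basis_closedBall.mem_iff.1 (hS.mem_nhds ht)
  have hcomp : IsCompact (Metric.closedBall t ε ×ˢ tsupport c) :=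
    (isCompact_closedBall t ε).prod hc.compact
  obtain ⟨M, hM⟩ := hcomp.exists_bound_of_continuousOn
    ((continuousOn_mul_weight hU hF' hc).mono (prod_mono hεS (subset_univ _)))
  refine (hasDerivAt_integral_of_dominated_loc_of_deriv_le
    (F := fun t x => F x t * c x) (F' := fun t x => F' x t * c x)
    (bound := (tsupport c).indicator fun _ => M) (Metric.closedBall_mem_nhds t hε)
    ?_ ?_ ?_ ?_ ?_ ?_).2
  · filter_upwards [hS.mem_nhds ht] with u hu
    exact (integrable_mul_weight hU (continuousOn_slice hF hu) hc).1
  · exact integrable_mul_weight hU (continuousOn_slice hF ht) hc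
  · exact (integrable_mul_weight hU (continuousOn_slice hF' ht) hc).1
  · refine ae_of_all _ fun x u hu => ?_
    by_cases hx : x ∈ tsupport c
    · rw [indicator_of_mem hx]
      exact hM (u, x) ⟨hu, hx⟩
    · rw [indicator_of_notMem hx, image_eq_zero_of_notMem_tsupport hx, mul_zero, norm_zero]
  · rw [integrable_indicator_iff hc.compact.measurableSet]
    exact integrableOn_const hc.compact.measure_ne_top
  · refine ae_of_all _ fun x u hu => ?_
    by_cases hx : x ∈ tsupport c
    · exact (hd x (hc.subset hx) u (hεS hu)).mul_const (c x)
    · simp only [image_eq_zero_of_notMem_tsupport hx, mul_zero]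
      exact hasDerivAt_const _ _

end localized

/-! ### Composition with a profile and multiplication by a cutoff -/

theorem hasGradientAt_comp_mul_cutoff {u c : Pt n → ℝ} {h h' : ℝ → ℝ}
    (hu : ∀ x ∈ U, DifferentiableAt ℝ u x) (hh : ∀ s, HasDerivAt h (h' s) s)
    (hc : ContDiff ℝ 1 c) (hcs : tsupport c ⊆ U) (x : Pt n) :
    HasGradientAt (fun x => h (u x) * c x)
      ((c x * h' (u x)) • gradient u x + h (u x) • gradient c x) x := by
  by_cases hx : x ∈ tsupport c
  · have h1 : HasFDerivAt (fun x => h (u x)) (h' (u x) • fderiv ℝ u x) x :=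
      (hh (u x)).comp_hasFDerivAt x (hu x (hcs hx)).hasFDerivAt
    have h2 := h1.mul ((hc.differentiable one_ne_zero) x).hasFDerivAt
    rw [hasGradientAt_iff_hasFDerivAt]
    refine h2.congr_fderiv ?_
    simp only [gradient, map_add, map_smulₛₗ, LinearIsometryEquiv.apply_symm_apply, smul_smul]
    rw [add_comm]
    rfl
  · have h1 : (fun x => h (u x) * c x) =ᶠ[𝓝 x] fun _ => 0 := by
      filter_upwards [notMem_tsupport_iff_eventuallyEq.1 hx] with y hy
      simp only [Pi.zero_apply] at hy
      rw [hy, mul_zero]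
    rw [image_eq_zero_of_notMem_tsupport hx, gradient_eq_zero_of_notMem_tsupport hx]
    simp only [zero_mul, zero_smul, smul_zero, add_zero]
    exact (hasGradientAt_const x (0 : ℝ)).congr_of_eventuallyEq h1

theorem gradient_comp_mul_cutoff {u c : Pt n → ℝ} {h h' : ℝ → ℝ}
    (hu : ∀ x ∈ U, DifferentiableAt ℝ u x) (hh : ∀ s, HasDerivAt h (h' s) s)
    (hc : ContDiff ℝ 1 c) (hcs : tsupport c ⊆ U) (x : Pt n) :
    gradient (fun x => h (u x) * c x) x =
      (c x * h' (u x)) • gradient u x + h (u x) • gradient c x :=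
  (hasGradientAt_comp_mul_cutoff hu hh hc hcs x).gradient

theorem contDiff_comp_mul_cutoff {u c : Pt n → ℝ} {h h' : ℝ → ℝ} (hU : IsOpen U)
    (hu : ∀ x ∈ U, DifferentiableAt ℝ u x) (hu' : ContinuousOn (gradient u) U)
    (hh : ∀ s, HasDerivAt h (h' s) s) (hh' : Continuous h')
    (hc : ContDiff ℝ 1 c) (hcs : tsupport c ⊆ U) :
    ContDiff ℝ 1 fun x => h (u x) * c x := by
  have huc : ContinuousOn u U := fun x hx => (hu x hx).continuousAt.continuousWithinAt
  have hhc : Continuous h := continuous_iff_continuousAt.2 fun s => (hh s).continuousAt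
  have hG : Continuous fun x => (c x * h' (u x)) • gradient u x + h (u x) • gradient c x := by
    refine Continuous.add ?_ ?_
    · refine continuous_of_continuousOn_tsupport hU
        ((hc.continuous.continuousOn.mul (hh'.comp_continuousOn huc)).smul hu') ?_
      refine (closure_mono fun x hx => ?_).trans hcs
      intro h0
      exact hx (by simp [h0])
    · refine continuous_of_continuousOn_tsupport hU
        ((hhc.comp_continuousOn huc).smul (continuous_gradient hc).continuousOn) ?_
      refine (closure_mono fun x hx => ?_).trans ((tsupport_gradient_subset c).trans hcs)
      intro h0
      exact hx (by simp [h0])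
  rw [contDiff_one_iff_hasFDerivAt]
  exact ⟨_, (LinearIsometryEquiv.continuous (InnerProductSpace.toDual ℝ (Pt n))).comp hG,
    fun x => (hasGradientAt_comp_mul_cutoff hu hh hc hcs x).hasFDerivAt⟩

end Forchheimer

namespace Forchheimer

variable {n : ℕ} {U : Set (Pt n)} {g : Poly} {α : ℝ} {p Ψ : Pt n → ℝ → ℝ} {p₀ : Pt n → ℝ}

/-! ### The energy identity -/

/-- It lets one energy identity serve twice: with zero for the local estimates of p - k, and with Ψ
for the global estimate. -/
theorem isBoundaryExtension_zero : IsBoundaryExtension U (fun _ _ => (0 : ℝ)) where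
  continuousOn := continuousOn_const
  differentiableAt_space _ _ _ _ := differentiableAt_const _
  differentiableWithinAt_time _ _ _ _ := differentiableWithinAt_const _
  continuousOn_gradient := by simp only [gradient_fun_const]; exact continuousOn_const
  continuousOn_timeDeriv := by
    simp only [timeDeriv, derivWithin_fun_const, Pi.zero_apply]; exact continuousOn_const

theorem IsBoundaryExtension.hasDerivAt (hΨ : IsBoundaryExtension U Ψ) {x : Pt n} (hx : x ∈ U)
    {t : ℝ} (ht : 0 < t) : HasDerivAt (Ψ x) (timeDeriv Ψ x t) t :=
  (hΨ.differentiableWithinAt_time x hx t ht.le).hasDerivWithinAt.hasDerivAt (Ici_mem_nhds ht)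

theorem continuousOn_K_gradient (hp : IsSolution g U α p p₀ Ψ) {t : ℝ} (ht : 0 < t) :
    ContinuousOn (fun x => g.K ‖gradient (fun y => p y t) x‖) U :=
  g.continuousOn_K.comp
    (continuousOn_slice (F := fun x t => gradient (fun y => p y t) x)
      hp.continuousOn_gradient ht).norm fun _ _ => norm_nonneg _

/-- The integrand of the time derivative of the localized energy `∫ Φ(p - Ψ - k) χ`. -/
noncomputable def energyIntegrand (g : Poly) (p Ψ : Pt n → ℝ → ℝ) (k : ℝ) (h h' : ℝ → ℝ)
    (χ : Pt n → ℝ) (t : ℝ) (x : Pt n) : ℝ :=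
  -(g.K ‖gradient (fun y => p y t) x‖ * inner ℝ (gradient (fun y => p y t) x)
      ((χ x * h' (p x t - Ψ x t - k)) •
          (gradient (fun y => p y t) x - gradient (fun y => Ψ y t) x)
        + h (p x t - Ψ x t - k) • gradient χ x))
    - h (p x t - Ψ x t - k) * timeDeriv Ψ x t * χ x

theorem continuousOn_difference (hp : IsSolution g U α p p₀ Ψ) {Ψ' : Pt n → ℝ → ℝ}
    (hΨ' : IsBoundaryExtension U Ψ') (k : ℝ) :
    ContinuousOn (fun z : Pt n × ℝ => p z.1 z.2 - Ψ' z.1 z.2 - k) (U ×ˢ Ioi 0) :=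
  ((hp.continuousOn.mono (prod_mono subset_closure subset_rfl)).sub
    (hΨ'.continuousOn.mono (prod_mono subset_closure Ioi_subset_Ici_self))).sub continuousOn_const

theorem gradient_difference (hp : IsSolution g U α p p₀ Ψ) {Ψ' : Pt n → ℝ → ℝ}
    (hΨ' : IsBoundaryExtension U Ψ') (k : ℝ) {t : ℝ} (ht : 0 < t) {x : Pt n} (hx : x ∈ U) :
    gradient (fun y => p y t - Ψ' y t - k) x =
      gradient (fun y => p y t) x - gradient (fun y => Ψ' y t) x := by
  have h1 := hp.differentiableAt_space x hx t ht
  have h2 := hΨ'.differentiableAt_space x hx t ht.le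
  simp only [gradient]
  rw [fderiv_sub_const, fderiv_fun_sub h1 h2, map_sub]

/-- The energy identity: `p` solves the equation, `Ψ'` is any regular function. -/
theorem hasDerivAt_energy (hU : IsOpen U) (hp : IsSolution g U α p p₀ Ψ) {Ψ' : Pt n → ℝ → ℝ}
    (hΨ' : IsBoundaryExtension U Ψ') {χ : Pt n → ℝ} (hχ : IsCutoff U χ) (k : ℝ)
    {H h h' : ℝ → ℝ} (hH : ∀ s, HasDerivAt H (h s) s) (hh : ∀ s, HasDerivAt h (h' s) s)
    (hh' : Continuous h') {t : ℝ} (ht : 0 < t) :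
    Integrable (energyIntegrand g p Ψ' k h h' χ t) ∧
    HasDerivAt (fun t => ∫ x, H (p x t - Ψ' x t - k) * χ x)
      (∫ x, energyIntegrand g p Ψ' k h h' χ t x) t := by
  have hHc : Continuous H := continuous_iff_continuousAt.2 fun s => (hH s).continuousAt
  have hhc : Continuous h := continuous_iff_continuousAt.2 fun s => (hh s).continuousAt
  have hw := continuousOn_difference hp hΨ' k
  have hΨt : ContinuousOn (fun z : Pt n × ℝ => timeDeriv Ψ' z.1 z.2) (U ×ˢ Ioi 0) :=
    hΨ'.continuousOn_timeDeriv.mono (prod_mono subset_rfl Ioi_subset_Ici_self)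
  have ht' : t ∈ Ioi (0 : ℝ) := ht
  -- the time derivative
  have hder := hasDerivAt_integral_mul_weight (S := Ioi 0) isOpen_Ioi
    (F := fun x t => H (p x t - Ψ' x t - k))
    (F' := fun x t => h (p x t - Ψ' x t - k) * (deriv (p x) t - timeDeriv Ψ' x t)) hU
    (hHc.comp_continuousOn hw)
    ((hhc.comp_continuousOn hw).mul (hp.continuousOn_timeDeriv.sub hΨt))
    (fun x hx t ht => (hH _).comp t
      (((hp.differentiableAt_time x hx t ht).hasDerivAt.sub (hΨ'.hasDerivAt hx ht)).sub_const k))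
    hχ.isWeight ht'
  -- the equation
  set u : Pt n → ℝ := fun y => p y t - Ψ' y t - k with hu
  have hud : ∀ x ∈ U, DifferentiableAt ℝ u x := fun x hx =>
    ((hp.differentiableAt_space x hx t ht).sub
      (hΨ'.differentiableAt_space x hx t ht.le)).sub_const k
  have hgp : ContinuousOn (fun x => gradient (fun y => p y t) x) U :=
    continuousOn_slice (F := fun x t => gradient (fun y => p y t) x) hp.continuousOn_gradient ht'
  have hgΨ : ContinuousOn (fun x => gradient (fun y => Ψ' y t) x) U :=
    continuousOn_slice (F := fun x t => gradient (fun y => Ψ' y t) x)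
      hΨ'.continuousOn_gradient (mem_Ici.2 ht.le)
  have hgu : ContinuousOn (gradient u) U :=
    (hgp.sub hgΨ).congr fun x hx => gradient_difference hp hΨ' k ht hx
  -- This is the test function. It is C¹ because p and Ψ' have continuous spatial gradients, and the
  -- cutoff gives it compact support in U.
  set φ : Pt n → ℝ := fun x => h (u x) * χ x with hφ
  have hφc : ContDiff ℝ 1 φ := contDiff_comp_mul_cutoff hU hud hgu hh hh' hχ.contDiff hχ.subset
  have hφs : HasCompactSupport φ := hasCompactSupport_mul_weight hχ.isWeight
  have hφU : tsupport φ ⊆ U :=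
    (tsupport_mul_subset_right (f := fun x => h (u x)) (g := χ)).trans hχ.subset
  have heq := hp.equation t ht φ hφc hφs hφU
  have hz : ∀ x, x ∉ U → φ x = 0 ∧ gradient φ x = 0 := fun x hx =>
    ⟨image_eq_zero_of_notMem_tsupport fun h => hx (hφU h),
      gradient_eq_zero_of_notMem_tsupport fun h => hx (hφU h)⟩
  rw [setIntegral_eq_integral_of_forall_compl_eq_zero (fun x hx => by rw [(hz x hx).1, mul_zero]),
    setIntegral_eq_integral_of_forall_compl_eq_zero
      (fun x hx => by rw [(hz x hx).2, inner_zero_right, mul_zero])] at heq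
  -- assembling
  have hint1 : Integrable fun x => g.K ‖gradient (fun y => p y t) x‖ *
      inner ℝ (gradient (fun y => p y t) x) (gradient φ x) := by
    have hsub : tsupport (fun x => g.K ‖gradient (fun y => p y t) x‖ *
        inner ℝ (gradient (fun y => p y t) x) (gradient φ x)) ⊆ tsupport φ :=
      (closure_mono fun x (hx : _ ≠ _) => by
        rw [Function.mem_support]
        contrapose! hx
        simp [hx]).trans (tsupport_gradient_subset φ)
    refine Continuous.integrable_of_hasCompactSupport ?_
      (hφs.of_isClosed_subset (isClosed_tsupport _) hsub)
    exact continuous_of_continuousOn_tsupport hU ((continuousOn_K_gradient hp ht).mul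
      (hgp.inner (continuous_gradient hφc).continuousOn)) (hsub.trans hφU)
  have hcu : ContinuousOn (fun x => h (u x)) U :=
    hhc.comp_continuousOn (continuousOn_slice (F := fun x t => p x t - Ψ' x t - k) hw ht')
  have hint2 : Integrable fun x => h (u x) * timeDeriv Ψ' x t * χ x :=
    integrable_mul_weight hU (hcu.mul (continuousOn_slice hΨt ht')) hχ.isWeight
  have hint3 : Integrable fun x => h (u x) * deriv (p x) t * χ x :=
    integrable_mul_weight hU (hcu.mul (continuousOn_slice (F := fun x t => deriv (p x) t)
      hp.continuousOn_timeDeriv ht')) hχ.isWeight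
  have hG : energyIntegrand g p Ψ' k h h' χ t = fun x =>
      -(g.K ‖gradient (fun y => p y t) x‖ *
        inner ℝ (gradient (fun y => p y t) x) (gradient φ x))
      - h (u x) * timeDeriv Ψ' x t * χ x := by
    funext x
    rw [hφ, gradient_comp_mul_cutoff hud hh hχ.contDiff hχ.subset x]
    by_cases hx : x ∈ U
    · rw [gradient_difference hp hΨ' k ht hx]; rfl
    · have h0 : x ∉ tsupport χ := fun h => hx (hχ.subset h)
      simp only [energyIntegrand, image_eq_zero_of_notMem_tsupport h0,
        gradient_eq_zero_of_notMem_tsupport h0]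
      simp
  rw [hG]
  have hint1' := hint1.fun_neg
  refine ⟨hint1'.sub hint2, hder.congr_deriv ?_⟩
  dsimp only
  rw [integral_sub hint1' hint2, integral_neg, ← heq, ← integral_sub ?_ hint2]
  · refine integral_congr_ae (ae_of_all _ fun x => ?_)
    simp only [hφ, hu]
    ring
  · refine hint3.congr (ae_of_all _ fun x => ?_)
    simp only [hφ]
    ring

end Forchheimer

namespace Forchheimer

variable {n : ℕ} {U : Set (Pt n)} {g : Poly} {α : ℝ} {p Ψ : Pt n → ℝ → ℝ} {p₀ : Pt n → ℝ}

/-! ### Local energy and Sobolev estimates -/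

theorem gradient_sq {χ : Pt n → ℝ} (hχ : ContDiff ℝ 1 χ) (x : Pt n) :
    gradient (fun x => χ x ^ 2) x = (2 * χ x) • gradient χ x := by
  have h := ((hχ.differentiable one_ne_zero) x).hasFDerivAt.pow 2
  simp only [gradient]
  have h' : fderiv ℝ (fun x => χ x ^ 2) x = (2 * χ x) • fderiv ℝ χ x := by
    simpa using! h.fderiv
  rw [h', map_smulₛₗ]
  rfl

/-- The compatibility between an inner cutoff `χ` and an outer weight `ζ`. -/
structure IsInnerCutoff (U : Set (Pt n)) (χ ζ : Pt n → ℝ) (L : ℝ) : Prop where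
  cutoff : IsCutoff U χ
  weight : IsWeight U ζ
  nonneg : ∀ x, 0 ≤ ζ x
  eq_one : ∀ x ∈ tsupport χ, ζ x = 1
  gradient_le : ∀ x, ‖gradient χ x‖ ≤ L

namespace IsInnerCutoff

variable {χ ζ : Pt n → ℝ} {L : ℝ} (h : IsInnerCutoff U χ ζ L)
include h

theorem sq_le (x : Pt n) : χ x ^ 2 ≤ ζ x := by
  by_cases hx : x ∈ tsupport χ
  · rw [h.eq_one x hx]; exact h.cutoff.sq.le_one x
  · rw [image_eq_zero_of_notMem_tsupport hx]; simpa using h.nonneg x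

theorem gradient_sq_le (x : Pt n) : ‖gradient χ x‖ ^ 2 ≤ L ^ 2 * ζ x := by
  by_cases hx : x ∈ tsupport χ
  · rw [h.eq_one x hx, mul_one]; exact pow_le_pow_left₀ (norm_nonneg _) (h.gradient_le x) 2
  · rw [gradient_eq_zero_of_notMem_tsupport hx, norm_zero, zero_pow two_ne_zero]
    exact mul_nonneg (sq_nonneg L) (h.nonneg x)

end IsInnerCutoff

/-- The localized energy at the level `k`. -/
noncomputable def locEnergy (α δ k : ℝ) (χ : Pt n → ℝ) (p : Pt n → ℝ → ℝ) (t : ℝ) : ℝ :=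
  ∫ x, Phi α δ (p x t - k) * χ x ^ 2

/-- The localized dissipation at the level `k`. -/
noncomputable def locDissipation (α r δ k : ℝ) (χ : Pt n → ℝ) (p : Pt n → ℝ → ℝ) (t : ℝ) : ℝ :=
  ∫ x, (‖gradient (fun y => p y t) x‖ ^ r * wt α δ (p x t - k)) * χ x ^ 2

/-- The localized `L^α` norm (to the power `α`) above the level `k`. -/
noncomputable def locMass (α k : ℝ) (ζ : Pt n → ℝ) (p : Pt n → ℝ → ℝ) (t : ℝ) : ℝ :=
  ∫ x, max (p x t - k) 0 ^ α * ζ x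

section continuity

variable (hU : IsOpen U) (hp : IsSolution g U α p p₀ Ψ)
include hp

theorem continuousOn_sub_level (k : ℝ) :
    ContinuousOn (fun z : Pt n × ℝ => p z.1 z.2 - k) (U ×ˢ Ioi 0) :=
  (hp.continuousOn.mono (prod_mono subset_closure subset_rfl)).sub continuousOn_const

theorem continuousOn_mass_integrand (hα : 2 ≤ α) (k : ℝ) :
    ContinuousOn (fun z : Pt n × ℝ => max (p z.1 z.2 - k) 0 ^ α) (U ×ˢ Ioi 0) :=
  ((continuous_id.max continuous_const).rpow_const fun _ => Or.inr (by linarith)).comp_continuousOn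
    (continuousOn_sub_level hp k)

theorem continuousOn_dissipation_integrand (hα : 2 ≤ α) {r δ : ℝ} (hr : 0 < r) (hδ : 0 < δ)
    (k : ℝ) : ContinuousOn (fun z : Pt n × ℝ => ‖gradient (fun y => p y z.2) z.1‖ ^ r *
      wt α δ (p z.1 z.2 - k)) (U ×ˢ Ioi 0) :=
  (hp.continuousOn_gradient.norm.rpow_const fun _ _ => Or.inr hr.le).mul
    ((continuous_wt hα hδ).comp_continuousOn (continuousOn_sub_level hp k))

include hU

theorem continuousOn_locMass (hα : 2 ≤ α) {ζ : Pt n → ℝ} (hζ : IsWeight U ζ) (k : ℝ) :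
    ContinuousOn (locMass α k ζ p) (Ioi 0) :=
  continuousOn_integral_mul_weight hU (f := fun x t => max (p x t - k) 0 ^ α)
    (continuousOn_mass_integrand hp hα k) hζ

theorem continuousOn_locDissipation (hα : 2 ≤ α) {r δ : ℝ} (hr : 0 < r) (hδ : 0 < δ)
    {χ : Pt n → ℝ} (hχ : IsCutoff U χ) (k : ℝ) :
    ContinuousOn (locDissipation α r δ k χ p) (Ioi 0) :=
  continuousOn_integral_mul_weight hU
    (f := fun x t => ‖gradient (fun y => p y t) x‖ ^ r * wt α δ (p x t - k))
    (continuousOn_dissipation_integrand hp hα hr hδ k) hχ.sq.isWeight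

end continuity

theorem locMass_nonneg {k : ℝ} {ζ : Pt n → ℝ} (hζ : ∀ x, 0 ≤ ζ x) (t : ℝ) :
    0 ≤ locMass α k ζ p t :=
  integral_nonneg fun x => mul_nonneg (Real.rpow_nonneg (le_max_right _ _) _) (hζ x)

theorem locDissipation_nonneg {r δ k : ℝ} {χ : Pt n → ℝ} (t : ℝ) :
    0 ≤ locDissipation α r δ k χ p t :=
  integral_nonneg fun _ => mul_nonneg (mul_nonneg (by positivity) (wt_nonneg _)) (sq_nonneg _)

theorem locEnergy_nonneg {δ k : ℝ} {χ : Pt n → ℝ} (t : ℝ) : 0 ≤ locEnergy α δ k χ p t :=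
  integral_nonneg fun _ => mul_nonneg (Phi_nonneg _) (sq_nonneg _)

theorem locEnergy_le_locMass (hU : IsOpen U) (hp : IsSolution g U α p p₀ Ψ) (hα : 2 ≤ α)
    {δ k L : ℝ} (hδ : 0 < δ) {χ ζ : Pt n → ℝ} (h : IsInnerCutoff U χ ζ L) {t : ℝ} (ht : 0 < t) :
    locEnergy α δ k χ p t ≤ locMass α k ζ p t := by
  have hc := continuousOn_slice (F := fun x t => p x t - k) (continuousOn_sub_level hp k)
    (mem_Ioi.2 ht)
  refine integral_mono
    (integrable_mul_weight hU ((continuous_Phi hα hδ).comp_continuousOn hc) h.cutoff.sq.isWeight)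
    (integrable_mul_weight hU (continuousOn_slice (F := fun x t => max (p x t - k) 0 ^ α)
      (continuousOn_mass_integrand hp hα k) (mem_Ioi.2 ht)) h.weight) fun x => ?_
  exact mul_le_mul (Phi_le hα hδ _) (h.sq_le x) (sq_nonneg _)
    (Real.rpow_nonneg (le_max_right _ _) _)

/-- The local energy inequality. -/
theorem exists_hasDerivAt_locEnergy_le (g : Poly) (hα : 2 ≤ α) : ∃ c C : ℝ, 0 < c ∧ 0 < C ∧
    ∀ {n : ℕ} {U : Set (Pt n)} {p Ψ : Pt n → ℝ → ℝ} {p₀ : Pt n → ℝ}, IsOpen U →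
      IsSolution g U α p p₀ Ψ → ∀ {χ ζ : Pt n → ℝ} {L δ : ℝ}, IsInnerCutoff U χ ζ L → 0 < δ →
      ∀ (k : ℝ) {t : ℝ}, 0 < t → ∃ e : ℝ, HasDerivAt (locEnergy α δ k χ p) e t ∧
        e ≤ -(c * locDissipation α (2 - g.a) δ k χ p t) +
          C * (1 / δ ^ 2 + L ^ 2) * locMass α k ζ p t := by
  obtain ⟨c, C, hc, hC, hK⟩ := g.exists_le_K_mul_sq
  have ha0 := g.coef_zero_pos
  have ha1 := g.a_lt_one
  refine ⟨c / 2, C + 2 / g.coef 0, by positivity, by positivity, ?_⟩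
  intro n U p Ψ p₀ hU hp χ ζ L δ h hδ k t ht
  obtain ⟨hint, hder⟩ := hasDerivAt_energy hU hp isBoundaryExtension_zero h.cutoff.sq k
    (hasDerivAt_Phi hα hδ) (hasDerivAt_eta hα hδ) (continuous_etaDeriv hα hδ) ht
  simp only [sub_zero] at hder
  refine ⟨_, hder, ?_⟩
  have hi1 := integrable_mul_weight hU (continuousOn_slice
    (F := fun x t => ‖gradient (fun y => p y t) x‖ ^ (2 - g.a) * wt α δ (p x t - k))
    (continuousOn_dissipation_integrand hp hα (by linarith) hδ k) (mem_Ioi.2 ht))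
    h.cutoff.sq.isWeight
  have hi2 := integrable_mul_weight hU (continuousOn_slice
    (F := fun x t => max (p x t - k) 0 ^ α)
    (continuousOn_mass_integrand hp hα k) (mem_Ioi.2 ht)) h.weight
  rw [locDissipation, locMass, ← integral_const_mul, ← integral_const_mul, ← integral_neg,
    ← integral_add (hi1.const_mul _).fun_neg (hi2.const_mul _)]
  refine integral_mono hint ((hi1.const_mul _).fun_neg.add (hi2.const_mul _)) fun x => ?_
  simp only [energyIntegrand, gradient_fun_const, sub_zero,
    gradient_sq h.cutoff.contDiff, timeDeriv, derivWithin_fun_const, Pi.zero_apply, mul_zero,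
    zero_mul, inner_add_right, inner_smul_right, real_inner_self_eq_norm_sq]
  set P := gradient (fun y => p y t) x
  set s := p x t - k
  set Γ := ‖gradient χ x‖ with hΓ
  have hX := norm_nonneg P
  have hw := wt_nonneg (α := α) (δ := δ) s
  have hs : 0 ≤ max s 0 := le_max_right _ _
  have hKp := g.K_pos hX
  have hχ0 := h.cutoff.nonneg x
  have hip : -(‖P‖ * Γ) ≤ inner ℝ P (gradient χ x) := (abs_le.1 (abs_real_inner_le_norm _ _)).1
  have h1 := wt_le_etaDeriv hα hδ s
  have hcoer := hK ‖P‖ hX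
  have hKle := g.K_le hX
  have h2 := sq_mul_wt_le (α := α) hδ s
  have h3 := wt_le_div (α := α) hδ s
  have hsα : 0 ≤ max s 0 ^ α := Real.rpow_nonneg hs _
  have hζ0 := h.nonneg x
  have e1 : χ x ^ 2 * wt α δ s * ‖P‖ ^ 2 ≤ χ x ^ 2 * etaDeriv α δ s * ‖P‖ ^ 2 := by gcongr
  have e2 : -(max s 0 * wt α δ s * (2 * χ x) * (‖P‖ * Γ)) ≤
      eta α δ s * (2 * χ x * inner ℝ P (gradient χ x)) := by
    have : 0 ≤ max s 0 * wt α δ s * (2 * χ x) := by positivity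
    have := mul_le_mul_of_nonneg_left hip this
    rw [eta]
    linarith
  -- The cutoff enters squared, so the cross term contains a factor χ‖P‖ and half of χ²‖P‖² absorbs
  -- it. The remainder carries |∇χ|² and is bounded further below by means of K ≤ 1/a₀.
  have e3 : max s 0 * wt α δ s * (2 * χ x) * (‖P‖ * Γ) ≤
      wt α δ s * (χ x ^ 2 * ‖P‖ ^ 2 / 2 + 2 * (max s 0 ^ 2 * Γ ^ 2)) := by
    have := mul_le_mul_of_nonneg_left
      (by nlinarith [sq_nonneg (χ x * ‖P‖ - 2 * (max s 0 * Γ))] :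
        max s 0 * (2 * χ x) * (‖P‖ * Γ) ≤
          χ x ^ 2 * ‖P‖ ^ 2 / 2 + 2 * (max s 0 ^ 2 * Γ ^ 2)) hw
    linarith
  have e4 : g.K ‖P‖ * (χ x ^ 2 * wt α δ s * ‖P‖ ^ 2 / 2 - 2 * (max s 0 ^ 2 * wt α δ s * Γ ^ 2)) ≤
      g.K ‖P‖ * (χ x ^ 2 * etaDeriv α δ s * ‖P‖ ^ 2 +
        eta α δ s * (2 * χ x * inner ℝ P (gradient χ x))) :=
    mul_le_mul_of_nonneg_left (by linarith) hKp.le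
  have e5 : χ x ^ 2 * wt α δ s * (c * ‖P‖ ^ (2 - g.a) - C) ≤
      χ x ^ 2 * wt α δ s * (g.K ‖P‖ * ‖P‖ ^ 2) :=
    mul_le_mul_of_nonneg_left hcoer (by positivity)
  have e6 : χ x ^ 2 * wt α δ s ≤ 1 / δ ^ 2 * (max s 0 ^ α * ζ x) := by
    calc χ x ^ 2 * wt α δ s ≤ ζ x * (max s 0 ^ α / δ ^ 2) :=
          mul_le_mul (h.sq_le x) h3 hw hζ0
      _ = _ := by ring
  have e7 : max s 0 ^ 2 * wt α δ s * Γ ^ 2 ≤ L ^ 2 * (max s 0 ^ α * ζ x) := by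
    calc max s 0 ^ 2 * wt α δ s * Γ ^ 2 ≤ max s 0 ^ α * (L ^ 2 * ζ x) :=
          mul_le_mul h2 (h.gradient_sq_le x) (by positivity) hsα
      _ = _ := by ring
  have e8 : g.K ‖P‖ * (max s 0 ^ 2 * wt α δ s * Γ ^ 2) ≤
      1 / g.coef 0 * (L ^ 2 * (max s 0 ^ α * ζ x)) :=
    mul_le_mul hKle e7 (by positivity) (by positivity)
  have e9 : C * (χ x ^ 2 * wt α δ s) ≤ C * (1 / δ ^ 2 * (max s 0 ^ α * ζ x)) :=
    mul_le_mul_of_nonneg_left e6 hC.le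
  have q1 : 0 ≤ C * (L ^ 2 * (max s 0 ^ α * ζ x)) := by positivity
  have q2 : 0 ≤ 2 / g.coef 0 * (1 / δ ^ 2 * (max s 0 ^ α * ζ x)) := by positivity
  have q3 : 0 ≤ C * (1 / δ ^ 2 * (max s 0 ^ α * ζ x)) := by positivity
  have q4 : 2 * (1 / g.coef 0 * (L ^ 2 * (max s 0 ^ α * ζ x))) =
    2 / g.coef 0 * (L ^ 2 * (max s 0 ^ α * ζ x)) := by ring
  linarith [e4, e5, e8, e9, q1, q2, q3, q4]

/-- The spatial Sobolev estimate for truncations at the level `k`. -/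
theorem exists_locMass_le (g : Poly) (hn : 2 ≤ n) (hUb : Bornology.IsBounded U) (hU : IsOpen U)
    (hα : 2 ≤ α) (hκ : g.a ≤ α * ((2 - g.a) / n)) : ∃ C : ℝ, 0 < C ∧
    ∀ {p Ψ : Pt n → ℝ → ℝ} {p₀ : Pt n → ℝ}, IsSolution g U α p p₀ Ψ →
      ∀ {χ ζ ζ' : Pt n → ℝ} {L δ : ℝ}, IsInnerCutoff U χ ζ L → IsWeight U ζ' →
      (∀ x, 0 ≤ ζ' x) → (∀ x, ζ' x ≤ 1) → (∀ x, ζ' x ≠ 0 → χ x = 1) → 0 < δ →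
      ∀ (k : ℝ) {t : ℝ}, 0 < t → locMass α (k + 2 * δ) ζ' p t ≤
        C * δ ^ (g.a - α * ((2 - g.a) / n)) * locEnergy α δ k χ p t ^ ((2 - g.a) / n) *
          (locDissipation α (2 - g.a) δ k χ p t +
            (1 / δ ^ 2 + L ^ 2) * locMass α k ζ p t) := by
  have ha0 := g.a_pos
  have ha1 := g.a_lt_one
  set r : ℝ := 2 - g.a with hr
  have hr0 : 0 < r := by linarith
  have hn' : (2 : ℝ) ≤ n := by exact_mod_cast hn
  set μ : ℝ := r / n with hμ
  have hμ0 : 0 < μ := by positivity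
  have hμ1 : μ < 1 := by rw [hμ, div_lt_one (by positivity)]; linarith
  -- With μ = r/n this is the critical Sobolev exponent rn/(n - r), and r/q = 1 - μ is also the
  -- exponent left to the profile in Hölder's inequality when the energy takes μ.
  set q : ℝ := r / (1 - μ) with hq
  have hq0 : 0 < q := div_pos hr0 (by linarith)
  have hrq : r / q = 1 - μ := by rw [hq]; field_simp
  obtain ⟨S, hS, hsob⟩ := exists_sobolev hUb (r := r) (q := q) (by linarith) (by linarith) hq0
    (by rw [hq, hμ]; apply le_of_eq; field_simp)
  set B : ℝ := 2 ^ r * ((1 + α / r) ^ r + 2 ^ r) with hB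
  have hB0 : 0 < B := by positivity
  refine ⟨4 * (4 * 2 ^ α) ^ μ * (S * B), by positivity, ?_⟩
  intro p Ψ p₀ hp χ ζ ζ' L δ h hζ' hζ'0 hζ'1 hζ'χ hδ k t ht
  have ht' : t ∈ Ioi (0 : ℝ) := ht
  have hc := continuousOn_slice (F := fun x t => p x t - k) (continuousOn_sub_level hp k) ht'
  set v : Pt n → ℝ := fun x => Wp α r δ (p x t - k) * χ x ^ 2 with hv
  have hv0 : ∀ x, 0 ≤ v x := fun x => mul_nonneg (Wp_nonneg hδ _) (sq_nonneg _)
  have hud : ∀ x ∈ U, DifferentiableAt ℝ (fun y => p y t - k) x := fun x hx =>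
    (hp.differentiableAt_space x hx t ht).sub_const k
  have hgu : ∀ x, gradient (fun y => p y t - k) x = gradient (fun y => p y t) x := fun x => by
    simp only [gradient, fderiv_sub_const]
  have hvC : ContDiff ℝ 1 v := contDiff_comp_mul_cutoff hU hud
    ((continuousOn_slice (F := fun x t => gradient (fun y => p y t) x)
      hp.continuousOn_gradient ht').congr fun x _ => hgu x)
    (hasDerivAt_Wp hα hr0 hδ) (continuous_WpDeriv hα hr0 hδ) h.cutoff.sq.contDiff
    h.cutoff.sq.subset
  have hvs : HasCompactSupport v := hasCompactSupport_mul_weight h.cutoff.sq.isWeight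
  have hvU : tsupport v ⊆ U :=
    (tsupport_mul_subset_right (f := fun x => Wp α r δ (p x t - k))).trans h.cutoff.sq.subset
  have hsv := hsob v hvC hvs ((subset_tsupport v).trans hvU)
  -- the gradient term
  have hi1 := integrable_mul_weight hU (continuousOn_slice
    (F := fun x t => ‖gradient (fun y => p y t) x‖ ^ r * wt α δ (p x t - k))
    (continuousOn_dissipation_integrand hp hα hr0 hδ k) ht') h.cutoff.sq.isWeight
  have hi2 := integrable_mul_weight hU (continuousOn_slice
    (F := fun x t => max (p x t - k) 0 ^ α)
    (continuousOn_mass_integrand hp hα k) ht') h.weight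
  have hgrad : ∫ x, ‖gradient v x‖ ^ r ≤ B * (locDissipation α r δ k χ p t +
      (1 / δ ^ 2 + L ^ 2) * locMass α k ζ p t) := by
    rw [locDissipation, locMass, ← integral_const_mul (1 / δ ^ 2 + L ^ 2),
      ← integral_add hi1 (hi2.const_mul _), ← integral_const_mul]
    refine integral_mono ?_ ((hi1.add (hi2.const_mul _)).const_mul _) fun x => ?_
    · refine Continuous.integrable_of_hasCompactSupport
        ((continuous_gradient hvC).norm.rpow_const fun _ => Or.inr hr0.le) ?_
      refine hvs.of_isClosed_subset (isClosed_tsupport _)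
        ((closure_mono fun x (hx : _ ≠ _) => ?_).trans (tsupport_gradient_subset v))
      rw [Function.mem_support]
      contrapose! hx
      simp [hx, Real.zero_rpow hr0.ne']
    · simp only
      rw [hv, gradient_comp_mul_cutoff hud (hasDerivAt_Wp hα hr0 hδ) h.cutoff.sq.contDiff
        h.cutoff.sq.subset x, hgu x, gradient_sq h.cutoff.contDiff]
      set P := gradient (fun y => p y t) x
      set s := p x t - k
      set Γ := ‖gradient χ x‖ with hΓ
      have hΓ0 : 0 ≤ Γ := norm_nonneg _
      have hX := norm_nonneg P
      have hw := wt_nonneg (α := α) (δ := δ) s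
      have hs : 0 ≤ max s 0 := le_max_right _ _
      have hχ0 := h.cutoff.nonneg x
      have hχ1 := h.cutoff.le_one x
      have hW := Wp_nonneg (α := α) (r := r) hδ s
      have hsα : 0 ≤ max s 0 ^ α := Real.rpow_nonneg hs _
      have hζ0 := h.nonneg x
      have n1 : ‖(χ x ^ 2 * WpDeriv α r δ s) • P + Wp α r δ s • (2 * χ x) • gradient χ x‖ ≤
          χ x ^ 2 * |WpDeriv α r δ s| * ‖P‖ + 2 * (Wp α r δ s * (χ x * Γ)) := by
        refine (norm_add_le _ _).trans ?_
        rw [norm_smul, norm_smul, norm_smul, Real.norm_eq_abs, abs_mul, abs_of_nonneg (sq_nonneg _),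
          Real.norm_of_nonneg hW, Real.norm_of_nonneg (by positivity)]
        apply le_of_eq; ring
      have n2 : ‖(χ x ^ 2 * WpDeriv α r δ s) • P + Wp α r δ s • (2 * χ x) • gradient χ x‖ ^ r ≤
          2 ^ r * ((χ x ^ 2 * |WpDeriv α r δ s| * ‖P‖) ^ r +
            (2 * (Wp α r δ s * (χ x * Γ))) ^ r) :=
        (Real.rpow_le_rpow (norm_nonneg _) n1 hr0.le).trans
          (add_rpow_le hr0.le (by positivity) (by positivity))
      have n3 : (χ x ^ 2 * |WpDeriv α r δ s| * ‖P‖) ^ r ≤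
          (1 + α / r) ^ r * (‖P‖ ^ r * wt α δ s * χ x ^ 2) := by
        rw [Real.mul_rpow (by positivity) hX, Real.mul_rpow (by positivity) (abs_nonneg _)]
        have m1 : (χ x ^ 2) ^ r ≤ χ x ^ 2 := by
          have := Real.rpow_le_rpow_of_exponent_ge' (sq_nonneg (χ x))
            (pow_le_one₀ hχ0 hχ1) zero_le_one (by linarith : (1 : ℝ) ≤ r)
          rwa [Real.rpow_one] at this
        have m2 := abs_WpDeriv_rpow_le (α := α) hα hr0 hδ s
        calc (χ x ^ 2) ^ r * |WpDeriv α r δ s| ^ r * ‖P‖ ^ r ≤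
              χ x ^ 2 * ((1 + α / r) ^ r * wt α δ s) * ‖P‖ ^ r := by gcongr
          _ = _ := by ring
      have n4 : (2 * (Wp α r δ s * (χ x * Γ))) ^ r ≤
          2 ^ r * ((1 / δ ^ 2 + L ^ 2) * (max s 0 ^ α * ζ x)) := by
        rw [Real.mul_rpow (by norm_num) (by positivity)]
        gcongr
        rw [Real.mul_rpow hW (by positivity), Wp_rpow hα hr0 hδ, mul_right_comm,
          ← Real.mul_rpow hs (by positivity)]
        -- As r ≤ 2, the r-th power is at most one plus the square: the one is paid for by 1/δ² and
        -- the square by L².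
        have m1 := rpow_le_one_add_sq (r := r) (s := max s 0 * (χ x * Γ)) (by positivity) hr0
          (by linarith)
        by_cases hx : x ∈ tsupport χ
        · have m2 : (max s 0 * (χ x * Γ)) ^ 2 ≤ max s 0 ^ 2 * L ^ 2 := by
            rw [mul_pow]
            gcongr
            calc χ x * Γ ≤ 1 * Γ := by gcongr
              _ ≤ L := by rw [one_mul]; exact h.gradient_le x
          have m3 := sq_mul_wt_le (α := α) hδ s
          have m4 := wt_le_div (α := α) hδ s
          rw [h.eq_one x hx, mul_one]
          calc (max s 0 * (χ x * Γ)) ^ r * wt α δ s ≤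
                (1 + max s 0 ^ 2 * L ^ 2) * wt α δ s := by gcongr; linarith
            _ = wt α δ s + L ^ 2 * (max s 0 ^ 2 * wt α δ s) := by ring
            _ ≤ max s 0 ^ α / δ ^ 2 + L ^ 2 * max s 0 ^ α := by gcongr
            _ = _ := by ring
        · rw [image_eq_zero_of_notMem_tsupport hx]
          simp only [zero_mul, mul_zero, Real.zero_rpow hr0.ne']
          positivity
      refine n2.trans ?_
      rw [hB, mul_assoc (2 ^ r : ℝ) ((1 + α / r) ^ r + 2 ^ r)]
      refine mul_le_mul_of_nonneg_left ?_ (Real.rpow_nonneg zero_le_two r)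
      have q1 : 0 ≤ ‖P‖ ^ r * wt α δ s * χ x ^ 2 := by positivity
      have q2 : 0 ≤ (1 / δ ^ 2 + L ^ 2) * (max s 0 ^ α * ζ x) := by positivity
      have q3 : 0 ≤ (1 + α / r) ^ r := by positivity
      have q4 : (0 : ℝ) ≤ 2 ^ r := by positivity
      nlinarith [mul_nonneg q3 q2, mul_nonneg q4 q1]
  -- Hölder's inequality
  have hPi : Integrable fun x => Phi α δ (p x t - k) * χ x ^ 2 :=
    integrable_mul_weight hU ((continuous_Phi hα hδ).comp_continuousOn hc) h.cutoff.sq.isWeight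
  have hvi : Integrable fun x => |v x| ^ q :=
    Continuous.integrable_of_hasCompactSupport
      (hvC.continuous.abs.rpow_const fun _ => Or.inr hq0.le)
      (hvs.comp_left (g := fun y => |y| ^ q) (by simp [Real.zero_rpow hq0.ne']))
  obtain ⟨hHi, hH⟩ := integral_rpow_mul_rpow_le hvi hPi (fun x => by positivity)
    (fun x => mul_nonneg (Phi_nonneg _) (sq_nonneg _)) (θ := 1 - μ) (θ' := μ) (by linarith) hμ0.le
    (by ring)
  have hi3 := integrable_mul_weight hU (continuousOn_slice
    (F := fun x t => max (p x t - (k + 2 * δ)) 0 ^ α)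
    (continuousOn_mass_integrand hp hα (k + 2 * δ)) ht') hζ'
  have hE : 0 ≤ locEnergy α δ k χ p t := locEnergy_nonneg t
  have hfirst : locMass α (k + 2 * δ) ζ' p t ≤ 4 * (4 * 2 ^ α) ^ μ * δ ^ (g.a - α * μ) *
      ∫ x, (|v x| ^ q) ^ (1 - μ) * (Phi α δ (p x t - k) * χ x ^ 2) ^ μ := by
    rw [locMass, ← integral_const_mul]
    refine integral_mono hi3 (hHi.const_mul _) fun x => ?_
    simp only
    have hPn := Phi_nonneg (α := α) (δ := δ) (p x t - k)
    -- Where `ζ'` does not vanish the inner cutoff equals one, so the different powers of χ in the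
    -- profile and in the energy are immaterial.
    by_cases hx : ζ' x = 0
    · rw [hx, mul_zero]; positivity
    · have h1 : |v x| ^ q = Wp α r δ (p x t - k) ^ q := by
        rw [abs_of_nonneg (hv0 x), hv]; simp only [hζ'χ x hx, one_pow, mul_one]
      rw [h1, hζ'χ x hx, one_pow, mul_one, ← Real.rpow_mul (Wp_nonneg hδ _),
        show q * (1 - μ) = r by rw [hq]; field_simp [(by linarith : (1 - μ) ≠ 0)]]
      have h2 := max_sub_rpow_le (α := α) hα hr0 hμ0.le (by rw [hr]; linarith) hδ (p x t - k)
      rw [show 2 - (r + α * μ) = g.a - α * μ by rw [hr]; ring, sub_sub] at h2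
      calc max (p x t - (k + 2 * δ)) 0 ^ α * ζ' x ≤ max (p x t - (k + 2 * δ)) 0 ^ α * 1 := by
            gcongr
            exact hζ'1 x
        _ ≤ _ := by rw [mul_one]; exact h2
  refine hfirst.trans ?_
  have hsv' : (∫ x, |v x| ^ q) ^ (1 - μ) ≤ S * (B * (locDissipation α r δ k χ p t +
      (1 / δ ^ 2 + L ^ 2) * locMass α k ζ p t)) := by
    rw [← hrq]
    exact hsv.trans (mul_le_mul_of_nonneg_left hgrad hS.le)
  have hfin := hH.trans (mul_le_mul_of_nonneg_right hsv'
    (Real.rpow_nonneg hE μ))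
  calc _ ≤ 4 * (4 * 2 ^ α) ^ μ * δ ^ (g.a - α * μ) * (S * (B * (locDissipation α r δ k χ p t +
      (1 / δ ^ 2 + L ^ 2) * locMass α k ζ p t)) * locEnergy α δ k χ p t ^ μ) := by
        gcongr
        exact hfin
    _ = _ := by ring

end Forchheimer

namespace Forchheimer

variable {n : ℕ} {U : Set (Pt n)} {g : Poly} {α : ℝ} {p Ψ : Pt n → ℝ → ℝ} {p₀ : Pt n → ℝ}

/-! ### De Giorgi iteration -/

/-- An energy inequality on `[t₁, T]` gives bounds on `[t₂, T]` in terms of the integral over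
`[t₁, T]`, by choosing a good starting time in `[t₁, t₂]`. -/
theorem energy_bound_of_deriv_le {E D G : ℝ → ℝ} {c N t₁ t₂ T : ℝ} (hc : 0 < c) (hN : 0 ≤ N)
    (h12 : t₁ < t₂) (h2T : t₂ ≤ T)
    (hE : ∀ t ∈ Icc t₁ T, ∃ e, HasDerivAt E e t ∧ e ≤ -(c * D t) + N * G t)
    (hD : ContinuousOn D (Icc t₁ T)) (hG : ContinuousOn G (Icc t₁ T)) (hD0 : ∀ t, 0 ≤ D t)
    (hE0 : ∀ t, 0 ≤ E t) (hG0 : ∀ t, 0 ≤ G t) (hEG : ∀ t ∈ Icc t₁ T, E t ≤ G t) :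
    (∀ t ∈ Icc t₂ T, E t ≤ (1 / (t₂ - t₁) + N) * ∫ t in t₁..T, G t) ∧
      c * ∫ t in t₂..T, D t ≤ (1 / (t₂ - t₁) + N) * ∫ t in t₁..T, G t := by
  choose! e he hle using hE
  have hEc : ContinuousOn E (Icc t₁ T) := fun t ht => (he t ht).continuousAt.continuousWithinAt
  have hint : ∀ {F : ℝ → ℝ}, ContinuousOn F (Icc t₁ T) → ∀ {a b : ℝ}, a ∈ Icc t₁ T → b ∈ Icc t₁ T →
      IntervalIntegrable F volume a b := fun {F} hF {a b} ha hb =>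
    (hF.mono (uIcc_subset_Icc ha hb)).intervalIntegrable
  have hm1 : t₁ ∈ Icc t₁ T := ⟨le_rfl, by linarith⟩
  have hmT : T ∈ Icc t₁ T := ⟨by linarith, le_rfl⟩
  have hm2 : t₂ ∈ Icc t₁ T := ⟨h12.le, h2T⟩
  have hsubint : ∀ {F : ℝ → ℝ}, ContinuousOn F (Icc t₁ T) → (∀ t, 0 ≤ F t) → ∀ {a b a' b' : ℝ},
      a' ≤ a → a ≤ b → b ≤ b' → t₁ ≤ a' → b' ≤ T →
      ∫ t in a..b, F t ≤ ∫ t in a'..b', F t := by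
    intro F hF hF0 a b a' b' h1 h2 h3 h4 h5
    exact intervalIntegral.integral_mono_interval h1 h2 h3 (ae_of_all _ hF0)
      (hint hF ⟨h4, by linarith⟩ ⟨by linarith, h5⟩)
  -- The minimum of E over [t₁, t₂] is at most its average there; starting at the minimizer replaces
  -- a cutoff in time and produces the factor 1/(t₂ - t₁).
  obtain ⟨s, hs, hmin⟩ := isCompact_Icc.exists_isMinOn (nonempty_Icc.2 h12.le)
    (hEc.mono (Icc_subset_Icc_right h2T))
  have hsI : s ∈ Icc t₁ T := ⟨hs.1, hs.2.trans h2T⟩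
  set Y := ∫ t in t₁..T, G t with hY
  have hEs : E s ≤ 1 / (t₂ - t₁) * Y := by
    have h1 : ∫ _ in t₁..t₂, E s ≤ ∫ t in t₁..t₂, G t :=
      intervalIntegral.integral_mono_on h12.le (by simp) (hint hG hm1 hm2) fun t ht =>
        (hmin ht).trans (hEG t ⟨ht.1, ht.2.trans h2T⟩)
    have h2 := hsubint hG hG0 le_rfl h12.le h2T le_rfl le_rfl
    rw [intervalIntegral.integral_const, smul_eq_mul] at h1
    rw [one_div, inv_mul_eq_div, le_div_iff₀ (by linarith)]
    linarith
  have key : ∀ t ∈ Icc t₂ T, E t + c * ∫ u in s..t, D u ≤ (1 / (t₂ - t₁) + N) * Y := by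
    intro t ht
    have hst : s ≤ t := hs.2.trans ht.1
    have htI : t ∈ Icc t₁ T := ⟨by linarith [ht.1], ht.2⟩
    have hsub : Icc s t ⊆ Icc t₁ T := Icc_subset_Icc hs.1 ht.2
    have hφ : ContinuousOn (fun u => -(c * D u) + N * G u) (Icc t₁ T) :=
      (continuousOn_const.mul hD).neg.add (continuousOn_const.mul hG)
    -- Only the continuous upper bound of E' is integrated; E' itself is not known to be integrable.
    have h1 := intervalIntegral.sub_le_integral_of_hasDeriv_right_of_le hst (hEc.mono hsub)
      (fun x hx => (he x (hsub (Ioo_subset_Icc_self hx))).hasDerivWithinAt)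
      ((hφ.mono hsub).integrableOn_Icc) (fun x hx => hle x (hsub (Ioo_subset_Icc_self hx)))
    rw [intervalIntegral.integral_add (f := fun u => -(c * D u)) ((hint hD hsI htI).const_mul c).neg
      ((hint hG hsI htI).const_mul N), intervalIntegral.integral_neg,
      intervalIntegral.integral_const_mul, intervalIntegral.integral_const_mul] at h1
    have h2 := mul_le_mul_of_nonneg_left (hsubint hG hG0 hs.1 hst ht.2 le_rfl le_rfl) hN
    linarith
  refine ⟨fun t ht => ?_, ?_⟩
  · have h1 := key t ht
    have h2 : 0 ≤ ∫ u in s..t, D u :=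
      intervalIntegral.integral_nonneg (hs.2.trans ht.1) fun u _ => hD0 u
    nlinarith
  · have h1 := key T ⟨h2T, le_rfl⟩
    have h2 := mul_le_mul_of_nonneg_left (hsubint hD hD0 hs.2 h2T le_rfl hs.1 le_rfl) hc.le
    linarith [hE0 T]

/-- The Caccioppoli inequality bounds both the energy at every time and the integrated dissipation
by MY, where Y is the old mass and M the sum of the three inverse scales. Inserting this into the
spatial Sobolev estimate and integrating in time gives (MY)^μ · MY with μ = r/n; the exponent beyond
one is the gain that drives the iteration. -/
theorem exists_deGiorgi_step (g : Poly) (hn : 2 ≤ n) (hUb : Bornology.IsBounded U) (hU : IsOpen U)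
    (hα : 2 ≤ α) (hκ : g.a ≤ α * ((2 - g.a) / n)) : ∃ C : ℝ, 0 < C ∧
    ∀ {p Ψ : Pt n → ℝ → ℝ} {p₀ : Pt n → ℝ}, IsSolution g U α p p₀ Ψ →
      ∀ {χ ζ ζ' : Pt n → ℝ} {L δ : ℝ}, IsInnerCutoff U χ ζ L → IsWeight U ζ' →
      (∀ x, 0 ≤ ζ' x) → (∀ x, ζ' x ≤ 1) → (∀ x, ζ' x ≠ 0 → χ x = 1) → 0 < δ →
      ∀ (k : ℝ) {t₁ t₂ T : ℝ}, 0 < t₁ → t₁ < t₂ → t₂ ≤ T →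
        ∫ t in t₂..T, locMass α (k + 2 * δ) ζ' p t ≤
          C * δ ^ (g.a - α * ((2 - g.a) / n)) * ((1 / (t₂ - t₁) + (1 / δ ^ 2 + L ^ 2)) *
            ∫ t in t₁..T, locMass α k ζ p t) ^ (1 + (2 - g.a) / n) := by
  obtain ⟨c, Ce, hc, hCe, henergy⟩ := exists_hasDerivAt_locEnergy_le g hα
  obtain ⟨Cs, hCs, hsob⟩ := exists_locMass_le g hn hUb hU hα hκ
  have ha1 := g.a_lt_one
  set μ : ℝ := (2 - g.a) / n with hμ
  have hμ0 : 0 < μ := div_pos (by linarith) (by positivity)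
  refine ⟨Cs * ((1 + Ce) ^ μ * ((1 + Ce) / c + 1)), by positivity, ?_⟩
  intro p Ψ p₀ hp χ ζ ζ' L δ h hζ' hζ'0 hζ'1 hζ'χ hδ k t₁ t₂ T h1 h12 h2T
  have hsub : Icc t₁ T ⊆ Ioi 0 := fun t ht => h1.trans_le ht.1
  have hsub2 : Icc t₂ T ⊆ Icc t₁ T := Icc_subset_Icc_left h12.le
  have hDc := (continuousOn_locDissipation hU hp hα (r := 2 - g.a) (by linarith) hδ h.cutoff
    k).mono hsub
  have hGc := (continuousOn_locMass hU hp hα h.weight k).mono hsub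
  have hHc := (continuousOn_locMass hU hp hα hζ' (k + 2 * δ)).mono hsub
  set V := 1 / δ ^ 2 + L ^ 2 with hV
  have hV0 : 0 < V := by positivity
  have h12' : 0 < 1 / (t₂ - t₁) := one_div_pos.2 (by linarith)
  set M := 1 / (t₂ - t₁) + V with hM
  have hM0 : 0 < M := by positivity
  set Y := ∫ t in t₁..T, locMass α k ζ p t with hY
  have hY0 : 0 ≤ Y := intervalIntegral.integral_nonneg (by linarith) fun t _ =>
    locMass_nonneg h.nonneg t
  obtain ⟨b1, b2⟩ := energy_bound_of_deriv_le (E := locEnergy α δ k χ p)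
    (D := locDissipation α (2 - g.a) δ k χ p) (G := locMass α k ζ p) hc
    (N := Ce * V) (by positivity) h12 h2T
    (fun t ht => henergy hU hp h hδ k (hsub ht)) hDc hGc locDissipation_nonneg locEnergy_nonneg
    (locMass_nonneg h.nonneg) (fun t ht => locEnergy_le_locMass hU hp hα hδ h (hsub ht))
  rw [← hY] at b1 b2
  have hQ : (1 / (t₂ - t₁) + Ce * V) * Y ≤ (1 + Ce) * (M * Y) := by
    rw [← mul_assoc]
    refine mul_le_mul_of_nonneg_right ?_ hY0
    rw [hM]
    nlinarith [mul_pos hCe h12']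
  have hMY : 0 ≤ M * Y := by positivity
  have hDi : IntervalIntegrable (locDissipation α (2 - g.a) δ k χ p) volume t₂ T :=
    (hDc.mono (by rw [uIcc_of_le h2T]; exact hsub2)).intervalIntegrable
  have hGi : IntervalIntegrable (locMass α k ζ p) volume t₂ T :=
    (hGc.mono (by rw [uIcc_of_le h2T]; exact hsub2)).intervalIntegrable
  have hHi : IntervalIntegrable (locMass α (k + 2 * δ) ζ' p) volume t₂ T :=
    (hHc.mono (by rw [uIcc_of_le h2T]; exact hsub2)).intervalIntegrable
  have hGle : ∫ t in t₂..T, locMass α k ζ p t ≤ Y :=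
    intervalIntegral.integral_mono_interval h12.le h2T le_rfl
      (ae_of_all _ (locMass_nonneg h.nonneg))
      (hGc.mono (by rw [uIcc_of_le (by linarith)])).intervalIntegrable
  calc ∫ t in t₂..T, locMass α (k + 2 * δ) ζ' p t ≤
        ∫ t in t₂..T, Cs * δ ^ (g.a - α * μ) * ((1 + Ce) * (M * Y)) ^ μ *
          (locDissipation α (2 - g.a) δ k χ p t + V * locMass α k ζ p t) := by
        refine intervalIntegral.integral_mono_on h2T hHi
          ((hDi.add (hGi.const_mul V)).const_mul _) fun t ht => ?_
        refine (hsob hp h hζ' hζ'0 hζ'1 hζ'χ hδ k (hsub (hsub2 ht))).trans ?_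
        have e1 := locDissipation_nonneg (α := α) (r := 2 - g.a) (δ := δ) (k := k) (χ := χ)
          (p := p) t
        have e2 := locMass_nonneg (α := α) (k := k) (p := p) h.nonneg t
        have e3 := locEnergy_nonneg (α := α) (δ := δ) (k := k) (χ := χ) (p := p) t
        gcongr
        exact (b1 t ht).trans hQ
    _ = Cs * δ ^ (g.a - α * μ) * ((1 + Ce) * (M * Y)) ^ μ *
          ((∫ t in t₂..T, locDissipation α (2 - g.a) δ k χ p t) +
            V * ∫ t in t₂..T, locMass α k ζ p t) := by
        rw [intervalIntegral.integral_const_mul, intervalIntegral.integral_add hDi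
          (hGi.const_mul V), intervalIntegral.integral_const_mul]
    _ ≤ Cs * δ ^ (g.a - α * μ) * ((1 + Ce) * (M * Y)) ^ μ *
          ((1 + Ce) / c * (M * Y) + M * Y) := by
        gcongr
        · rw [div_mul_eq_mul_div, le_div_iff₀ hc]
          linarith
        · exact intervalIntegral.integral_nonneg h2T fun t _ => locMass_nonneg h.nonneg t
        · linarith
    _ = _ := by
        rw [Real.mul_rpow (by positivity) hMY, Real.rpow_add_of_nonneg hMY zero_le_one hμ0.le,
          Real.rpow_one]
        ring

/-- Fast geometric convergence. -/
theorem le_mul_rpow_of_superlinear {Y : ℕ → ℝ} {A B μ : ℝ} (hY : ∀ j, 0 ≤ Y j) (hA : 0 ≤ A)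
    (hB : 0 < B) (hμ : 0 < μ) (hrec : ∀ j : ℕ, Y (j + 1) ≤ A * B ^ (j : ℝ) * Y j ^ (1 + μ))
    (h0 : A * Y 0 ^ μ * B ^ (1 / μ) ≤ 1) (j : ℕ) : Y j ≤ Y 0 * B ^ (-(j : ℝ) / μ) := by
  induction j with
  | zero => simp
  | succ j ih =>
    have hY0 := hY 0
    calc Y (j + 1) ≤ A * B ^ (j : ℝ) * Y j ^ (1 + μ) := hrec j
      _ ≤ A * B ^ (j : ℝ) * (Y 0 * B ^ (-(j : ℝ) / μ)) ^ (1 + μ) := by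
          gcongr
          exact hY j
      _ = Y 0 * (A * Y 0 ^ μ * B ^ (1 / μ)) * B ^ (-((j + 1 : ℕ) : ℝ) / μ) := by
          rw [Real.mul_rpow hY0 (by positivity), ← Real.rpow_mul hB.le,
            Real.rpow_add_of_nonneg hY0 zero_le_one hμ.le, Real.rpow_one]
          -- The rate B^{-1/μ} is the one for which the growth B^j and the superlinear power
          -- balance, leaving exactly the factor B^{1/μ} of the smallness condition.
          have : B ^ (j : ℝ) * B ^ (-(j : ℝ) / μ * (1 + μ)) =
              B ^ (1 / μ) * B ^ (-((j + 1 : ℕ) : ℝ) / μ) := by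
            rw [← Real.rpow_add hB, ← Real.rpow_add hB]
            congr 1
            push_cast
            field_simp
            ring
          linear_combination A * Y 0 * Y 0 ^ μ * this
      _ ≤ Y 0 * 1 * B ^ (-((j + 1 : ℕ) : ℝ) / μ) := by gcongr
      _ = _ := by rw [mul_one]

/-- The nested cutoff functions generated by a single one. -/
noncomputable def nestedCutoff (f : Pt n → ℝ) (j : ℕ) (x : Pt n) : ℝ :=
  Real.smoothTransition (2 ^ (j + 2) * (f x - (3 / 4 - 1 / 2 ^ (j + 1))))

theorem exists_deriv_smoothTransition_le :
    ∃ M : ℝ, 0 < M ∧ ∀ s, |deriv Real.smoothTransition s| ≤ M := by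
  have hc : Continuous (deriv Real.smoothTransition) :=
    (Real.smoothTransition.contDiff (n := 1)).continuous_deriv (by norm_num)
  obtain ⟨M, hM⟩ := (isCompact_Icc (a := (0 : ℝ)) (b := 1)).exists_bound_of_continuousOn
    hc.continuousOn
  refine ⟨max M 1, by positivity, fun s => ?_⟩
  rcases lt_or_ge s 0 with hs | hs
  · have : Real.smoothTransition =ᶠ[𝓝 s] fun _ => 0 := by
      filter_upwards [Iio_mem_nhds hs] with u hu
      exact Real.smoothTransition.zero_of_nonpos (le_of_lt hu)
    rw [this.deriv_eq]; simp
  rcases lt_or_ge 1 s with hs' | hs'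
  · have : Real.smoothTransition =ᶠ[𝓝 s] fun _ => 1 := by
      filter_upwards [Ioi_mem_nhds hs'] with u hu
      exact Real.smoothTransition.one_of_one_le (le_of_lt hu)
    rw [this.deriv_eq]; simp
  · exact (hM s ⟨hs, hs'⟩).trans (le_max_left _ _)

section nested

variable {f : Pt n → ℝ} (hf : IsCutoff U f)
include hf

/-- The thresholds 3/4 - 2^{-(j+1)} increase from 1/4 towards 3/4. The j-th transition has width
2^{-(j+2)} in the values of `f` and ends exactly at the next threshold, so each cutoff equals one on
the support of its successor. -/
theorem tsupport_nestedCutoff_subset (j : ℕ) :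
    tsupport (nestedCutoff f j) ⊆ {x | 3 / 4 - 1 / 2 ^ (j + 1) ≤ f x} := by
  refine closure_minimal (fun x hx => ?_) (isClosed_le continuous_const hf.contDiff.continuous)
  rw [mem_ofPred_eq]
  by_contra! h
  refine hx (Real.smoothTransition.zero_of_nonpos ?_)
  exact mul_nonpos_of_nonneg_of_nonpos (by positivity) (by linarith)

theorem isCutoff_nestedCutoff (j : ℕ) : IsCutoff U (nestedCutoff f j) := by
  have hsub : tsupport (nestedCutoff f j) ⊆ tsupport f := by
    refine (tsupport_nestedCutoff_subset hf j).trans fun x hx => subset_tsupport f ?_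
    have h1 : (1 : ℝ) / 2 ^ (j + 1) ≤ 1 / 2 := by
      have : (1 : ℝ) ≤ 2 ^ j := one_le_pow₀ (by norm_num)
      rw [pow_succ]
      gcongr
      linarith
    rw [mem_ofPred_eq] at hx
    exact (by linarith : 0 < f x).ne'
  exact ⟨Real.smoothTransition.contDiff.comp
      (contDiff_const.mul (hf.contDiff.sub contDiff_const)),
    hf.compact.of_isClosed_subset (isClosed_tsupport _) hsub, hsub.trans hf.subset,
    fun x => Real.smoothTransition.nonneg _, fun x => Real.smoothTransition.le_one _⟩

theorem nestedCutoff_eq_one (j : ℕ) {x : Pt n} (hx : x ∈ tsupport (nestedCutoff f (j + 1))) :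
    nestedCutoff f j x = 1 := by
  have h := tsupport_nestedCutoff_subset hf (j + 1) hx
  rw [mem_ofPred_eq] at h
  refine Real.smoothTransition.one_of_one_le ?_
  have e : (1 : ℝ) / 2 ^ (j + 1) = 2 * (1 / 2 ^ (j + 1 + 1)) := by
    rw [pow_succ 2 (j + 1)]; field_simp
  have h2 : 1 / 2 ^ (j + 1 + 1) ≤ f x - (3 / 4 - 1 / 2 ^ (j + 1)) := by linarith
  calc (1 : ℝ) = 2 ^ (j + 2) * (1 / 2 ^ (j + 1 + 1)) := by field_simp
    _ ≤ _ := by gcongr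

theorem exists_gradient_nestedCutoff_le :
    ∃ M : ℝ, 0 < M ∧ ∀ (j : ℕ) (x : Pt n), ‖gradient (nestedCutoff f j) x‖ ≤ M * 2 ^ j := by
  obtain ⟨M, hM, hM'⟩ := exists_deriv_smoothTransition_le
  obtain ⟨F, hF⟩ := hf.compact.exists_bound_of_continuousOn
    (continuous_gradient hf.contDiff).continuousOn
  have hF' : ∀ x, ‖gradient f x‖ ≤ max F 1 := fun x => by
    by_cases hx : x ∈ tsupport f
    · exact (hF x hx).trans (le_max_left _ _)
    · rw [gradient_eq_zero_of_notMem_tsupport hx, norm_zero]; positivity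
  refine ⟨M * 4 * max F 1, by positivity, fun j x => ?_⟩
  have h1 : HasFDerivAt (fun x => 2 ^ (j + 2) * (f x - (3 / 4 - 1 / 2 ^ (j + 1))))
      ((2 : ℝ) ^ (j + 2) • fderiv ℝ f x) x :=
    (((hf.contDiff.differentiable one_ne_zero) x).hasFDerivAt.sub_const _).const_mul _
  have h2 : HasDerivAt Real.smoothTransition
      (deriv Real.smoothTransition (2 ^ (j + 2) * (f x - (3 / 4 - 1 / 2 ^ (j + 1)))))
      (2 ^ (j + 2) * (f x - (3 / 4 - 1 / 2 ^ (j + 1)))) :=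
    ((Real.smoothTransition.contDiff (n := 1)).differentiable (by norm_num) _).hasDerivAt
  have h3 : fderiv ℝ (nestedCutoff f j) x = _ := (h2.comp_hasFDerivAt x h1).fderiv
  rw [norm_gradient_eq, h3, norm_smul, norm_smul, Real.norm_eq_abs, ← norm_gradient_eq,
    Real.norm_of_nonneg (by positivity)]
  calc _ ≤ M * (2 ^ (j + 2) * max F 1) := by
        gcongr
        · exact hM' _
        · exact hF' x
    _ = _ := by ring

end nested

end Forchheimer

/-! ### From the iteration to a pointwise upper bound in the interior. -/

namespace Forchheimer

variable {n : ℕ} {U : Set (Pt n)} {g : Poly} {α : ℝ} {p Ψ : Pt n → ℝ → ℝ} {p₀ : Pt n → ℝ}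

/-- If p exceeded k at such a point at the final time, continuity in space would make the mass at T
positive, and continuity in time would make the integral positive. The bound therefore holds at
every point, including the final time, with no exceptional null set. -/
theorem le_of_integral_locMass_nonpos (hU : IsOpen U) (hp : IsSolution g U α p p₀ Ψ) (hα : 2 ≤ α)
    {ζ : Pt n → ℝ} (hζ : IsWeight U ζ) (hζ0 : ∀ x, 0 ≤ ζ x) {k t₁ T : ℝ} (ht₁ : 0 < t₁)
    (h1T : t₁ < T) (h : ∫ t in t₁..T, locMass α k ζ p t ≤ 0) {x : Pt n} (hx : 0 < ζ x) :
    p x T ≤ k := by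
  by_contra! hlt
  have hT : T ∈ Ioi (0 : ℝ) := ht₁.trans h1T
  have hcont := continuous_mul_weight hU (continuousOn_slice
    (F := fun x t => max (p x t - k) 0 ^ α) (continuousOn_mass_integrand hp hα k) hT) hζ
  have hpos : 0 < locMass α k ζ p T := by
    refine hcont.integral_pos_of_hasCompactSupport_nonneg_nonzero
      (hasCompactSupport_mul_weight hζ)
      (fun y => mul_nonneg (Real.rpow_nonneg (le_max_right _ _) _) (hζ0 y)) (x := x) ?_
    have : 0 < max (p x T - k) 0 := lt_max_of_lt_left (by linarith)
    positivity
  have hsub : Icc t₁ T ⊆ Ioi 0 := fun t ht => ht₁.trans_le ht.1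
  have h2 : 0 < ∫ t in t₁..T, locMass α k ζ p t :=
    intervalIntegral.integral_pos h1T ((continuousOn_locMass hU hp hα hζ k).mono hsub)
      (fun t _ => locMass_nonneg hζ0 t) ⟨T, ⟨h1T.le, le_rfl⟩, hpos⟩
  linarith

theorem locMass_le_locMass (hU : IsOpen U) (hp : IsSolution g U α p p₀ Ψ) (hα : 2 ≤ α)
    {ζ ζ' : Pt n → ℝ} (hζ : IsWeight U ζ) (hζ' : IsWeight U ζ') (hζ0 : ∀ x, 0 ≤ ζ x)
    (hle : ∀ x, ζ x ≤ ζ' x) {k k' : ℝ} (hk : k' ≤ k) {t : ℝ} (ht : 0 < t) :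
    locMass α k ζ p t ≤ locMass α k' ζ' p t := by
  have hi : ∀ k {ζ : Pt n → ℝ}, IsWeight U ζ →
      Integrable fun x => max (p x t - k) 0 ^ α * ζ x := fun k ζ hζ =>
    integrable_mul_weight hU (continuousOn_slice (F := fun x t => max (p x t - k) 0 ^ α)
      (continuousOn_mass_integrand hp hα k) (mem_Ioi.2 ht)) hζ
  refine integral_mono (hi k hζ) (hi k' hζ') fun x => ?_
  have h1 : max (p x t - k) 0 ≤ max (p x t - k') 0 := max_le_max_right _ (by linarith)
  exact mul_le_mul (Real.rpow_le_rpow (le_max_right _ _) h1 (by linarith)) (hle x) (hζ0 x)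
    (Real.rpow_nonneg (le_max_right _ _) _)

theorem isInnerCutoff_nestedCutoff {f : Pt n → ℝ} (hf : IsCutoff U f) {M : ℝ}
    (hM : ∀ (j : ℕ) (x : Pt n), ‖gradient (nestedCutoff f j) x‖ ≤ M * 2 ^ j) (j : ℕ) :
    IsInnerCutoff U (nestedCutoff f (j + 1)) (nestedCutoff f j) (M * 2 ^ (j + 1)) where
  cutoff := isCutoff_nestedCutoff hf _
  weight := (isCutoff_nestedCutoff hf _).isWeight
  nonneg := (isCutoff_nestedCutoff hf _).nonneg
  eq_one _ hx := nestedCutoff_eq_one hf j hx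
  gradient_le := hM _

/-- The three terms come from the time step τ2^{-(j+1)}, the level parameter δ = k2^{-(j+2)} and the
cutoff gradient M2^{2j+1}. The worst growth is that of the squared gradient, 16^j, and τ ≤ 1 ≤ k
allows everything to be put over τ. -/
theorem deGiorgi_factor_le {M k τ : ℝ} (hk : 1 ≤ k) (hτ : 0 < τ) (hτ1 : τ ≤ 1) (j : ℕ) :
    1 / (τ * (1 / 2 ^ (j + 1))) +
        (1 / (k * (1 / 2 ^ (j + 2))) ^ 2 + (M * 2 ^ (2 * j + 1)) ^ 2) ≤
      (18 + 4 * M ^ 2) * 16 ^ j / τ := by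
  have h2 : (2 : ℝ) ^ j ≤ 16 ^ j := pow_le_pow_left₀ (by norm_num) (by norm_num) j
  have h4 : (4 : ℝ) ^ j ≤ 16 ^ j := pow_le_pow_left₀ (by norm_num) (by norm_num) j
  have e1 : 1 / (τ * (1 / (2 : ℝ) ^ (j + 1))) = 2 * 2 ^ j / τ := by
    rw [pow_succ]; field_simp
  have e2 : 1 / (k * (1 / (2 : ℝ) ^ (j + 2))) ^ 2 = 16 * 4 ^ j / k ^ 2 := by
    rw [show (4 : ℝ) = 2 ^ 2 by norm_num, ← pow_mul, mul_comm 2 j, pow_mul, pow_add]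
    field_simp
    norm_num
  have e3 : (M * (2 : ℝ) ^ (2 * j + 1)) ^ 2 = 4 * M ^ 2 * 16 ^ j := by
    rw [show (16 : ℝ) = (2 ^ 2) ^ 2 by norm_num, ← pow_mul, ← pow_mul, pow_succ 2 (2 * j)]
    ring
  have hτ' : 1 ≤ 1 / τ := by rw [one_le_div hτ]; exact hτ1
  have h16 : (0 : ℝ) < 16 ^ j := by positivity
  have b2 : 16 * (4 : ℝ) ^ j / k ^ 2 ≤ 16 * 16 ^ j / τ := by
    have : τ ≤ k ^ 2 := by nlinarith
    gcongr
  have b3 : 4 * M ^ 2 * (16 : ℝ) ^ j ≤ 4 * M ^ 2 * 16 ^ j / τ := by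
    rw [le_div_iff₀ hτ]
    have : 0 ≤ 4 * M ^ 2 * (16 : ℝ) ^ j := by positivity
    nlinarith
  have b1 : 2 * (2 : ℝ) ^ j / τ ≤ 2 * 16 ^ j / τ := by gcongr
  rw [e1, e2, e3]
  calc _ ≤ 2 * 16 ^ j / τ + (16 * 16 ^ j / τ + 4 * M ^ 2 * 16 ^ j / τ) := by gcongr
    _ = _ := by ring

/-- Bookkeeping that isolates the geometric growth: 2^e per step from the shrinking level increment
and 16^{1+μ} from the scales. -/
theorem deGiorgi_factor_eq {k τ e μ Q c Y : ℝ} (hk : 0 < k) (hτ : 0 < τ) (hQ : 0 < Q)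
    (hY : 0 ≤ Y) (j : ℕ) :
    c * (k * (1 / 2 ^ (j + 2))) ^ (-e) * (Q * 16 ^ j / τ * Y) ^ (1 + μ) =
      (c * 4 ^ e * Q ^ (1 + μ) * (k ^ (-e) * τ ^ (-(1 + μ)))) *
        (2 ^ e * 16 ^ (1 + μ)) ^ (j : ℝ) * Y ^ (1 + μ) := by
  have h2 : ((2 : ℝ) ^ (j + 2)) ^ e = 4 ^ e * (2 ^ e) ^ (j : ℝ) := by
    rw [pow_add, Real.mul_rpow (by positivity) (by positivity), ← Real.rpow_natCast 2 j,
      ← Real.rpow_mul (by norm_num), ← Real.rpow_mul (by norm_num), mul_comm (j : ℝ) e,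
      mul_comm]
    norm_num
  have h16 : ((16 : ℝ) ^ j) ^ (1 + μ) = (16 ^ (1 + μ)) ^ (j : ℝ) := by
    rw [← Real.rpow_natCast 16 j, ← Real.rpow_mul (by norm_num), ← Real.rpow_mul (by norm_num),
      mul_comm]
  have e1 : (k * (1 / 2 ^ (j + 2))) ^ (-e) = k ^ (-e) * (4 ^ e * (2 ^ e) ^ (j : ℝ)) := by
    rw [Real.mul_rpow hk.le (by positivity), one_div, Real.inv_rpow (by positivity),
      Real.rpow_neg (by positivity : (0 : ℝ) ≤ 2 ^ (j + 2)), inv_inv, h2]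
  rw [e1, Real.mul_rpow (by positivity) hY, Real.div_rpow (by positivity) hτ.le,
    Real.mul_rpow hQ.le (by positivity), Real.mul_rpow (by positivity) (by positivity), h16,
    Real.rpow_neg hτ.le]
  ring

set_option maxHeartbeats 1000000 in
/-- The interior upper bound for solutions in terms of the local space-time `L^α` norm. -/
theorem exists_local_sup_bound (g : Poly) (hn : 2 ≤ n) (hUb : Bornology.IsBounded U)
    (hU : IsOpen U) (hα : 2 ≤ α) (hκ : g.a < α * ((2 - g.a) / n)) {K : Set (Pt n)}
    (hK : IsCompact K) (hKU : K ⊆ U) :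
    ∃ (ζ : Pt n → ℝ) (C : ℝ), IsCutoff U ζ ∧ 0 < C ∧
      ∀ {p Ψ : Pt n → ℝ → ℝ} {p₀ : Pt n → ℝ}, IsSolution g U α p p₀ Ψ →
      ∀ {T τ : ℝ}, 0 < τ → τ ≤ 1 → 2 * τ < T → ∀ x ∈ K,
        p x T ≤ C * (1 + (τ ^ (-(1 + (2 - g.a) / n)) *
          (∫ t in (T - 2 * τ)..T, locMass α 0 ζ p t) ^ ((2 - g.a) / n)) ^
            (1 / (α * ((2 - g.a) / n) - g.a))) := by
  obtain ⟨f, hf, hf1⟩ := exists_isCutoff hK hU hKU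
  obtain ⟨Cst, hCst, hstep⟩ := exists_deGiorgi_step g hn hUb hU hα hκ.le
  obtain ⟨M, hM, hgrad⟩ := exists_gradient_nestedCutoff_le hf
  have ha1 := g.a_lt_one
  set μ : ℝ := (2 - g.a) / n with hμ
  have hμ0 : 0 < μ := div_pos (by linarith) (by positivity)
  set e : ℝ := α * μ - g.a with he
  have he0 : 0 < e := by linarith
  set Q : ℝ := 18 + 4 * M ^ 2 with hQ
  have hQ0 : 0 < Q := by positivity
  set A₀ : ℝ := Cst * 4 ^ e * Q ^ (1 + μ) with hA₀
  have hA₀0 : 0 < A₀ := by positivity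
  set B : ℝ := 2 ^ e * 16 ^ (1 + μ) with hB
  have hB1 : 1 < B := by
    have h1 : (1 : ℝ) < 2 ^ e := Real.one_lt_rpow (by norm_num) he0
    have h2 : (1 : ℝ) < 16 ^ (1 + μ) := Real.one_lt_rpow (by norm_num) (by linarith)
    nlinarith
  have hB0 : 0 < B := by linarith
  set A₁ : ℝ := A₀ * B ^ (1 / μ) with hA₁
  have hA₁0 : 0 < A₁ := by positivity
  refine ⟨nestedCutoff f 0, 1 + A₁ ^ (1 / e), isCutoff_nestedCutoff hf 0, by positivity, ?_⟩
  intro p Ψ p₀ hp T τ hτ hτ1 hT x hx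
  have hcut := fun j => isCutoff_nestedCutoff hf j
  set Y₀ := ∫ t in (T - 2 * τ)..T, locMass α 0 (nestedCutoff f 0) p t with hY₀
  have hY₀0 : 0 ≤ Y₀ := intervalIntegral.integral_nonneg (by linarith) fun t _ =>
    locMass_nonneg (hcut 0).nonneg t
  set Z := τ ^ (-(1 + μ)) * Y₀ ^ μ with hZ
  have hZ0 : 0 ≤ Z := by positivity
  -- Chosen so that k^e ≥ A₁Z, which is the smallness condition for the first mass; the summand one
  -- secures k ≥ 1, needed to compare the scales.
  set k : ℝ := 1 + (A₁ * Z) ^ (1 / e) with hk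
  have hk1 : 1 ≤ k := le_add_of_nonneg_right (by positivity)
  have hk0 : 0 < k := by linarith
  have hke : A₁ * Z ≤ k ^ e := by
    calc A₁ * Z = ((A₁ * Z) ^ (1 / e)) ^ e := by
          rw [← Real.rpow_mul (by positivity), one_div_mul_cancel he0.ne', Real.rpow_one]
      _ ≤ k ^ e := Real.rpow_le_rpow (by positivity) (by linarith) he0.le
  have hgoal : p x T ≤ k → p x T ≤ (1 + A₁ ^ (1 / e)) * (1 + Z ^ (1 / e)) := fun h => by
    refine h.trans ?_
    rw [hk, Real.mul_rpow hA₁0.le hZ0]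
    have h1 : 0 ≤ A₁ ^ (1 / e) := by positivity
    have h2 : 0 ≤ Z ^ (1 / e) := by positivity
    nlinarith
  apply hgoal
  -- the iteration
  set lev : ℕ → ℝ := fun j => k * (1 - 1 / 2 ^ j) with hlev
  set tm : ℕ → ℝ := fun j => T - τ * (1 + 1 / 2 ^ j) with htm
  have hpow : ∀ j : ℕ, (0 : ℝ) < 1 / 2 ^ j ∧ (1 : ℝ) / 2 ^ j ≤ 1 := fun j =>
    ⟨by positivity, by rw [div_le_one (by positivity)]; exact one_le_pow₀ (by norm_num)⟩
  have htm0 : ∀ j, 0 < tm j := fun j => by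
    simp only [htm]; nlinarith [hpow j]
  -- The cutoff index advances by two per step, because the odd one in between serves as the inner
  -- cutoff of the energy estimate.
  set Y : ℕ → ℝ := fun j => ∫ t in (tm j)..T, locMass α (lev j) (nestedCutoff f (2 * j)) p t
    with hY
  have hYn : ∀ j, 0 ≤ Y j := fun j => by
    refine intervalIntegral.integral_nonneg ?_ fun t _ => locMass_nonneg (hcut _).nonneg t
    simp only [htm]; nlinarith [hpow j]
  have hYz : Y 0 = Y₀ := by
    simp only [hY, hY₀, htm, hlev]
    norm_num
    rw [mul_comm]
  have hrec : ∀ j : ℕ, Y (j + 1) ≤ (A₀ * (k ^ (-e) * τ ^ (-(1 + μ)))) * B ^ (j : ℝ) *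
      Y j ^ (1 + μ) := by
    intro j
    have hd : (1 : ℝ) / 2 ^ j - 1 / 2 ^ (j + 1) = 1 / 2 ^ (j + 1) := by
      rw [pow_succ]; field_simp; norm_num
    have hlt : tm j < tm (j + 1) := by
      simp only [htm]
      have := (hpow (j + 1)).1
      nlinarith
    have hle : tm (j + 1) ≤ T := by
      simp only [htm]
      have := (hpow (j + 1)).1
      nlinarith
    -- Half of the level increment k2^{-(j+1)}, since one step raises the level by 2δ.
    have hδ : 0 < k * (1 / 2 ^ (j + 2)) := by positivity
    have hmain := hstep hp (isInnerCutoff_nestedCutoff hf hgrad (2 * j))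
      (hcut (2 * j + 2)).isWeight (hcut (2 * j + 2)).nonneg (hcut (2 * j + 2)).le_one
      (fun y hy => nestedCutoff_eq_one hf (2 * j + 1) (subset_tsupport _ hy)) hδ (lev j)
      (htm0 j) hlt hle
    have hl : lev j + 2 * (k * (1 / 2 ^ (j + 2))) = lev (j + 1) := by
      simp only [hlev]
      have : 2 * (1 / (2 : ℝ) ^ (j + 2)) = 1 / 2 ^ (j + 1) := by
        rw [pow_succ 2 (j + 1)]; field_simp
      linear_combination k * this - k * hd
    have ht : tm (j + 1) - tm j = τ * (1 / 2 ^ (j + 1)) := by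
      simp only [htm]; linear_combination τ * hd
    rw [hl, ht] at hmain
    refine hmain.trans ?_
    have hfac := deGiorgi_factor_le (M := M) hk1 hτ hτ1 j
    have hneg : g.a - α * μ = -e := by rw [he]; ring
    have hYj : ∫ t in (tm j)..T, locMass α (lev j) (nestedCutoff f (2 * j)) p t = Y j := rfl
    rw [hneg, hYj]
    have hYnj := hYn j
    calc Cst * (k * (1 / 2 ^ (j + 2))) ^ (-e) *
          ((1 / (τ * (1 / 2 ^ (j + 1))) + (1 / (k * (1 / 2 ^ (j + 2))) ^ 2 +
            (M * 2 ^ (2 * j + 1)) ^ 2)) * Y j) ^ (1 + μ)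
        ≤ Cst * (k * (1 / 2 ^ (j + 2))) ^ (-e) * (Q * 16 ^ j / τ * Y j) ^ (1 + μ) := by
          gcongr
      _ = _ := deGiorgi_factor_eq hk0 hτ hQ0 hYnj j
  have hstart : (A₀ * (k ^ (-e) * τ ^ (-(1 + μ)))) * Y 0 ^ μ * B ^ (1 / μ) ≤ 1 := by
    rw [hYz]
    have : (A₀ * (k ^ (-e) * τ ^ (-(1 + μ)))) * Y₀ ^ μ * B ^ (1 / μ) = A₁ * Z / k ^ e := by
      rw [Real.rpow_neg hk0.le, hA₁, hZ]; field_simp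
    rw [this, div_le_one (by positivity)]
    exact hke
  have hdecay := le_mul_rpow_of_superlinear hYn (by positivity) hB0 hμ0 hrec hstart
  -- the limit
  set ζ : Pt n → ℝ := fun y => Real.smoothTransition (f y - 3 / 4) with hζ
  have hζw : IsWeight U ζ := hf.isWeight.of_support
    (Real.smoothTransition.continuous.comp (hf.contDiff.continuous.sub continuous_const))
    fun y hy => Real.smoothTransition.zero_of_nonpos (by rw [hy]; norm_num)
  have hζ0 : ∀ y, 0 ≤ ζ y := fun y => Real.smoothTransition.nonneg _
  have hζle : ∀ j y, ζ y ≤ nestedCutoff f j y := fun j y => by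
    rcases le_or_gt (f y) (3 / 4) with h | h
    · have : ζ y = 0 := Real.smoothTransition.zero_of_nonpos (by linarith)
      rw [this]; exact (hcut j).nonneg y
    · refine (Real.smoothTransition.le_one _).trans (le_of_eq ?_)
      refine (Real.smoothTransition.one_of_one_le ?_).symm
      have h1 : 1 / 2 ^ (j + 1) ≤ f y - (3 / 4 - 1 / 2 ^ (j + 1)) := by linarith
      calc (1 : ℝ) ≤ 2 ^ (j + 2) * (1 / 2 ^ (j + 1)) := by
            rw [pow_succ 2 (j + 1)]; field_simp; norm_num
        _ ≤ _ := by gcongr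
  have hlim : ∀ j, ∫ t in (T - τ)..T, locMass α k ζ p t ≤ Y j := by
    intro j
    have hsub : Icc (tm j) T ⊆ Ioi 0 := fun t ht => (htm0 j).trans_le ht.1
    have h1 : tm j ≤ T - τ := by simp only [htm]; nlinarith [hpow j]
    have hlevj : lev j ≤ k := by simp only [hlev]; nlinarith [hpow j]
    have hcont : ContinuousOn (locMass α (lev j) (nestedCutoff f (2 * j)) p) (Icc (tm j) T) :=
      (continuousOn_locMass hU hp hα (hcut _).isWeight _).mono hsub
    have hsub' : Icc (T - τ) T ⊆ Icc (tm j) T := Icc_subset_Icc_left h1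
    calc ∫ t in (T - τ)..T, locMass α k ζ p t
        ≤ ∫ t in (T - τ)..T, locMass α (lev j) (nestedCutoff f (2 * j)) p t := by
          refine intervalIntegral.integral_mono_on (by linarith) ?_ ?_ fun t ht => ?_
          · refine ((continuousOn_locMass hU hp hα hζw k).mono ?_).intervalIntegrable
            rw [uIcc_of_le (by linarith)]; exact hsub'.trans hsub
          · refine (hcont.mono ?_).intervalIntegrable
            rw [uIcc_of_le (by linarith)]; exact hsub'
          · exact locMass_le_locMass hU hp hα hζw (hcut _).isWeight hζ0 (hζle _) hlevj
              (hsub (hsub' ht))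
      _ ≤ Y j := intervalIntegral.integral_mono_interval h1 (by linarith) le_rfl
          (ae_of_all _ (locMass_nonneg (hcut _).nonneg))
          (hcont.mono (by rw [uIcc_of_le (by linarith)])).intervalIntegrable
  refine le_of_integral_locMass_nonpos hU hp hα hζw hζ0 (t₁ := T - τ) (by linarith) (by linarith)
    ?_ (x := x) ?_
  · have htend : Tendsto (fun j : ℕ => Y 0 * B ^ (-(j : ℝ) / μ)) atTop (𝓝 (Y 0 * 0)) := by
      refine Tendsto.const_mul _ ?_
      have hq : (fun j : ℕ => B ^ (-(j : ℝ) / μ)) = fun j : ℕ => (B ^ (-1 / μ)) ^ j := by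
        funext j
        rw [← Real.rpow_natCast (B ^ (-1 / μ)), ← Real.rpow_mul hB0.le]
        congr 1
        ring
      rw [hq]
      refine tendsto_pow_atTop_nhds_zero_of_lt_one (by positivity) ?_
      exact Real.rpow_lt_one_of_one_lt_of_neg hB1 (div_neg_of_neg_of_pos (by norm_num) hμ0)
    rw [mul_zero] at htend
    exact ge_of_tendsto' htend fun j => (hlim j).trans (hdecay j)
  · refine Real.smoothTransition.pos_of_pos ?_
    rw [hf1 x hx]; norm_num

end Forchheimer

namespace Forchheimer

variable {n : ℕ} {U : Set (Pt n)} {g : Poly} {α : ℝ} {p Ψ : Pt n → ℝ → ℝ} {p₀ : Pt n → ℝ}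

/-! ### The global energy inequality -/

/-- Young's inequality with a small parameter, in the form `z^σ X ≤ ε z + C X^{1/(1-σ)}`. -/
theorem rpow_mul_le_add {σ ε z X : ℝ} (hσ : 0 ≤ σ) (hσ1 : σ < 1) (hε : 0 < ε) (hz : 0 ≤ z)
    (hX : 0 ≤ X) :
    z ^ σ * X ≤ ε * z + (1 / ε) ^ (σ / (1 - σ)) * X ^ (1 / (1 - σ)) := by
  have h1 : 0 < 1 - σ := by linarith
  rcases le_total X (ε * z ^ (1 - σ)) with h | h
  · calc z ^ σ * X ≤ z ^ σ * (ε * z ^ (1 - σ)) := by gcongr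
      _ = ε * z := by
        have : z ^ σ * z ^ (1 - σ) = z := by
          rw [← Real.rpow_add_of_nonneg hz hσ h1.le]; simp
        linear_combination ε * this
      _ ≤ _ := le_add_of_nonneg_right (by positivity)
  · have h2 : z ≤ (1 / ε * X) ^ (1 / (1 - σ)) := by
      calc z = (z ^ (1 - σ)) ^ (1 / (1 - σ)) := by
            rw [← Real.rpow_mul hz, mul_one_div_cancel h1.ne', Real.rpow_one]
        _ ≤ _ := by
          refine Real.rpow_le_rpow (by positivity) ?_ (by positivity)
          rw [one_div, inv_mul_eq_div, le_div_iff₀ hε]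
          linarith
    calc z ^ σ * X ≤ ((1 / ε * X) ^ (1 / (1 - σ))) ^ σ * X := by gcongr
      _ = (1 / ε) ^ (σ / (1 - σ)) * X ^ (1 / (1 - σ)) := by
        rw [← Real.rpow_mul (by positivity), Real.mul_rpow (by positivity) hX, mul_assoc]
        congr 1
        · congr 1; ring
        · have : 1 / (1 - σ) = 1 / (1 - σ) * σ + 1 := by field_simp; ring
          conv_rhs => rw [this, Real.rpow_add_of_nonneg hX (by positivity) zero_le_one,
            Real.rpow_one]
      _ ≤ _ := le_add_of_nonneg_left (by positivity)

/-- A cutoff which equals one wherever `p - Ψ ≥ 1` at some time in a compact interval. -/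
theorem exists_isCutoff_superlevel (hU : IsOpen U) (hUb : Bornology.IsBounded U)
    (hp : IsSolution g U α p p₀ Ψ) (hΨ : IsBoundaryExtension U Ψ) {t₁ t₂ : ℝ} (ht₁ : 0 < t₁) :
    ∃ χ, IsCutoff U χ ∧ ∀ t ∈ Icc t₁ t₂, ∀ x ∈ U, 0 ≤ p x t - Ψ x t - 1 → χ x = 1 := by
  have hcomp : IsCompact (closure U ×ˢ Icc t₁ t₂) :=
    hUb.isCompact_closure.prod isCompact_Icc
  have hcont : ContinuousOn (fun z : Pt n × ℝ => p z.1 z.2 - Ψ z.1 z.2 - 1)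
      (closure U ×ˢ Icc t₁ t₂) :=
    ((hp.continuousOn.mono (prod_mono subset_rfl fun t ht => ht₁.trans_le ht.1)).sub
      (hΨ.continuousOn.mono (prod_mono subset_rfl fun t ht => ht₁.le.trans ht.1))).sub
      continuousOn_const
  have hK : IsCompact (Prod.fst '' ((closure U ×ˢ Icc t₁ t₂) ∩
      (fun z : Pt n × ℝ => p z.1 z.2 - Ψ z.1 z.2 - 1) ⁻¹' Ici 0)) :=
    (hcomp.of_isClosed_subset (hcont.preimage_isClosed_of_isClosed hcomp.isClosed isClosed_Ici)
      inter_subset_left).image continuous_fst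
  obtain ⟨χ, hχ, h1⟩ := exists_isCutoff hK hU (by
    rintro _ ⟨⟨x, t⟩, ⟨⟨hx, ht⟩, hpos⟩, rfl⟩
    -- The level one is used here: on the boundary p = Ψ, so p - Ψ - 1 = -1 and the closed
    -- superlevel set stays inside U.
    by_contra hxU
    have hfr : x ∈ frontier U := by rw [hU.frontier_eq]; exact ⟨hx, hxU⟩
    have := hp.boundary x hfr t (ht₁.trans_le ht.1)
    simp only [mem_preimage, mem_Ici, this] at hpos
    linarith)
  exact ⟨χ, hχ, fun t ht x hx hpos => h1 x ⟨(x, t), ⟨⟨subset_closure hx, ht⟩, hpos⟩, rfl⟩⟩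

/-- One is the maximal value of a cutoff, hence a critical value. This removes all the cutoff terms
from the global estimates. -/
theorem IsCutoff.gradient_eq_zero {χ : Pt n → ℝ} (hχ : IsCutoff U χ) {x : Pt n} (hx : χ x = 1) :
    gradient χ x = 0 := by
  have : IsLocalMax χ x := Eventually.of_forall fun y => by rw [hx]; exact hχ.le_one y
  rw [gradient, this.fderiv_eq_zero, map_zero]

/-- The dissipation of `(p - Ψ - 1)₊`. -/
noncomputable def globDissipation (α r : ℝ) (χ : Pt n → ℝ) (p Ψ : Pt n → ℝ → ℝ) (t : ℝ) : ℝ :=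
  ∫ x, (‖gradient (fun y => p y t) x - gradient (fun y => Ψ y t) x‖ ^ r *
    wt α 1 (p x t - Ψ x t - 1)) * χ x

/-- The `L^α` norm (to the power `α`) of `(p - Ψ - 1)₊`. -/
noncomputable def globMass (α : ℝ) (χ : Pt n → ℝ) (p Ψ : Pt n → ℝ → ℝ) (t : ℝ) : ℝ :=
  ∫ x, max (p x t - Ψ x t - 1) 0 ^ α * χ x

section slices

variable (hp : IsSolution g U α p p₀ Ψ) (hΨ : IsBoundaryExtension U Ψ) {t : ℝ} (ht : 0 < t)
include hp hΨ ht

theorem continuousOn_difference_slice (k : ℝ) : ContinuousOn (fun x => p x t - Ψ x t - k) U :=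
  continuousOn_slice (F := fun x t => p x t - Ψ x t - k) (continuousOn_difference hp hΨ k)
    (mem_Ioi.2 ht)

theorem continuousOn_gradient_difference_slice : ContinuousOn
    (fun x => gradient (fun y => p y t) x - gradient (fun y => Ψ y t) x) U :=
  (continuousOn_slice (F := fun x t => gradient (fun y => p y t) x) hp.continuousOn_gradient
    (mem_Ioi.2 ht)).sub
    (continuousOn_slice (F := fun x t => gradient (fun y => Ψ y t) x) hΨ.continuousOn_gradient
    (mem_Ici.2 ht.le))

theorem integrable_globMass_integrand (hU : IsOpen U) (hα : 2 ≤ α) {χ : Pt n → ℝ}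
    (hχ : IsCutoff U χ) : Integrable fun x => max (p x t - Ψ x t - 1) 0 ^ α * χ x :=
  integrable_mul_weight hU (((continuous_id.max continuous_const).rpow_const
    fun _ => Or.inr (by linarith)).comp_continuousOn (continuousOn_difference_slice hp hΨ ht 1))
    hχ.isWeight

theorem integrable_globDissipation_integrand (hU : IsOpen U) (hα : 2 ≤ α) {r : ℝ} (hr : 0 < r)
    {χ : Pt n → ℝ} (hχ : IsCutoff U χ) :
    Integrable fun x => (‖gradient (fun y => p y t) x - gradient (fun y => Ψ y t) x‖ ^ r *
      wt α 1 (p x t - Ψ x t - 1)) * χ x :=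
  integrable_mul_weight hU
    (((continuousOn_gradient_difference_slice hp hΨ ht).norm.rpow_const
      fun _ _ => Or.inr hr.le).mul
    ((continuous_wt hα one_pos).comp_continuousOn (continuousOn_difference_slice hp hΨ ht 1)))
    hχ.isWeight

end slices

theorem globMass_nonneg {χ : Pt n → ℝ} (hχ : IsCutoff U χ) (t : ℝ) : 0 ≤ globMass α χ p Ψ t :=
  integral_nonneg fun x => mul_nonneg (Real.rpow_nonneg (le_max_right _ _) _) (hχ.nonneg x)

theorem integral_cutoff_le (hUb : Bornology.IsBounded U) {χ : Pt n → ℝ}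
    (hχ : IsCutoff U χ) : ∫ x, χ x ≤ (volume U).toReal := by
  have hfin : volume U ≠ ∞ := hUb.measure_lt_top.ne
  rw [← setIntegral_eq_integral_of_forall_compl_eq_zero (s := U) fun x hx =>
    image_eq_zero_of_notMem_tsupport fun h => hx (hχ.subset h)]
  calc ∫ x in U, χ x ≤ ∫ _ in U, (1 : ℝ) :=
        integral_mono (hχ.contDiff.continuous.integrable_of_hasCompactSupport
          hχ.compact).integrableOn (integrableOn_const hfin) hχ.le_one
    _ = (volume U).toReal := by simp [Measure.real]

/-- The Sobolev–Poincaré inequality for `(p - Ψ - 1)₊`. -/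
theorem exists_globMass_rpow_le (g : Poly) (hn : 2 ≤ n) (hUb : Bornology.IsBounded U)
    (hU : IsOpen U) (hα : 2 ≤ α) (hκ : g.a ≤ α * ((2 - g.a) / n)) : ∃ C : ℝ, 0 < C ∧
    ∀ {p Ψ : Pt n → ℝ → ℝ} {p₀ : Pt n → ℝ}, IsSolution g U α p p₀ Ψ → IsBoundaryExtension U Ψ →
      ∀ {χ : Pt n → ℝ} {t : ℝ}, IsCutoff U χ → 0 < t →
      (∀ x ∈ U, 0 ≤ p x t - Ψ x t - 1 → χ x = 1) →
      globMass α χ p Ψ t ^ ((α - g.a) / α) ≤ C * (1 + globDissipation α (2 - g.a) χ p Ψ t) := by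
  have ha0 := g.a_pos
  have ha1 := g.a_lt_one
  set r : ℝ := 2 - g.a with hr
  have hr0 : 0 < r := by linarith
  have hn' : (2 : ℝ) ≤ n := by exact_mod_cast hn
  have hn0 : (0 : ℝ) < n := by linarith
  set γ : ℝ := (α - g.a) / α with hγ
  have hγ0 : 0 < γ := div_pos (by linarith) (by linarith)
  -- Above the level one the r-th power of the profile is comparable to s^{α-a}, so its q-th power
  -- is comparable to s^α. This q is at most the critical Sobolev exponent precisely when a ≤ αr/n.
  set q : ℝ := r / γ with hq
  have hq0 : 0 < q := by positivity
  have hrq : r / q = γ := by rw [hq]; field_simp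
  obtain ⟨S, hS, hsob⟩ := exists_sobolev hUb (r := r) (q := q) (by linarith) (by linarith) hq0 (by
    have h1 : g.a * n ≤ α * r := by
      rw [← mul_div_assoc, le_div_iff₀ hn0] at hκ
      exact hκ
    have h2 : g.a / (α * r) ≤ (n : ℝ)⁻¹ := by
      rw [div_le_iff₀ (by positivity), inv_mul_eq_div, le_div_iff₀ hn0]; exact h1
    have h3 : q⁻¹ = r⁻¹ - g.a / (α * r) := by
      rw [hq, hγ]
      field_simp
    linarith)
  set m : ℝ := (volume U).toReal with hm
  have hm0 : 0 ≤ m := ENNReal.toReal_nonneg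
  set S₁ : ℝ := S * (1 + α / r) ^ r with hS₁
  have hS₁0 : 0 < S₁ := by positivity
  refine ⟨2 ^ γ * (m ^ γ + 4 * S₁), by positivity, ?_⟩
  intro p Ψ p₀ hp hΨ χ t hχ ht hχ1
  have hcs := continuousOn_difference_slice hp hΨ ht 1
  set v : Pt n → ℝ := fun x => Wp α r 1 (p x t - Ψ x t - 1) * χ x with hv
  have hv0 : ∀ x, 0 ≤ v x := fun x => mul_nonneg (Wp_nonneg one_pos _) (hχ.nonneg x)
  have hud : ∀ x ∈ U, DifferentiableAt ℝ (fun y => p y t - Ψ y t - 1) x := fun x hx =>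
    ((hp.differentiableAt_space x hx t ht).sub
      (hΨ.differentiableAt_space x hx t ht.le)).sub_const 1
  have hvC : ContDiff ℝ 1 v := contDiff_comp_mul_cutoff hU hud
    ((continuousOn_gradient_difference_slice hp hΨ ht).congr fun x hx =>
      gradient_difference hp hΨ 1 ht hx)
    (hasDerivAt_Wp hα hr0 one_pos) (continuous_WpDeriv hα hr0 one_pos) hχ.contDiff hχ.subset
  have hvs : HasCompactSupport v := hasCompactSupport_mul_weight hχ.isWeight
  have hvU : tsupport v ⊆ U :=
    (tsupport_mul_subset_right (f := fun x => Wp α r 1 (p x t - Ψ x t - 1))).trans hχ.subset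
  have hsv := hsob v hvC hvs ((subset_tsupport v).trans hvU)
  have hi1 := integrable_globDissipation_integrand hp hΨ ht hU hα hr0 hχ
  have hgrad : ∫ x, ‖gradient v x‖ ^ r ≤ (1 + α / r) ^ r * globDissipation α r χ p Ψ t := by
    rw [globDissipation, ← integral_const_mul]
    refine integral_mono ?_ (hi1.const_mul _) fun x => ?_
    · refine Continuous.integrable_of_hasCompactSupport
        ((continuous_gradient hvC).norm.rpow_const fun _ => Or.inr hr0.le) ?_
      refine hvs.of_isClosed_subset (isClosed_tsupport _)
        ((closure_mono fun x (hx : _ ≠ _) => ?_).trans (tsupport_gradient_subset v))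
      rw [Function.mem_support]
      contrapose! hx
      simp [hx, Real.zero_rpow hr0.ne']
    · dsimp only
      by_cases hx : x ∈ U
      · rw [hv, gradient_comp_mul_cutoff hud (hasDerivAt_Wp hα hr0 one_pos) hχ.contDiff
          hχ.subset x, gradient_difference hp hΨ 1 ht hx]
        have hwn := wt_nonneg (α := α) (δ := 1) (p x t - Ψ x t - 1)
        have hD := abs_WpDeriv_rpow_le (α := α) hα hr0 one_pos (p x t - Ψ x t - 1)
        rcases lt_or_ge (p x t - Ψ x t - 1) 0 with hs | hs
        · rw [Wp_of_nonpos hα hr0 hs.le]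
          rw [wt_of_nonpos hα hs.le, mul_zero] at hD
          have hz : WpDeriv α r 1 (p x t - Ψ x t - 1) = 0 := by
            by_contra h
            have : 0 < |WpDeriv α r 1 (p x t - Ψ x t - 1)| ^ r := by positivity
            linarith
          rw [hz, wt_of_nonpos hα hs.le]
          simp [Real.zero_rpow hr0.ne']
        · rw [hχ1 x hx hs, hχ.gradient_eq_zero (hχ1 x hx hs), smul_zero, add_zero, one_mul, mul_one,
            norm_smul, Real.norm_eq_abs, Real.mul_rpow (abs_nonneg _) (norm_nonneg _)]
          calc _ ≤ (1 + α / r) ^ r * wt α 1 (p x t - Ψ x t - 1) *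
                ‖gradient (fun y => p y t) x - gradient (fun y => Ψ y t) x‖ ^ r := by gcongr
            _ = _ := by ring
      · rw [gradient_eq_zero_of_notMem_tsupport fun h => hx (hvU h),
          image_eq_zero_of_notMem_tsupport fun h => hx (hχ.subset h)]
        simp [Real.zero_rpow hr0.ne']
  have hvi : Integrable fun x => |v x| ^ q :=
    Continuous.integrable_of_hasCompactSupport
      (hvC.continuous.abs.rpow_const fun _ => Or.inr hq0.le)
      (hvs.comp_left (g := fun y => |y| ^ q) (by simp [Real.zero_rpow hq0.ne']))
  have hχi : Integrable χ := hχ.contDiff.continuous.integrable_of_hasCompactSupport hχ.compact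
  have hIv : 0 ≤ ∫ x, |v x| ^ q := integral_nonneg fun x => by positivity
  -- Where the truncation is at most one its α-th power is at most one, which costs the volume of U;
  -- elsewhere the lower bound of the profile applies.
  have hmass : globMass α χ p Ψ t ≤ m + 4 ^ (1 / γ) * ∫ x, |v x| ^ q := by
    refine le_trans ?_ (add_le_add_left (integral_cutoff_le hUb hχ) _)
    rw [globMass, ← integral_const_mul, ← integral_add hχi (hvi.const_mul _)]
    refine integral_mono (integrable_globMass_integrand hp hΨ ht hU hα hχ)
      (hχi.add (hvi.const_mul _)) fun x => ?_
    dsimp only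
    have hχ0 := hχ.nonneg x
    set s := p x t - Ψ x t - 1 with hs
    rcases le_or_gt s 1 with h1 | h1
    · have : max s 0 ^ α ≤ 1 :=
        Real.rpow_le_one (le_max_right _ _) (max_le h1 zero_le_one) (by linarith)
      have h2 : 0 ≤ 4 ^ (1 / γ) * |v x| ^ q := by positivity
      nlinarith
    · by_cases hx : x ∈ U
      · have hx1 := hχ1 x hx (by linarith)
        have hvx : |v x| = Wp α r 1 s := by
          rw [abs_of_nonneg (hv0 x), hv]; simp only [hx1, mul_one]; rfl
        have hge := Wp_rpow_ge (α := α) (r := r) hα hr0 one_pos h1.le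
        rw [hvx, hx1, mul_one, max_eq_left (by linarith)]
        have hW := Wp_nonneg (α := α) (r := r) one_pos s
        have h3 : s ^ (α - 2 + r) ≤ 4 * Wp α r 1 s ^ r := by linarith
        have h4 := Real.rpow_le_rpow (by positivity) h3 (by positivity : 0 ≤ 1 / γ)
        rw [Real.mul_rpow (by norm_num) (by positivity), ← Real.rpow_mul hW,
          ← Real.rpow_mul (by linarith : (0 : ℝ) ≤ s),
          show (α - 2 + r) * (1 / γ) = α by
            rw [hr, hγ]
            field_simp [(by linarith : α - g.a ≠ 0)]
            ring, show r * (1 / γ) = q by rw [hq]; ring] at h4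
        linarith
      · rw [image_eq_zero_of_notMem_tsupport fun h => hx (hχ.subset h), mul_zero, zero_add]
        positivity
  have hD0 : 0 ≤ globDissipation α r χ p Ψ t := integral_nonneg fun x =>
    mul_nonneg (mul_nonneg (by positivity) (wt_nonneg _)) (hχ.nonneg x)
  calc globMass α χ p Ψ t ^ γ ≤ (m + 4 ^ (1 / γ) * ∫ x, |v x| ^ q) ^ γ :=
        Real.rpow_le_rpow (globMass_nonneg hχ t) hmass hγ0.le
    _ ≤ 2 ^ γ * (m ^ γ + (4 ^ (1 / γ) * ∫ x, |v x| ^ q) ^ γ) :=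
        add_rpow_le hγ0.le hm0 (by positivity)
    _ = 2 ^ γ * (m ^ γ + 4 * (∫ x, |v x| ^ q) ^ γ) := by
        rw [Real.mul_rpow (by positivity) hIv, ← Real.rpow_mul (by norm_num),
          one_div_mul_cancel hγ0.ne', Real.rpow_one]
    _ ≤ 2 ^ γ * (m ^ γ + 4 * (S₁ * globDissipation α r χ p Ψ t)) := by
        gcongr
        rw [← hrq]
        refine hsv.trans ?_
        rw [hS₁, mul_assoc]
        exact mul_le_mul_of_nonneg_left hgrad hS.le
    _ ≤ _ := by
        rw [mul_assoc (2 ^ γ : ℝ) (m ^ γ + 4 * S₁)]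
        refine mul_le_mul_of_nonneg_left ?_ (Real.rpow_nonneg zero_le_two γ)
        have h1 : 0 ≤ m ^ γ := by positivity
        nlinarith [mul_nonneg h1 hD0, mul_nonneg hS₁0.le hD0]

end Forchheimer

/-! ### Estimates of the data terms and the differential inequality for the global energy. -/

namespace Forchheimer

variable {n : ℕ} {U : Set (Pt n)} {g : Poly} {α : ℝ} {p Ψ : Pt n → ℝ → ℝ} {p₀ : Pt n → ℝ}

theorem lintegral_enorm_rpow_ne_top_integrable {E : Type*} [NormedAddCommGroup E]
    {X : Type*} [MeasurableSpace X] {μ : Measure X} {F : X → E} (hF : AEStronglyMeasurable F μ)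
    {q : ℝ} (hq : 0 ≤ q) (h : ∫⁻ x, ‖F x‖ₑ ^ q ∂μ ≠ ∞) :
    Integrable (fun x => ‖F x‖ ^ q) μ ∧
      ∫ x, ‖F x‖ ^ q ∂μ = (∫⁻ x, ‖F x‖ₑ ^ q ∂μ).toReal := by
  have hm : AEStronglyMeasurable (fun x => ‖F x‖ ^ q) μ :=
    (hF.norm.aemeasurable.pow_const q).aestronglyMeasurable
  have he : ∀ x, ENNReal.ofReal (‖F x‖ ^ q) = ‖F x‖ₑ ^ q := fun x => by
    rw [← ENNReal.ofReal_rpow_of_nonneg (norm_nonneg _) hq, ofReal_norm]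
  have h0 : ∀ x, 0 ≤ ‖F x‖ ^ q := fun x => by positivity
  refine ⟨⟨hm, ?_⟩, ?_⟩
  · rw [hasFiniteIntegral_iff_ofReal (ae_of_all _ h0)]
    simp only [he]
    exact h.lt_top
  · rw [integral_eq_lintegral_of_nonneg_ae (ae_of_all _ h0) hm]
    simp only [he]

/-- Hölder's inequality against a power of `(p - Ψ - 1)₊`. -/
theorem integral_mul_profile_le (hU : IsOpen U) (hp : IsSolution g U α p p₀ Ψ)
    (hΨ : IsBoundaryExtension U Ψ) (hα : 2 ≤ α) {χ : Pt n → ℝ} (hχ : IsCutoff U χ) {t : ℝ}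
    (ht : 0 < t) {β : ℝ} (hβ : 0 < β) (hβα : β ≤ α) {F : Pt n → ℝ} (hF0 : ∀ x, 0 ≤ F x)
    (hFi : IntegrableOn (fun x => F x ^ (α / β)) U) (hFc : ContinuousOn F U) {h : ℝ → ℝ}
    (hc : Continuous h) (hle : ∀ s, h s ≤ max s 0 ^ (α - β)) :
    ∫ x, (F x * h (p x t - Ψ x t - 1)) * χ x ≤
      (∫ x in U, F x ^ (α / β)) ^ (β / α) * globMass α χ p Ψ t ^ ((α - β) / α) := by
  have hα0 : 0 < α := by linarith
  have hmi := integrable_globMass_integrand hp hΨ ht hU hα hχ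
  have hz : ∀ x, x ∉ U → χ x = 0 := fun x hx =>
    image_eq_zero_of_notMem_tsupport fun h => hx (hχ.subset h)
  obtain ⟨hi, hH⟩ := integral_rpow_mul_rpow_le (μ := volume.restrict U) hFi hmi.integrableOn
    (fun x => Real.rpow_nonneg (hF0 x) _)
    (fun x => mul_nonneg (Real.rpow_nonneg (le_max_right _ _) _) (hχ.nonneg x))
    (θ := β / α) (θ' := (α - β) / α) (by positivity) (div_nonneg (by linarith) hα0.le)
    (by field_simp; ring)
  rw [setIntegral_eq_integral_of_forall_compl_eq_zero (f := fun x =>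
    max (p x t - Ψ x t - 1) 0 ^ α * χ x) fun x hx => by rw [hz x hx, mul_zero]] at hH
  refine le_trans ?_ hH
  rw [← setIntegral_eq_integral_of_forall_compl_eq_zero (s := U) fun x hx => by
    rw [hz x hx, mul_zero]]
  refine integral_mono (integrable_mul_weight hU (hFc.mul (hc.comp_continuousOn
    (continuousOn_difference_slice hp hΨ ht 1))) hχ.isWeight).integrableOn hi fun x => ?_
  dsimp only
  set s := p x t - Ψ x t - 1
  have hs : 0 ≤ max s 0 := le_max_right _ _
  have hχ0 := hχ.nonneg x
  have hFx := hF0 x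
  have e1 : (F x ^ (α / β)) ^ (β / α) = F x := by
    rw [← Real.rpow_mul hFx, div_mul_div_cancel₀ hβ.ne', div_self hα0.ne', Real.rpow_one]
  have e2 : (max s 0 ^ α * χ x) ^ ((α - β) / α) = max s 0 ^ (α - β) * χ x ^ ((α - β) / α) := by
    rw [Real.mul_rpow (by positivity) hχ0, ← Real.rpow_mul hs, mul_div_cancel₀ _ hα0.ne']
  -- A single factor χ suffices for Hölder's inequality, because lowering the exponent increases a
  -- number in [0,1].
  have e3 : χ x ≤ χ x ^ ((α - β) / α) := by
    have h1 : (α - β) / α ≤ 1 := by rw [div_le_one hα0]; linarith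
    have := Real.rpow_le_rpow_of_exponent_ge' hχ0 (hχ.le_one x)
      (div_nonneg (by linarith) hα0.le) h1
    rwa [Real.rpow_one] at this
  rw [e1, e2]
  calc F x * h s * χ x ≤ F x * max s 0 ^ (α - β) * χ x ^ ((α - β) / α) := by
        gcongr
        exact hle s
    _ = _ := by ring

/-- The pointwise bound of the energy integrand. -/
theorem exists_energyIntegrand_le (g : Poly) (n : ℕ) (hα : 2 ≤ α) : ∃ c C : ℝ, 0 < c ∧ 0 < C ∧
    ∀ {U : Set (Pt n)} {p Ψ : Pt n → ℝ → ℝ} {χ : Pt n → ℝ} {t : ℝ}, IsCutoff U χ →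
      (∀ x ∈ U, 0 ≤ p x t - Ψ x t - 1 → χ x = 1) → ∀ x,
      energyIntegrand g p Ψ 1 (eta α 1) (etaDeriv α 1) χ t x ≤
        -(c * ((‖gradient (fun y => p y t) x - gradient (fun y => Ψ y t) x‖ ^ (2 - g.a) *
          wt α 1 (p x t - Ψ x t - 1)) * χ x)) +
        (C * ((1 * wt α 1 (p x t - Ψ x t - 1)) * χ x) +
          C * ((‖gradient (fun y => Ψ y t) x‖ ^ (2 - g.a) * wt α 1 (p x t - Ψ x t - 1)) * χ x)) +
        (‖timeDeriv Ψ x t‖ * eta α 1 (p x t - Ψ x t - 1)) * χ x := by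
  obtain ⟨c, C, hc, hC, hK⟩ := g.exists_le_K_mul_inner (Pt n)
  refine ⟨c, C * (α + 1), hc, by positivity, ?_⟩
  intro U p Ψ χ t hχ hχ1 x
  rw [energyIntegrand]
  set s := p x t - Ψ x t - 1
  by_cases hx : x ∈ U
  · rcases lt_or_ge s 0 with hs | hs
    · rw [wt_of_nonpos hα hs.le, etaDeriv_of_nonpos hα hs.le, eta_of_nonpos hs.le]
      simp
    · have h1 := hχ1 x hx hs
      rw [hχ.gradient_eq_zero h1, h1, smul_zero, add_zero, one_mul, inner_smul_right]
      set P := gradient (fun y => p y t) x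
      set Q := gradient (fun y => Ψ y t) x
      have hw := wt_nonneg (α := α) (δ := 1) s
      have hη := eta_nonneg (α := α) (δ := 1) s
      have e1 := wt_le_etaDeriv hα one_pos s
      have e2 := etaDeriv_le (α := α) one_pos s
      have e3 := mul_le_mul_of_nonneg_left (hK P Q) (hw.trans e1)
      have hA : 0 ≤ c * ‖P - Q‖ ^ (2 - g.a) := by positivity
      have hB : 0 ≤ C * (1 + ‖Q‖ ^ (2 - g.a)) := by positivity
      have e4 := mul_le_mul_of_nonneg_right e1 hA
      have e5 := mul_le_mul_of_nonneg_right e2 hB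
      have e6 : -(eta α 1 s * timeDeriv Ψ x t) ≤ ‖timeDeriv Ψ x t‖ * eta α 1 s := by
        rw [Real.norm_eq_abs]
        nlinarith [neg_abs_le (timeDeriv Ψ x t)]
      linarith
  · rw [image_eq_zero_of_notMem_tsupport fun h => hx (hχ.subset h),
      gradient_eq_zero_of_notMem_tsupport fun h => hx (hχ.subset h)]
    simp

/-- The energy of `(p - Ψ - 1)₊` in the whole domain. -/
noncomputable def globEnergy (U : Set (Pt n)) (α : ℝ) (p Ψ : Pt n → ℝ → ℝ) (t : ℝ) : ℝ :=
  ∫ x in U, Phi α 1 (p x t - Ψ x t - 1)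

theorem globEnergy_nonneg (t : ℝ) : 0 ≤ globEnergy U α p Ψ t :=
  integral_nonneg fun _ => Phi_nonneg _

/-- The integrand vanishes where p - Ψ ≤ 1 and the cutoff is one elsewhere. As one cutoff serves a
whole neighbourhood of a given time, the energy over U inherits the derivative of the localized
energy. -/
theorem globEnergy_eq {χ : Pt n → ℝ} (hχ : IsCutoff U χ) {t : ℝ} (hUm : MeasurableSet U)
    (hχ1 : ∀ x ∈ U, 0 ≤ p x t - Ψ x t - 1 → χ x = 1) :
    globEnergy U α p Ψ t = ∫ x, Phi α 1 (p x t - Ψ x t - 1) * χ x := by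
  rw [← setIntegral_eq_integral_of_forall_compl_eq_zero (s := U) fun x hx => by
    rw [image_eq_zero_of_notMem_tsupport fun h => hx (hχ.subset h), mul_zero]]
  refine setIntegral_congr_fun hUm fun x hx => ?_
  rcases lt_or_ge (p x t - Ψ x t - 1) 0 with hs | hs
  · rw [Phi_of_nonpos hs.le, zero_mul]
  · rw [hχ1 x hx hs, mul_one]

theorem A_toReal {a : ℝ} (ha1 : a < 1) (hα : 2 ≤ α) {t : ℝ} (h : A U a α Ψ t ≠ ∞) :
    (∫⁻ x in U, ‖gradient (fun y => Ψ y t) x‖ₑ ^ (α * (2 - a) / 2)) ≠ ∞ ∧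
    (∫⁻ x in U, ‖timeDeriv Ψ x t‖ₑ ^ α) ≠ ∞ ∧
    (A U a α Ψ t).toReal =
      (∫⁻ x in U, ‖gradient (fun y => Ψ y t) x‖ₑ ^ (α * (2 - a) / 2)).toReal
        ^ (2 * (α - a) / (α * (2 - a))) +
      (∫⁻ x in U, ‖timeDeriv Ψ x t‖ₑ ^ α).toReal ^ ((α - a) / (α * (1 - a))) := by
  have e1 : 0 < 2 * (α - a) / (α * (2 - a)) :=
    div_pos (by linarith) (mul_pos (by linarith) (by linarith))
  have e2 : 0 < (α - a) / (α * (1 - a)) :=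
    div_pos (by linarith) (mul_pos (by linarith) (by linarith))
  rw [A, ENNReal.add_ne_top] at h
  refine ⟨fun h' => h.1 (by rw [h', ENNReal.top_rpow_of_pos e1]),
    fun h' => h.2 (by rw [h', ENNReal.top_rpow_of_pos e2]), ?_⟩
  rw [A, ENNReal.toReal_add h.1 h.2, ENNReal.toReal_rpow, ENNReal.toReal_rpow]

/-- The differential inequality for the global energy. -/
theorem exists_hasDerivAt_globEnergy_le (g : Poly) (hn : 2 ≤ n) (hUb : Bornology.IsBounded U)
    (hU : IsOpen U) (hα : 2 ≤ α) (hκ : g.a ≤ α * ((2 - g.a) / n)) : ∃ c C : ℝ, 0 < c ∧ 0 < C ∧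
    ∀ {p Ψ : Pt n → ℝ → ℝ} {p₀ : Pt n → ℝ}, IsSolution g U α p p₀ Ψ → IsBoundaryExtension U Ψ →
      ∀ {t : ℝ}, 0 < t → ∃ e, HasDerivAt (globEnergy U α p Ψ) e t ∧
        (A U g.a α Ψ t ≠ ∞ → e ≤ -(c * globEnergy U α p Ψ t ^ ((α - g.a) / α)) +
          C * (1 + (A U g.a α Ψ t).toReal)) := by
  have ha0 := g.a_pos
  have ha1 := g.a_lt_one
  have hα0 : 0 < α := by linarith
  obtain ⟨S, hS, hsob⟩ := exists_globMass_rpow_le g hn hUb hU hα hκ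
  obtain ⟨c, C, hc, hC, hpt⟩ := exists_energyIntegrand_le g n hα
  set γ : ℝ := (α - g.a) / α with hγ
  have hγ0 : 0 < γ := div_pos (by linarith) hα0
  set m : ℝ := (volume U).toReal with hm
  have hm0 : 0 ≤ m := ENNReal.toReal_nonneg
  have hfin : volume U ≠ ∞ := hUb.measure_lt_top.ne
  -- In terms of z = y^γ, Hölder's inequality leaves the powers z^{σ₂} and z^{σ₁}. The dual Young
  -- exponents (α-a)/(2-a) and (α-a)/(1-a) are what yields the two exponents in the definition of A.
  set σ₂ : ℝ := (α - 2) / (α - g.a) with hσ₂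
  set σ₁ : ℝ := (α - 1) / (α - g.a) with hσ₁
  have hαa : 0 < α - g.a := by linarith
  have hσ₂0 : 0 ≤ σ₂ := div_nonneg (by linarith) hαa.le
  have hσ₁0 : 0 ≤ σ₁ := div_nonneg (by linarith) hαa.le
  have hσ₂1 : σ₂ < 1 := by rw [hσ₂, div_lt_one hαa]; linarith
  have hσ₁1 : σ₁ < 1 := by rw [hσ₁, div_lt_one hαa]; linarith
  have hi2 : 1 / (1 - σ₂) = (α - g.a) / (2 - g.a) := by
    have : 1 - σ₂ = (2 - g.a) / (α - g.a) := by rw [hσ₂]; field_simp; ring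
    rw [this, one_div_div]
  have hi1 : 1 / (1 - σ₁) = (α - g.a) / (1 - g.a) := by
    have : 1 - σ₁ = (1 - g.a) / (α - g.a) := by rw [hσ₁]; field_simp; ring
    rw [this, one_div_div]
  -- The three applications of Young's inequality cost (2C + 1)εz in total, which is half of the
  -- term cz/S supplied by the dissipation.
  set ε : ℝ := c / (2 * S * (2 * C + 1)) with hε
  have hε0 : 0 < ε := by positivity
  set k₂ : ℝ := (1 / ε) ^ (σ₂ / (1 - σ₂)) with hk₂
  set k₁ : ℝ := (1 / ε) ^ (σ₁ / (1 - σ₁)) with hk₁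
  have hk₂0 : 0 < k₂ := by positivity
  have hk₁0 : 0 < k₁ := by positivity
  set M : ℝ := (m ^ (2 / α)) ^ (1 / (1 - σ₂)) with hM
  have hM0 : 0 ≤ M := by positivity
  refine ⟨c / (2 * S), c + C * k₂ * M + C * k₂ + k₁, by positivity, by positivity, ?_⟩
  intro p Ψ p₀ hp hΨ t ht
  -- A time window around t is needed so that the same cutoff can be kept while differentiating.
  obtain ⟨χ, hχ, hχ1⟩ := exists_isCutoff_superlevel hU hUb hp hΨ (t₁ := t / 2) (t₂ := 2 * t)
    (by linarith)
  have hχt := hχ1 t ⟨by linarith, by linarith⟩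
  obtain ⟨hint, hder⟩ := hasDerivAt_energy hU hp hΨ hχ 1
    (hasDerivAt_Phi hα one_pos) (hasDerivAt_eta hα one_pos) (continuous_etaDeriv hα one_pos) ht
  refine ⟨_, hder.congr_of_eventuallyEq ?_, fun hA => ?_⟩
  · filter_upwards [Icc_mem_nhds (by linarith : t / 2 < t) (by linarith : t < 2 * t)] with s hs
    exact globEnergy_eq hχ hU.measurableSet (hχ1 s hs)
  obtain ⟨hA1, hA2, hAeq⟩ := A_toReal ha1 hα hA
  have hgΨ : ContinuousOn (fun x => gradient (fun y => Ψ y t) x) U :=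
    continuousOn_slice (F := fun x t => gradient (fun y => Ψ y t) x)
      hΨ.continuousOn_gradient (mem_Ici.2 ht.le)
  have htΨ : ContinuousOn (fun x => timeDeriv Ψ x t) U :=
    continuousOn_slice hΨ.continuousOn_timeDeriv (mem_Ici.2 ht.le)
  obtain ⟨hB1i, hB1⟩ := lintegral_enorm_rpow_ne_top_integrable
    (hgΨ.aestronglyMeasurable hU.measurableSet) (by nlinarith : 0 ≤ α * (2 - g.a) / 2) hA1
  obtain ⟨hB2i, hB2⟩ := lintegral_enorm_rpow_ne_top_integrable
    (htΨ.aestronglyMeasurable hU.measurableSet) hα0.le hA2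
  set b₁ := (∫⁻ x in U, ‖gradient (fun y => Ψ y t) x‖ₑ ^ (α * (2 - g.a) / 2)).toReal with hb₁
  set b₂ := (∫⁻ x in U, ‖timeDeriv Ψ x t‖ₑ ^ α).toReal with hb₂
  have hb₁0 : 0 ≤ b₁ := ENNReal.toReal_nonneg
  have hb₂0 : 0 ≤ b₂ := ENNReal.toReal_nonneg
  set y := globMass α χ p Ψ t with hy
  have hy0 : 0 ≤ y := globMass_nonneg hχ t
  set z := y ^ γ with hz
  have hz0 : 0 ≤ z := by positivity
  have hzσ₂ : y ^ ((α - 2) / α) = z ^ σ₂ := by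
    rw [hz, ← Real.rpow_mul hy0]; congr 1; rw [hγ, hσ₂]; field_simp
  have hzσ₁ : y ^ ((α - 1) / α) = z ^ σ₁ := by
    rw [hz, ← Real.rpow_mul hy0]; congr 1; rw [hγ, hσ₁]; field_simp
  have hcw := continuous_wt (α := α) hα one_pos
  have hcη := continuous_eta (α := α) hα one_pos
  have hcs := continuousOn_difference_slice hp hΨ ht 1
  have hgr : ContinuousOn (fun x => ‖gradient (fun y => Ψ y t) x‖ ^ (2 - g.a)) U :=
    hgΨ.norm.rpow_const fun _ _ => Or.inr (by linarith)
  have hexp : ∀ x, (‖gradient (fun y => Ψ y t) x‖ ^ (2 - g.a)) ^ (α / 2) =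
      ‖gradient (fun y => Ψ y t) x‖ ^ (α * (2 - g.a) / 2) := fun x => by
    rw [← Real.rpow_mul (norm_nonneg _)]; congr 1; ring
  have T1a : ∫ x, (1 * wt α 1 (p x t - Ψ x t - 1)) * χ x ≤ m ^ (2 / α) * z ^ σ₂ := by
    have := integral_mul_profile_le hU hp hΨ hα hχ ht (β := 2) two_pos hα (F := fun _ => 1)
      (fun _ => zero_le_one) (by simpa using hfin.lt_top) continuousOn_const hcw (wt_le_rpow hα one_pos)
    rw [← hy, hzσ₂] at this
    simpa [Measure.real] using this
  have T1b : ∫ x, (‖gradient (fun y => Ψ y t) x‖ ^ (2 - g.a) * wt α 1 (p x t - Ψ x t - 1)) * χ x ≤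
      b₁ ^ (2 / α) * z ^ σ₂ := by
    have := integral_mul_profile_le hU hp hΨ hα hχ ht (β := 2) two_pos hα
      (F := fun x => ‖gradient (fun y => Ψ y t) x‖ ^ (2 - g.a)) (fun _ => by positivity)
      (by simp only [hexp]; exact hB1i) hgr hcw (wt_le_rpow hα one_pos)
    rw [← hy, hzσ₂] at this
    simpa only [hexp, hB1] using this
  have T2 : ∫ x, (‖timeDeriv Ψ x t‖ * eta α 1 (p x t - Ψ x t - 1)) * χ x ≤
      b₂ ^ (1 / α) * z ^ σ₁ := by
    have := integral_mul_profile_le hU hp hΨ hα hχ ht (β := 1) one_pos (by linarith)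
      (F := fun x => ‖timeDeriv Ψ x t‖) (fun _ => norm_nonneg _)
      (by simp only [div_one]; exact hB2i) htΨ.norm hcη (eta_le_rpow hα one_pos)
    rw [← hy, hzσ₁] at this
    simpa only [div_one, hB2] using this
  have Y1a := rpow_mul_le_add hσ₂0 hσ₂1 hε0 hz0 (X := m ^ (2 / α)) (by positivity)
  have Y1b := rpow_mul_le_add hσ₂0 hσ₂1 hε0 hz0 (X := b₁ ^ (2 / α)) (by positivity)
  have Y2 := rpow_mul_le_add hσ₁0 hσ₁1 hε0 hz0 (X := b₂ ^ (1 / α)) (by positivity)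
  have hX1 : (b₁ ^ (2 / α)) ^ (1 / (1 - σ₂)) = b₁ ^ (2 * (α - g.a) / (α * (2 - g.a))) := by
    rw [hi2, ← Real.rpow_mul hb₁0, div_mul_div_comm]
  have hX2 : (b₂ ^ (1 / α)) ^ (1 / (1 - σ₁)) = b₂ ^ ((α - g.a) / (α * (1 - g.a))) := by
    rw [hi1, ← Real.rpow_mul hb₂0, div_mul_div_comm, one_mul]
  rw [hX1] at Y1b
  rw [hX2] at Y2
  rw [hAeq]
  set R₁ := b₁ ^ (2 * (α - g.a) / (α * (2 - g.a)))
  set R₂ := b₂ ^ ((α - g.a) / (α * (1 - g.a)))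
  have hR₁ : 0 ≤ R₁ := by positivity
  have hR₂ : 0 ≤ R₂ := by positivity
  have hDz := hsob hp hΨ hχ ht hχt
  set D := globDissipation α (2 - g.a) χ p Ψ t with hD
  have hDz' : z / S - 1 ≤ D := by
    rw [sub_le_iff_le_add, div_le_iff₀ hS]; linarith
  have hEy : globEnergy U α p Ψ t ≤ y := by
    rw [globEnergy_eq hχ hU.measurableSet hχt]
    refine integral_mono (integrable_mul_weight hU ((continuous_Phi hα one_pos).comp_continuousOn
      hcs) hχ.isWeight) (integrable_globMass_integrand hp hΨ ht hU hα hχ) fun x => ?_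
    exact mul_le_mul_of_nonneg_right (Phi_le hα one_pos _) (hχ.nonneg x)
  have hEz : globEnergy U α p Ψ t ^ γ ≤ z :=
    Real.rpow_le_rpow (globEnergy_nonneg t) hEy hγ0.le
  have hbound : ∫ x, energyIntegrand g p Ψ 1 (eta α 1) (etaDeriv α 1) χ t x ≤
      -(c * D) + (C * (m ^ (2 / α) * z ^ σ₂) + C * (b₁ ^ (2 / α) * z ^ σ₂)) +
        b₂ ^ (1 / α) * z ^ σ₁ := by
    have j0 := integrable_globDissipation_integrand hp hΨ ht hU hα
      (by linarith : 0 < 2 - g.a) hχ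
    have j1 := integrable_mul_weight hU (f := fun x => 1 * wt α 1 (p x t - Ψ x t - 1))
      (continuousOn_const.mul (hcw.comp_continuousOn hcs)) hχ.isWeight
    have j2 := integrable_mul_weight hU
      (f := fun x => ‖gradient (fun y => Ψ y t) x‖ ^ (2 - g.a) * wt α 1 (p x t - Ψ x t - 1))
      (hgr.mul (hcw.comp_continuousOn hcs)) hχ.isWeight
    have j3 := integrable_mul_weight hU
      (f := fun x => ‖timeDeriv Ψ x t‖ * eta α 1 (p x t - Ψ x t - 1))
      (htΨ.norm.mul (hcη.comp_continuousOn hcs)) hχ.isWeight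
    have j12 : Integrable fun x => C * ((1 * wt α 1 (p x t - Ψ x t - 1)) * χ x) +
        C * ((‖gradient (fun y => Ψ y t) x‖ ^ (2 - g.a) * wt α 1 (p x t - Ψ x t - 1)) * χ x) :=
      (j1.const_mul C).add (j2.const_mul C)
    have j012 : Integrable fun x =>
        -(c * ((‖gradient (fun y => p y t) x - gradient (fun y => Ψ y t) x‖ ^ (2 - g.a) *
          wt α 1 (p x t - Ψ x t - 1)) * χ x)) + (C * ((1 * wt α 1 (p x t - Ψ x t - 1)) * χ x) +
        C * ((‖gradient (fun y => Ψ y t) x‖ ^ (2 - g.a) * wt α 1 (p x t - Ψ x t - 1)) * χ x)) :=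
      (j0.const_mul c).fun_neg.add j12
    refine (integral_mono hint (j012.add j3) fun x => hpt hχ hχt x).trans ?_
    simp only [Pi.add_apply]
    rw [integral_add j012 j3, integral_add (j0.const_mul c).fun_neg j12,
      integral_add (j1.const_mul C) (j2.const_mul C), integral_neg, integral_const_mul,
      integral_const_mul, integral_const_mul]
    rw [hD, globDissipation]
    gcongr
  refine hbound.trans ?_
  have f1 := mul_le_mul_of_nonneg_left Y1a hC.le
  have f2 := mul_le_mul_of_nonneg_left Y1b hC.le
  have f3 := mul_le_mul_of_nonneg_left hDz' hc.le
  have f4 := mul_le_mul_of_nonneg_left hEz (by positivity : 0 ≤ c / (2 * S))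
  have f5 : (2 * C + 1) * (ε * z) = c / (2 * S) * z := by
    rw [hε]; field_simp
  have f6 : c * (z / S - 1) = 2 * (c / (2 * S) * z) - c := by field_simp
  have q1 : 0 ≤ (c + C * k₂ * M + k₁) * R₁ := by positivity
  have q2 : 0 ≤ (c + C * k₂ * M + C * k₂) * R₂ := by positivity
  have q3 : 0 ≤ C * k₂ + k₁ := by positivity
  have f1' : C * (m ^ (2 / α) * z ^ σ₂) ≤ C * (ε * z) + C * k₂ * M := by
    rw [mul_comm (m ^ (2 / α))]; linarith
  have f2' : C * (b₁ ^ (2 / α) * z ^ σ₂) ≤ C * (ε * z) + C * k₂ * R₁ := by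
    rw [mul_comm (b₁ ^ (2 / α))]; linarith
  have f3' : b₂ ^ (1 / α) * z ^ σ₁ ≤ ε * z + k₁ * R₂ := by
    rw [mul_comm (b₂ ^ (1 / α))]; linarith
  linarith

end Forchheimer

/-! ### Comparison principles for differential inequalities in time. -/

namespace Forchheimer

/-- No upward crossing of zero is possible, since the slope is strictly negative at each contact. -/
theorem nonpos_of_deriv_neg {w w' : ℝ → ℝ} {t₀ T : ℝ}
    (hw : ∀ t ∈ Icc t₀ T, HasDerivAt w (w' t) t) (h : ∀ t ∈ Icc t₀ T, w t = 0 → w' t < 0)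
    (h0 : w t₀ ≤ 0) {t : ℝ} (ht : t ∈ Icc t₀ T) : w t ≤ 0 :=
  image_le_of_deriv_right_lt_deriv_boundary' (f := w) (f' := w') (B := fun _ => 0)
    (B' := fun _ => 0) (fun s hs => (hw s hs).continuousAt.continuousWithinAt)
    (fun s hs => (hw s (Ico_subset_Icc_self hs)).hasDerivWithinAt) h0 continuousOn_const
    (fun _ _ => hasDerivWithinAt_const _ _ _) (fun s hs h' => h s (Ico_subset_Icc_self hs) h') ht

/-- As long as w is positive it falls at rate at least d, so it reaches zero by the time t₀ +
w(t₀)/d. From then on the previous lemma traps it. -/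
theorem exists_forall_nonpos_of_deriv_le {w w' : ℝ → ℝ} {t₀ d : ℝ} (hd : 0 < d)
    (hw : ∀ t, t₀ ≤ t → HasDerivAt w (w' t) t) (h : ∀ t, t₀ ≤ t → 0 ≤ w t → w' t ≤ -d) :
    ∃ T, t₀ ≤ T ∧ ∀ t, T ≤ t → w t ≤ 0 := by
  obtain ⟨T, hT, hwT⟩ : ∃ T, t₀ ≤ T ∧ w T ≤ 0 := by
    by_contra! hcon
    have h0 := hcon t₀ le_rfl
    set T := t₀ + w t₀ / d
    have hT : t₀ ≤ T := le_add_of_nonneg_right (by positivity)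
    have hle := (convex_Icc t₀ T).image_sub_le_mul_sub_of_deriv_le (f := w) (C := -d)
      (fun s hs => (hw s hs.1).continuousAt.continuousWithinAt)
      (fun s hs => by
        rw [interior_Icc] at hs
        exact (hw s hs.1.le).differentiableAt.differentiableWithinAt)
      (fun s hs => by
        rw [interior_Icc] at hs
        rw [(hw s hs.1.le).deriv]
        exact h s hs.1.le (hcon s hs.1.le).le)
      t₀ (left_mem_Icc.2 hT) T (right_mem_Icc.2 hT) hT
    have he : -d * (T - t₀) = -w t₀ := by
      simp only [T]; field_simp; ring
    linarith [hcon T hT]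
  refine ⟨T, hT, fun t ht => ?_⟩
  exact nonpos_of_deriv_neg (T := t) (fun s hs => hw s (hT.trans hs.1))
    (fun s hs hs0 => (h s (hT.trans hs.1) hs0.ge).trans_lt (by linarith)) hwT
    (right_mem_Icc.2 ht)

section OrdinaryDifferentialInequality

variable {y y' : ℝ → ℝ} {c C γ F : ℝ}

/-- The barrier is the solution of c s^γ = C(1 + F) + c; above it the solution decreases at a fixed
rate, which gives both the trapping and the finite arrival time. -/
theorem deriv_le_of_barrier_le {s e : ℝ} (hc : 0 < c) (hC : 0 < C) (hγ : 0 < γ) (hF : 0 ≤ F)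
    (he : e ≤ -(c * s ^ γ) + C * (1 + F)) (hs : (C * (1 + F) / c + 1) ^ (1 / γ) ≤ s) :
    e ≤ -c := by
  have hb : 0 ≤ C * (1 + F) / c + 1 := by positivity
  have h1 := Real.rpow_le_rpow (by positivity) hs hγ.le
  rw [← Real.rpow_mul hb, one_div_mul_cancel hγ.ne', Real.rpow_one] at h1
  have h2 := mul_le_mul_of_nonneg_left h1 hc.le
  have h3 : c * (C * (1 + F) / c + 1) = C * (1 + F) + c := by field_simp
  linarith

theorem le_max_of_deriv_le {t₀ T : ℝ} (hc : 0 < c) (hC : 0 < C) (hγ : 0 < γ) (hF : 0 ≤ F)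
    (hy : ∀ t ∈ Icc t₀ T, HasDerivAt y (y' t) t)
    (hle : ∀ t ∈ Icc t₀ T, y' t ≤ -(c * y t ^ γ) + C * (1 + F)) {t : ℝ} (ht : t ∈ Icc t₀ T) :
    y t ≤ max (y t₀) ((C * (1 + F) / c + 1) ^ (1 / γ)) := by
  set M := max (y t₀) ((C * (1 + F) / c + 1) ^ (1 / γ))
  have := nonpos_of_deriv_neg (w := fun t => y t - M) (w' := y') (T := T)
    (fun s hs => (hy s hs).sub_const M) (fun s hs hs0 => by
      have : y s = M := by linarith
      exact (deriv_le_of_barrier_le hc hC hγ hF (hle s hs) (this ▸ le_max_right _ _)).trans_lt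
        (by linarith)) (sub_nonpos.2 (le_max_left _ _)) ht
  linarith

theorem exists_forall_le_of_deriv_le {t₀ : ℝ} (hc : 0 < c) (hC : 0 < C) (hγ : 0 < γ) (hF : 0 ≤ F)
    (hy : ∀ t, t₀ ≤ t → HasDerivAt y (y' t) t)
    (hle : ∀ t, t₀ ≤ t → y' t ≤ -(c * y t ^ γ) + C * (1 + F)) :
    ∃ T, t₀ ≤ T ∧ ∀ t, T ≤ t → y t ≤ (C * (1 + F) / c + 1) ^ (1 / γ) := by
  obtain ⟨T, hT, h⟩ := exists_forall_nonpos_of_deriv_le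
    (w := fun t => y t - (C * (1 + F) / c + 1) ^ (1 / γ)) (w' := y') hc
    (fun s hs => (hy s hs).sub_const _) (fun s hs hs0 =>
      deriv_le_of_barrier_le hc hC hγ hF (hle s hs) (by linarith))
  exact ⟨T, hT, fun t ht => by linarith [h t ht]⟩

/-- Solutions of `y' ≤ -c y^γ + C (1 + f)` are eventually below a power of `f`, if `f'` is bounded
from below. -/
theorem exists_forall_le_rpow_of_deriv_le {f f' : ℝ → ℝ} {t₀ b M : ℝ} (hc : 0 < c) (hC : 0 < C)
    (hγ : 1 / 2 < γ) (hγ1 : γ ≤ 1) (hb : 0 ≤ b) (hM : M = (C + 2) / c)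
    (hy : ∀ t, t₀ ≤ t → HasDerivAt y (y' t) t) (hf0 : ∀ t, t₀ ≤ t → 0 ≤ f t)
    (hf : ∀ t, t₀ ≤ t → HasDerivAt f (f' t) t) (hf' : ∀ t, t₀ ≤ t → -b ≤ f' t)
    (hle : ∀ t, t₀ ≤ t → y' t ≤ -(c * y t ^ γ) + C * (1 + f t)) :
    ∃ T, t₀ ≤ T ∧ ∀ t, T ≤ t →
      y t ≤ (M * (1 + (1 / γ * M ^ (1 / γ) * b) ^ (1 / (2 - 1 / γ)) + f t)) ^ (1 / γ) := by
  have hγ0 : 0 < γ := by linarith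
  set θ := 1 / γ with hθ
  have hθ1 : 1 ≤ θ := by rw [hθ, one_le_div hγ0]; exact hγ1
  have hθ2 : 0 < 2 - θ := by
    rw [sub_pos, hθ, div_lt_iff₀ hγ0]; linarith
  have hM0 : 0 < M := by rw [hM]; positivity
  set B := θ * M ^ θ * b with hB
  have hB0 : 0 ≤ B := by positivity
  -- Makes B ≤ L^{2-θ}, which limits the speed at which the barrier can fall. This requires θ < 2,
  -- that is γ > 1/2.
  set L := 1 + B ^ (1 / (2 - θ)) with hL
  have hL1 : 1 ≤ L := le_add_of_nonneg_right (by positivity)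
  have hBL : B ≤ L ^ (2 - θ) := by
    calc B = (B ^ (1 / (2 - θ))) ^ (2 - θ) := by
          rw [← Real.rpow_mul hB0, one_div_mul_cancel hθ2.ne', Real.rpow_one]
      _ ≤ _ := Real.rpow_le_rpow (by positivity) (by linarith) hθ2.le
  have key : ∀ s, t₀ ≤ s → 0 ≤ y s - (M * (L + f s)) ^ θ →
      y' s - M * f' s * θ * (M * (L + f s)) ^ (θ - 1) ≤ -1 := by
    intro s hs hs0
    have hG1 : L ≤ L + f s := le_add_of_nonneg_right (hf0 s hs)
    set G := L + f s with hG
    have hG0 : 0 < G := by linarith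
    have hMG : 0 ≤ M * G := by positivity
    have h1 : M * G ≤ y s ^ γ := by
      have := Real.rpow_le_rpow (by positivity) (sub_nonneg.1 hs0) hγ0.le
      rwa [← Real.rpow_mul hMG, hθ, one_div_mul_cancel hγ0.ne', Real.rpow_one] at this
    -- M = (C + 2)/c turns the damping into (C + 2)G, of which the source consumes CG.
    have h2 : y' s ≤ -(2 * G) := by
      have e1 := mul_le_mul_of_nonneg_left h1 hc.le
      have e2 : c * (M * G) = (C + 2) * G := by rw [hM]; field_simp
      have e3 : C * (1 + f s) ≤ C * G := by
        refine mul_le_mul_of_nonneg_left ?_ hC.le; linarith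
      linarith [hle s hs]
    -- The barrier falls at rate at most B G^{θ-1} ≤ G^{2-θ} G^{θ-1} = G, so the difference
    -- decreases at rate at least G ≥ 1.
    have h3 : -G ≤ M * f' s * θ * (M * G) ^ (θ - 1) := by
      have e0 : G ^ (2 - θ) * G ^ (θ - 1) = G := by
        rw [← Real.rpow_add hG0]; convert Real.rpow_one G using 2; ring
      have e1 : M * (M * G) ^ (θ - 1) = M ^ θ * G ^ (θ - 1) := by
        rw [Real.mul_rpow hM0.le hG0.le, ← mul_assoc]
        congr 1
        nth_rw 1 [← Real.rpow_one M]
        rw [← Real.rpow_add hM0]; congr 1; ring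
      have e2 : M * f' s * θ * (M * G) ^ (θ - 1) = (θ * M ^ θ * G ^ (θ - 1)) * f' s := by
        linear_combination (f' s * θ) * e1
      rw [e2]
      have e3 := mul_le_mul_of_nonneg_left (hf' s hs)
        (by positivity : 0 ≤ θ * M ^ θ * G ^ (θ - 1))
      have e4 : B ≤ G ^ (2 - θ) := hBL.trans (Real.rpow_le_rpow (by linarith) hG1 hθ2.le)
      have e5 := mul_le_mul_of_nonneg_right e4 (by positivity : 0 ≤ G ^ (θ - 1))
      rw [e0] at e5
      have e6 : θ * M ^ θ * G ^ (θ - 1) * -b = -(B * G ^ (θ - 1)) := by rw [hB]; ring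
      linarith
    linarith
  obtain ⟨T, hT, h⟩ := exists_forall_nonpos_of_deriv_le (d := 1)
    (w := fun t => y t - (M * (L + f t)) ^ θ)
    (w' := fun t => y' t - M * f' t * θ * (M * (L + f t)) ^ (θ - 1)) one_pos
    (fun s hs => (hy s hs).sub ((((hf s hs).const_add L).const_mul M).rpow_const (Or.inr hθ1))) key
  exact ⟨T, hT, fun t ht => by linarith [h t ht]⟩

end OrdinaryDifferentialInequality

end Forchheimer

namespace Forchheimer

variable {n : ℕ} {U : Set (Pt n)} {g : Poly} {α : ℝ} {p Ψ : Pt n → ℝ → ℝ} {p₀ : Pt n → ℝ}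

/-! ### Symmetry under change of sign -/

theorem gradient_fun_neg (f : Pt n → ℝ) (x : Pt n) :
    gradient (fun y => -f y) x = -gradient f x := by
  simp only [gradient]
  rw [fderiv_fun_neg, map_neg]

theorem timeDeriv_neg (x : Pt n) (t : ℝ) :
    timeDeriv (fun x t => -Ψ x t) x t = -timeDeriv Ψ x t := by
  simp only [timeDeriv]
  exact derivWithin.fun_neg

theorem IsBoundaryExtension.neg (h : IsBoundaryExtension U Ψ) :
    IsBoundaryExtension U (fun x t => -Ψ x t) where
  continuousOn := h.continuousOn.neg
  differentiableAt_space x hx t ht := (h.differentiableAt_space x hx t ht).neg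
  differentiableWithinAt_time x hx t ht := (h.differentiableWithinAt_time x hx t ht).neg
  continuousOn_gradient := by
    simp only [gradient_fun_neg]; exact h.continuousOn_gradient.neg
  continuousOn_timeDeriv := by
    simp only [timeDeriv_neg]; exact h.continuousOn_timeDeriv.neg

/-- K depends only on the length of the gradient, so the flux is odd. Lower bounds for p thus follow
from upper bounds for -p with the same constants. -/
theorem IsSolution.neg (h : IsSolution g U α p p₀ Ψ) :
    IsSolution g U α (fun x t => -p x t) (fun x => -p₀ x) (fun x t => -Ψ x t) where
  continuousOn := h.continuousOn.neg
  differentiableAt_space x hx t ht := (h.differentiableAt_space x hx t ht).neg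
  differentiableAt_time x hx t ht := (h.differentiableAt_time x hx t ht).neg
  continuousOn_gradient := by
    simp only [gradient_fun_neg]; exact h.continuousOn_gradient.neg
  continuousOn_timeDeriv := by
    simp only [deriv.fun_neg]; exact h.continuousOn_timeDeriv.neg
  equation t ht φ h1 h2 h3 := by
    have := h.equation t ht φ h1 h2 h3
    simp only [gradient_fun_neg, deriv.fun_neg, norm_neg, inner_neg_left, neg_mul, mul_neg,
      integral_neg, this]
  boundary x hx t ht := by rw [h.boundary x hx t ht]
  initial x hx := by rw [h.initial x hx]
  initial_memLp := h.initial_memLp.neg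
  initial_tendsto := by
    refine h.initial_tendsto.congr fun t => ?_
    rw [← eLpNorm_neg]
    congr 1
    ext x
    simp only [Pi.neg_apply]
    ring

theorem A_neg (a : ℝ) (t : ℝ) : A U a α (fun x t => -Ψ x t) t = A U a α Ψ t := by
  simp only [A, gradient_fun_neg, timeDeriv_neg, enorm_neg]

theorem spaceTimeNorm_neg (t₁ t₂ : ℝ) :
    spaceTimeNorm U α (fun x t => -Ψ x t) t₁ t₂ = spaceTimeNorm U α Ψ t₁ t₂ :=
  eLpNorm_neg _ _ _

/-! ### The local mass is controlled by the global energy -/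

theorem IsSolution.integrableOn_difference (hUb : Bornology.IsBounded U)
    (hp : IsSolution g U α p p₀ Ψ) (hΨ : IsBoundaryExtension U Ψ) {h : ℝ → ℝ} (hh : Continuous h)
    {t : ℝ} (ht : 0 < t) (k : ℝ) : IntegrableOn (fun x => h (p x t - Ψ x t - k)) U := by
  have h1 : ContinuousOn (fun x => p x t) (closure U) :=
    continuousOn_slice (F := p) hp.continuousOn (mem_Ioi.2 ht)
  have h2 : ContinuousOn (fun x => Ψ x t) (closure U) :=
    continuousOn_slice (F := Ψ) hΨ.continuousOn (mem_Ici.2 ht.le)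
  exact ((hh.comp_continuousOn ((h1.sub h2).sub continuousOn_const)).integrableOn_compact
    hUb.isCompact_closure).mono_set subset_closure

theorem IsBoundaryExtension.integrableOn_slice (hUb : Bornology.IsBounded U)
    (hΨ : IsBoundaryExtension U Ψ) (hα : 0 ≤ α) {t : ℝ} (ht : 0 ≤ t) :
    IntegrableOn (fun x => ‖Ψ x t‖ ^ α) U := by
  have h2 : ContinuousOn (fun x => Ψ x t) (closure U) :=
    continuousOn_slice (F := Ψ) hΨ.continuousOn (mem_Ici.2 ht)
  exact ((h2.norm.rpow_const fun _ _ => Or.inr hα).integrableOn_compact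
    hUb.isCompact_closure).mono_set subset_closure

/-- Undoes the truncation at level one: for s ≥ 3 the shifted value s - 1 is at least 2, where the
lower bound of `Phi` is available, and s ≤ 2(s - 1); smaller s only contribute a constant. -/
theorem rpow_max_le_Phi (hα : 2 ≤ α) (s : ℝ) :
    max s 0 ^ α ≤ 3 ^ α + 4 * 4 ^ α * Phi α 1 (s - 1) := by
  have hα0 : 0 ≤ α := by linarith
  have hP := Phi_nonneg (α := α) (δ := 1) (s - 1)
  rcases le_total s 3 with h | h
  · have : max s 0 ^ α ≤ 3 ^ α :=
      Real.rpow_le_rpow (le_max_right _ _) (max_le h (by norm_num)) hα0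
    have : 0 ≤ 4 * 4 ^ α * Phi α 1 (s - 1) := by positivity
    linarith
  · have h1 := Phi_ge hα one_pos (by linarith : 2 * 1 ≤ s - 1)
    rw [div_le_iff₀ (by positivity)] at h1
    have h2 : max s 0 ^ α ≤ 2 ^ α * (s - 1) ^ α := by
      rw [← Real.mul_rpow (by norm_num) (by linarith)]
      exact Real.rpow_le_rpow (le_max_right _ _) (max_le (by linarith) (by linarith)) hα0
    have h3 := mul_le_mul_of_nonneg_left h1 (by positivity : (0 : ℝ) ≤ 2 ^ α)
    have h4 : (4 : ℝ) ^ α = 2 ^ α * 2 ^ α := by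
      rw [← Real.mul_rpow (by norm_num) (by norm_num)]; norm_num
    have h5 : (0 : ℝ) ≤ 3 ^ α := by positivity
    rw [h4]
    linarith

/-- It rests on p₊ ≤ (p - Ψ)₊ + |Ψ|. This is the link between the local and the global argument, and
the only source of the space-time norm of Ψ in the final bounds. -/
theorem locMass_le (hU : IsOpen U) (hUb : Bornology.IsBounded U) (hα : 2 ≤ α)
    (hp : IsSolution g U α p p₀ Ψ) (hΨ : IsBoundaryExtension U Ψ) {ζ : Pt n → ℝ}
    (hζ : IsCutoff U ζ) {t : ℝ} (ht : 0 < t) :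
    locMass α 0 ζ p t ≤ 2 ^ α * (3 ^ α * volume.real U + 4 * 4 ^ α * globEnergy U α p Ψ t +
      ∫ x in U, ‖Ψ x t‖ ^ α) := by
  have hα0 : 0 ≤ α := by linarith
  have hfin : volume U ≠ ∞ := hUb.measure_lt_top.ne
  have i1 : IntegrableOn (fun x => Phi α 1 (p x t - Ψ x t - 1)) U :=
    hp.integrableOn_difference hUb hΨ (continuous_Phi hα one_pos) ht 1
  have i2 := hΨ.integrableOn_slice hUb hα0 ht.le
  have i0 : IntegrableOn (fun _ : Pt n => (3 : ℝ) ^ α) U := integrableOn_const hfin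
  have i3 : IntegrableOn (fun x => 3 ^ α + 4 * 4 ^ α * Phi α 1 (p x t - Ψ x t - 1)) U :=
    i0.add (i1.const_mul _)
  have i4 : IntegrableOn (fun x => 2 ^ α * (3 ^ α + 4 * 4 ^ α * Phi α 1 (p x t - Ψ x t - 1) +
    ‖Ψ x t‖ ^ α)) U := (i3.add i2).const_mul _
  have hR : ∫ x in U, 2 ^ α * (3 ^ α + 4 * 4 ^ α * Phi α 1 (p x t - Ψ x t - 1) + ‖Ψ x t‖ ^ α) =
      2 ^ α * (3 ^ α * volume.real U + 4 * 4 ^ α * globEnergy U α p Ψ t +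
        ∫ x in U, ‖Ψ x t‖ ^ α) := by
    rw [integral_const_mul, integral_add i3 i2, integral_add i0 (i1.const_mul _),
      integral_const_mul, setIntegral_const, smul_eq_mul, globEnergy, mul_comm (volume.real U)]
  rw [← hR, locMass, ← setIntegral_eq_integral_of_forall_compl_eq_zero (s := U) fun x hx => by
    rw [image_eq_zero_of_notMem_tsupport fun h => hx (hζ.subset h), mul_zero]]
  refine setIntegral_mono_on ?_ i4 hU.measurableSet fun x _ => ?_
  · have h1 : ContinuousOn (fun x => max (p x t - 0) 0 ^ α) U :=
      (((continuousOn_slice (F := p) hp.continuousOn (mem_Ioi.2 ht)).mono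
        subset_closure).sub continuousOn_const |>.sup continuousOn_const).rpow_const
          fun _ _ => Or.inr hα0
    exact (integrable_mul_weight hU h1 hζ.isWeight).integrableOn
  · have hle : max (p x t - 0) 0 ≤ max (p x t - Ψ x t) 0 + ‖Ψ x t‖ := by
      refine max_le ?_ (by positivity)
      have := le_max_left (p x t - Ψ x t) 0
      have := Real.le_norm_self (Ψ x t)
      linarith
    calc max (p x t - 0) 0 ^ α * ζ x ≤ max (p x t - 0) 0 ^ α * 1 :=
          mul_le_mul_of_nonneg_left (hζ.le_one x) (by positivity)
      _ = max (p x t - 0) 0 ^ α := mul_one _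
      _ ≤ (max (p x t - Ψ x t) 0 + ‖Ψ x t‖) ^ α :=
          Real.rpow_le_rpow (le_max_right _ _) hle hα0
      _ ≤ 2 ^ α * (max (p x t - Ψ x t) 0 ^ α + ‖Ψ x t‖ ^ α) :=
          add_rpow_le hα0 (le_max_right _ _) (norm_nonneg _)
      _ ≤ _ := by
          gcongr
          exact rpow_max_le_Phi hα _

/-- Tonelli's theorem for the space-time norm. -/
theorem IsBoundaryExtension.integral_integral_le (hUb : Bornology.IsBounded U)
    (hα : 0 < α) (hΨ : IsBoundaryExtension U Ψ) {t₁ t₂ X : ℝ} (h1 : 0 ≤ t₁) (h12 : t₁ ≤ t₂)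
    (hX0 : 0 ≤ X) (hX : spaceTimeNorm U α Ψ t₁ t₂ ≤ ENNReal.ofReal X) :
    IntervalIntegrable (fun t => ∫ x in U, ‖Ψ x t‖ ^ α) volume t₁ t₂ ∧
      ∫ t in t₁..t₂, ∫ x in U, ‖Ψ x t‖ ^ α ≤ X ^ α := by
  have hc : ContinuousOn (fun z : Pt n × ℝ => ‖Ψ z.1 z.2‖ ^ α) (closure U ×ˢ Icc t₁ t₂) :=
    (hΨ.continuousOn.mono (prod_mono subset_rfl fun t ht => h1.trans ht.1)).norm.rpow_const
      fun _ _ => Or.inr hα.le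
  have hi : IntegrableOn (fun z : Pt n × ℝ => ‖Ψ z.1 z.2‖ ^ α) (U ×ˢ Ioo t₁ t₂)
      (volume.prod volume) :=
    (hc.integrableOn_compact (hUb.isCompact_closure.prod isCompact_Icc)).mono_set
      (prod_mono subset_closure Ioo_subset_Icc_self)
  rw [IntegrableOn, ← Measure.prod_restrict] at hi
  have hi' := hi.integral_prod_right
  refine ⟨(intervalIntegrable_iff_integrableOn_Ioo_of_le h12).2 hi', ?_⟩
  rw [intervalIntegral.integral_of_le h12, integral_Ioc_eq_integral_Ioo]
  rw [← integral_prod_symm _ hi]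
  rw [integral_eq_lintegral_of_nonneg_ae (ae_of_all _ fun _ => by positivity) hi.1]
  have he : ∀ z : Pt n × ℝ, ENNReal.ofReal (‖Ψ z.1 z.2‖ ^ α) = ‖Ψ z.1 z.2‖ₑ ^ α := fun z => by
    rw [← ENNReal.ofReal_rpow_of_nonneg (norm_nonneg _) hα.le, ofReal_norm]
  simp only [he]
  rw [Measure.prod_restrict]
  rw [spaceTimeNorm, eLpNorm_eq_lintegral_rpow_enorm_toReal (by simpa using hα)
    ENNReal.ofReal_ne_top, ENNReal.toReal_ofReal hα.le, one_div] at hX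
  rw [ENNReal.rpow_inv_le_iff hα, ENNReal.ofReal_rpow_of_nonneg hX0 hα.le] at hX
  exact ENNReal.toReal_le_of_le_ofReal (by positivity) hX

end Forchheimer

/-! ### Interior bounds in terms of the time integral of the global energy. -/

namespace Forchheimer

variable {n : ℕ} {U : Set (Pt n)} {g : Poly} {α : ℝ} {p Ψ : Pt n → ℝ → ℝ} {p₀ : Pt n → ℝ}

theorem continuousOn_globEnergy (hn : 2 ≤ n) (hUb : Bornology.IsBounded U) (hU : IsOpen U)
    (hα : 2 ≤ α) (hκ : g.a < α * ((2 - g.a) / n)) (hp : IsSolution g U α p p₀ Ψ)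
    (hΨ : IsBoundaryExtension U Ψ) : ContinuousOn (globEnergy U α p Ψ) (Ioi 0) := by
  obtain ⟨_, _, _, _, h⟩ := exists_hasDerivAt_globEnergy_le g hn hUb hU hα hκ.le
  intro t ht
  obtain ⟨e, he, _⟩ := h hp hΨ ht
  exact he.continuousAt.continuousWithinAt

/-- The one-sided interior bound in terms of the energy of `(p - Ψ - 1)₊`. -/
theorem exists_le_of_globEnergy_le (g : Poly) (hn : 2 ≤ n) (hUb : Bornology.IsBounded U)
    (hU : IsOpen U) (hα : 2 ≤ α) (hκ : g.a < α * ((2 - g.a) / n)) {K : Set (Pt n)}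
    (hK : IsCompact K) (hKU : K ⊆ U) : ∃ C : ℝ, 0 < C ∧
    ∀ {p Ψ : Pt n → ℝ → ℝ} {p₀ : Pt n → ℝ}, IsSolution g U α p p₀ Ψ → IsBoundaryExtension U Ψ →
    ∀ {T τ X : ℝ}, 0 < τ → τ ≤ 1 / 4 → 2 * τ < T → 1 ≤ X →
      ∫ t in (T - 2 * τ)..T, globEnergy U α p Ψ t ≤ X ^ α →
      spaceTimeNorm U α Ψ (T - 2 * τ) T ≤ ENNReal.ofReal X →
      ∀ x ∈ K, p x T ≤ C * (τ ^ (-((1 + (2 - g.a) / n) / (α * ((2 - g.a) / n) - g.a))) *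
        X ^ (α * ((2 - g.a) / n) / (α * ((2 - g.a) / n) - g.a))) := by
  obtain ⟨ζ, C, hζ, hC, h⟩ := exists_local_sup_bound g hn hUb hU hα hκ hK hKU
  have ha := g.a_lt_one
  have hn0 : (0 : ℝ) < n := by exact_mod_cast (by omega : 0 < n)
  set μ := (2 - g.a) / n with hμ
  have hμ0 : 0 < μ := div_pos (by linarith) hn0
  set ρ := α * μ - g.a with hρ
  have hρ0 : 0 < ρ := sub_pos.2 hκ
  have hα0 : 0 < α := by linarith
  set C₀ : ℝ := 2 ^ α * (3 ^ α * volume.real U + 4 * 4 ^ α + 1) with hC₀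
  have hC₀0 : 0 < C₀ := by positivity
  refine ⟨C * (1 + C₀ ^ (μ / ρ)), by positivity, ?_⟩
  intro p Ψ p₀ hp hΨ T τ X hτ hτ1 hτT hX hE hS x hx
  have hX0 : 0 < X := by linarith
  have hT1 : 0 < T - 2 * τ := by linarith
  have hT2 : T - 2 * τ ≤ T := by linarith
  have hXα : 1 ≤ X ^ α := Real.one_le_rpow hX hα0.le
  obtain ⟨iΨ, hΨle⟩ := hΨ.integral_integral_le hUb hα0 hT1.le hT2 hX0.le hS
  have hsub : uIcc (T - 2 * τ) T ⊆ Ioi 0 := by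
    rw [uIcc_of_le hT2]; exact fun s hs => hT1.trans_le hs.1
  have iL : IntervalIntegrable (locMass α 0 ζ p) volume (T - 2 * τ) T :=
    ((continuousOn_locMass hU hp hα hζ.isWeight 0).mono hsub).intervalIntegrable
  have iE : IntervalIntegrable (globEnergy U α p Ψ) volume (T - 2 * τ) T :=
    ((continuousOn_globEnergy hn hUb hU hα hκ hp hΨ).mono hsub).intervalIntegrable
  have i0 : IntervalIntegrable (fun _ : ℝ => (3 : ℝ) ^ α * volume.real U) volume (T - 2 * τ) T :=
    intervalIntegrable_const
  have i1 : IntervalIntegrable (fun t => 3 ^ α * volume.real U + 4 * 4 ^ α * globEnergy U α p Ψ t)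
    volume (T - 2 * τ) T := i0.add (iE.const_mul _)
  have i2 : IntervalIntegrable (fun t => 2 ^ α * (3 ^ α * volume.real U +
      4 * 4 ^ α * globEnergy U α p Ψ t + ∫ x in U, ‖Ψ x t‖ ^ α)) volume (T - 2 * τ) T :=
    (i1.add iΨ).const_mul _
  have hY : ∫ t in (T - 2 * τ)..T, locMass α 0 ζ p t ≤ C₀ * X ^ α := by
    refine (intervalIntegral.integral_mono_on hT2 iL i2 fun t ht =>
      locMass_le hU hUb hα hp hΨ hζ (hT1.trans_le ht.1)).trans ?_
    rw [intervalIntegral.integral_const_mul, intervalIntegral.integral_add i1 iΨ,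
      intervalIntegral.integral_add i0 (iE.const_mul _),
      intervalIntegral.integral_const_mul (f := globEnergy U α p Ψ),
      intervalIntegral.integral_const, smul_eq_mul, hC₀, mul_assoc ((2 : ℝ) ^ α)]
    refine mul_le_mul_of_nonneg_left ?_ (by positivity)
    have hm : 0 ≤ 3 ^ α * volume.real U := by positivity
    -- The window is shorter than one and X^α ≥ 1, so the volume term is absorbed.
    have e1 : (T - (T - 2 * τ)) * (3 ^ α * volume.real U) ≤ 3 ^ α * volume.real U * X ^ α := by
      rw [mul_comm]
      exact mul_le_mul_of_nonneg_left (by linarith) hm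
    have e2 := mul_le_mul_of_nonneg_left hE (by positivity : (0 : ℝ) ≤ 4 * 4 ^ α)
    linarith
  have hY0 : 0 ≤ ∫ t in (T - 2 * τ)..T, locMass α 0 ζ p t :=
    intervalIntegral.integral_nonneg hT2 fun t _ => locMass_nonneg hζ.nonneg t
  refine (h hp hτ (by linarith) hτT x hx).trans ?_
  rw [mul_assoc]
  refine mul_le_mul_of_nonneg_left ?_ hC.le
  have hb : 1 ≤ τ ^ (-((1 + μ) / ρ)) * X ^ (α * μ / ρ) :=
    one_le_mul_of_one_le_of_one_le
      (Real.one_le_rpow_of_pos_of_le_one_of_nonpos hτ (by linarith)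
        (neg_nonpos.2 (by positivity))) (Real.one_le_rpow hX (by positivity))
  have hm : (τ ^ (-(1 + μ)) * (∫ t in (T - 2 * τ)..T, locMass α 0 ζ p t) ^ μ) ^ (1 / ρ) ≤
      C₀ ^ (μ / ρ) * (τ ^ (-((1 + μ) / ρ)) * X ^ (α * μ / ρ)) := by
    have e1 : (τ ^ (-(1 + μ)) * (C₀ * X ^ α) ^ μ) ^ (1 / ρ) =
        C₀ ^ (μ / ρ) * (τ ^ (-((1 + μ) / ρ)) * X ^ (α * μ / ρ)) := by
      rw [Real.mul_rpow (by positivity) (by positivity), ← Real.rpow_mul hτ.le,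
        ← Real.rpow_mul (by positivity), Real.mul_rpow hC₀0.le (by positivity),
        ← Real.rpow_mul hX0.le]
      rw [show -(1 + μ) * (1 / ρ) = -((1 + μ) / ρ) by ring, show μ * (1 / ρ) = μ / ρ by ring,
        show α * (μ / ρ) = α * μ / ρ by ring]
      ring
    rw [← e1]
    gcongr
  nlinarith

/-! ### Exponents -/

/-- The threshold α_* in the form used by the iteration: it makes the surplus αμ - a positive, with
μ = (2 - a)/n. -/
theorem lt_mul_of_alphaStar_lt (g : Poly) (hn : 2 ≤ n) (h : alphaStar n g.a < α) :
    g.a < α * ((2 - g.a) / n) := by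
  have ha := g.a_lt_one
  have hn0 : (0 : ℝ) < n := by exact_mod_cast (by omega : 0 < n)
  rw [alphaStar, div_lt_iff₀ (by linarith)] at h
  rw [← mul_div_assoc, lt_div_iff₀ hn0]
  exact h

/-- The second factor is the exponent that the iteration produces when the mass is of size X^α. The
first exceeds one, so passing to κ₂ only weakens a bound whose base is at least one. -/
theorem kappa2_eq (g : Poly) (hn : 2 ≤ n) (hα : 2 ≤ α) (h : alphaStar n g.a < α) :
    kappa2 n g.a α = (α / (α - g.a)) *
      (α * ((2 - g.a) / n) / (α * ((2 - g.a) / n) - g.a)) := by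
  have ha := g.a_lt_one
  have hn0 : (0 : ℝ) < n := by exact_mod_cast (by omega : 0 < n)
  have hκ := lt_mul_of_alphaStar_lt g hn h
  have h1 : α * ((2 - g.a) / n) - g.a ≠ 0 := (sub_pos.2 hκ).ne'
  have h2 : α - g.a ≠ 0 := by linarith
  have h3 : (2 - g.a) ≠ 0 := by linarith
  have h4 : α ≠ 0 := by linarith
  have e1 : 1 - g.a / α = (α - g.a) / α := by field_simp
  have e2 : 1 - alphaStar n g.a / α =
      (α * ((2 - g.a) / n) - g.a) / (α * ((2 - g.a) / n)) := by
    rw [alphaStar]; field_simp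
  rw [kappa2, e1, e2, one_div, mul_inv, inv_div, inv_div]

theorem exponent_le_kappa2 (g : Poly) (hn : 2 ≤ n) (hα : 2 ≤ α) (h : alphaStar n g.a < α) :
    α * ((2 - g.a) / n) / (α * ((2 - g.a) / n) - g.a) ≤ kappa2 n g.a α := by
  have ha := g.a_lt_one
  have ha0 := g.a_pos
  have hn0 : (0 : ℝ) < n := by exact_mod_cast (by omega : 0 < n)
  have hκ := lt_mul_of_alphaStar_lt g hn h
  rw [kappa2_eq g hn hα h]
  refine le_mul_of_one_le_left (div_nonneg (by linarith) (by linarith)) ?_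
  rw [one_le_div (by linarith)]
  linarith

theorem kappa2_pos (g : Poly) (hn : 2 ≤ n) (hα : 2 ≤ α) (h : alphaStar n g.a < α) :
    0 < kappa2 n g.a α := by
  have hκ := lt_mul_of_alphaStar_lt g hn h
  have ha0 := g.a_pos
  exact (div_pos (by linarith) (by linarith)).trans_le (exponent_le_kappa2 g hn hα h)

/-- With ρ = αμ - a one has κ₁ = (α + ρ)/ρ and (1 + μ)(α - a) = α + ρ - aμ, so the power of time
coming from the iteration is slightly better than the one claimed. -/
theorem exponent_le_kappa1 (g : Poly) (hn : 2 ≤ n) (hα : 2 ≤ α) (h : alphaStar n g.a < α) :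
    (1 + (2 - g.a) / n) / (α * ((2 - g.a) / n) - g.a) ≤ kappa1 n g.a α / (α - g.a) := by
  have ha := g.a_lt_one
  have ha0 := g.a_pos
  have hκ := lt_mul_of_alphaStar_lt g hn h
  set μ := (2 - g.a) / n
  have hρ : 0 < α * μ - g.a := sub_pos.2 hκ
  have hk0 : kappa0 n g.a α = α + (α * μ - g.a) := by rw [kappa0]; ring
  have hk0' : 0 < α + (α * μ - g.a) := by linarith
  have hk1 : kappa1 n g.a α = (α + (α * μ - g.a)) / (α * μ - g.a) := by
    rw [kappa1, hk0, one_sub_div hk0'.ne', add_sub_cancel_left, one_div_div]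
  rw [hk1, div_div, div_le_div_iff₀ hρ (mul_pos hρ (by linarith))]
  have h1 : (1 + μ) * (α - g.a) ≤ α + (α * μ - g.a) := by
    have : 0 < μ := by
      by_contra! hc
      nlinarith
    nlinarith
  calc (1 + μ) * ((α * μ - g.a) * (α - g.a)) = ((1 + μ) * (α - g.a)) * (α * μ - g.a) := by ring
    _ ≤ _ := mul_le_mul_of_nonneg_right h1 hρ.le

/-- The interior bound of `|p|` in terms of the energies of `(p - Ψ - 1)₊` and `(Ψ - p - 1)₊`. -/
theorem exists_supNorm_le_of_globEnergy_le (g : Poly) (hn : 2 ≤ n) (hUb : Bornology.IsBounded U)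
    (hU : IsOpen U) (hα : 2 ≤ α) (hα' : alphaStar n g.a < α) {U' : Set (Pt n)}
    (hK : IsCompact (closure U')) (hKU : closure U' ⊆ U) : ∃ C : ℝ, 0 < C ∧
    ∀ {p Ψ : Pt n → ℝ → ℝ} {p₀ : Pt n → ℝ}, IsSolution g U α p p₀ Ψ → IsBoundaryExtension U Ψ →
    ∀ {T τ X : ℝ}, 0 < τ → τ ≤ 1 / 4 → 2 * τ < T → 1 ≤ X →
      ∫ t in (T - 2 * τ)..T, globEnergy U α p Ψ t ≤ X ^ α →
      ∫ t in (T - 2 * τ)..T, globEnergy U α (fun x t => -p x t) (fun x t => -Ψ x t) t ≤ X ^ α →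
      spaceTimeNorm U α Ψ (T - 2 * τ) T ≤ ENNReal.ofReal X →
      supNorm U' p T ≤ ENNReal.ofReal
        (C * (τ ^ (-(kappa1 n g.a α / (α - g.a))) * X ^ kappa2 n g.a α)) := by
  have hκ := lt_mul_of_alphaStar_lt g hn hα'
  obtain ⟨C, hC, h⟩ := exists_le_of_globEnergy_le g hn hUb hU hα hκ hK hKU
  refine ⟨C, hC, ?_⟩
  intro p Ψ p₀ hp hΨ T τ X hτ hτ1 hτT hX hE hE' hS
  have h1 := h hp hΨ hτ hτ1 hτT hX hE hS
  have h2 := h hp.neg hΨ.neg hτ hτ1 hτT hX hE' (by rwa [spaceTimeNorm_neg])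
  have hle : C * (τ ^ (-((1 + (2 - g.a) / n) / (α * ((2 - g.a) / n) - g.a))) *
        X ^ (α * ((2 - g.a) / n) / (α * ((2 - g.a) / n) - g.a))) ≤
      C * (τ ^ (-(kappa1 n g.a α / (α - g.a))) * X ^ kappa2 n g.a α) := by
    refine mul_le_mul_of_nonneg_left (mul_le_mul ?_ ?_ (by positivity) (by positivity)) hC.le
    · exact Real.rpow_le_rpow_of_exponent_ge hτ (by linarith)
        (neg_le_neg (exponent_le_kappa1 g hn hα hα'))
    · exact Real.rpow_le_rpow_of_exponent_le hX (exponent_le_kappa2 g hn hα hα')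
  calc supNorm U' p T ≤ eLpNorm (fun x => p x T) ∞ (volume.restrict (closure U')) :=
        eLpNorm_mono_measure _ (Measure.restrict_mono subset_closure le_rfl)
    _ ≤ _ := by
        rw [eLpNorm_exponent_top]
        refine eLpNormEssSup_le_of_ae_bound ?_
        filter_upwards [ae_restrict_mem hK.measurableSet] with x hx
        rw [Real.norm_eq_abs]
        exact abs_le.2 ⟨by linarith [h2 x hx], (h1 x hx).trans hle⟩

end Forchheimer

namespace Forchheimer

variable {n : ℕ} {U : Set (Pt n)} {g : Poly} {α : ℝ} {p Ψ : Pt n → ℝ → ℝ} {p₀ : Pt n → ℝ}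

/-! ### The initial energy -/

theorem globEnergy_le_of_eLpNorm_le (hUb : Bornology.IsBounded U) (hU : IsOpen U) (hα : 2 ≤ α)
    (hp : IsSolution g U α p p₀ Ψ) (hΨ : IsBoundaryExtension U Ψ) {t R : ℝ} (ht : 0 < t)
    (hR : 0 ≤ R) (h : eLpNorm (fun x => p x t - Ψ x t) (ENNReal.ofReal α) (volume.restrict U) ≤
      ENNReal.ofReal R) : globEnergy U α p Ψ t ≤ R ^ α := by
  have hα0 : 0 < α := by linarith
  have i1 : IntegrableOn (fun x => Phi α 1 (p x t - Ψ x t - 1)) U :=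
    hp.integrableOn_difference hUb hΨ (continuous_Phi hα one_pos) ht 1
  have hm : AEStronglyMeasurable (fun x => p x t - Ψ x t) (volume.restrict U) := by
    have := (continuousOn_difference_slice hp hΨ ht 0).aestronglyMeasurable hU.measurableSet
      (μ := volume)
    simpa only [sub_zero] using this
  rw [eLpNorm_eq_lintegral_rpow_enorm_toReal (by simpa using hα0) ENNReal.ofReal_ne_top,
    ENNReal.toReal_ofReal hα0.le, one_div, ENNReal.rpow_inv_le_iff hα0,
    ENNReal.ofReal_rpow_of_nonneg hR hα0.le] at h
  obtain ⟨i2, e2⟩ := lintegral_enorm_rpow_ne_top_integrable hm hα0.le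
    (h.trans_lt ENNReal.ofReal_lt_top).ne
  refine (integral_mono i1 i2 fun x => ?_).trans
    (e2.le.trans (ENNReal.toReal_le_of_le_ofReal (by positivity) h))
  refine (Phi_le hα one_pos _).trans
    (Real.rpow_le_rpow (le_max_right _ _) (max_le ?_ (norm_nonneg _)) hα0.le)
  linarith [Real.le_norm_self (p x t - Ψ x t)]

/-- Ψ is uniformly continuous on the compact set closure U × [0,1], so the convergence is uniform in
x, and U has finite volume. -/
theorem IsBoundaryExtension.tendsto_eLpNorm_sub (hU : IsOpen U) (hUb : Bornology.IsBounded U)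
    (hα : 0 < α) (hΨ : IsBoundaryExtension U Ψ) :
    Tendsto (fun t => eLpNorm (fun x => Ψ x 0 - Ψ x t) (ENNReal.ofReal α) (volume.restrict U))
      (𝓝[>] 0) (𝓝 0) := by
  have huc := (hUb.isCompact_closure.prod (isCompact_Icc (a := (0 : ℝ)) (b := 1)))
    |>.uniformContinuousOn_of_continuous
      (hΨ.continuousOn.mono (prod_mono subset_rfl fun t ht => ht.1))
  rw [Metric.uniformContinuousOn_iff] at huc
  have hfin : volume U ≠ ∞ := hUb.measure_lt_top.ne
  set m := (volume U) ^ α⁻¹ with hm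
  have hmt : m ≠ ∞ := ENNReal.rpow_ne_top_of_nonneg (by positivity) hfin
  have hlim : Tendsto (fun ε : ℝ => m * ENNReal.ofReal ε) (𝓝[>] 0) (𝓝 0) := by
    have : Tendsto (fun ε : ℝ => m * ENNReal.ofReal ε) (𝓝 0) (𝓝 (m * ENNReal.ofReal 0)) :=
      ENNReal.Tendsto.const_mul (ENNReal.continuous_ofReal.tendsto 0) (Or.inr hmt)
    rw [ENNReal.ofReal_zero, mul_zero] at this
    exact this.mono_left nhdsWithin_le_nhds
  rw [ENNReal.tendsto_nhds_zero]
  intro ε' hε'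
  obtain ⟨ε, hε1, hε⟩ := ((ENNReal.tendsto_nhds_zero.1 hlim ε' hε').and
    self_mem_nhdsWithin).exists
  obtain ⟨δ, hδ, h⟩ := huc ε hε
  filter_upwards [Ioo_mem_nhdsGT (lt_min hδ one_pos)] with t ht
  refine le_trans ?_ hε1
  have hb : ∀ᵐ x ∂(volume.restrict U), ‖Ψ x 0 - Ψ x t‖ ≤ ε := by
    filter_upwards [ae_restrict_mem hU.measurableSet] with x hx
    have hx' := subset_closure hx
    rw [← dist_eq_norm]
    refine (h (x, 0) ⟨hx', by simp⟩ (x, t)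
      ⟨hx', ht.1.le, (ht.2.trans_le (min_le_right _ _)).le⟩ ?_).le
    rw [Prod.dist_eq, dist_self, max_eq_right dist_nonneg, Real.dist_eq, zero_sub, abs_neg,
      abs_of_pos ht.1]
    exact ht.2.trans_le (min_le_left _ _)
  have := eLpNorm_le_of_ae_bound (p := ENNReal.ofReal α) hb
  rwa [Measure.restrict_apply_univ, ENNReal.toReal_ofReal hα.le] at this

/-- The differential inequality is only available at positive times, so the comparison has to start
at some t₀ > 0. This t₀ depends on the solution, but the loss is at most one and is absorbed by the
summand 1 in the bounds. -/
theorem exists_eLpNorm_difference_le (hU : IsOpen U) (hUb : Bornology.IsBounded U)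
    (hα : 2 ≤ α) (hp : IsSolution g U α p p₀ Ψ) (hΨ : IsBoundaryExtension U Ψ) {t : ℝ}
    (ht : 0 < t) : ∃ t₀, 0 < t₀ ∧ t₀ ≤ t ∧
      eLpNorm (fun x => p x t₀ - Ψ x t₀) (ENNReal.ofReal α) (volume.restrict U) ≤
        eLpNorm (fun x => p₀ x - Ψ x 0) (ENNReal.ofReal α) (volume.restrict U) + 1 := by
  have h1 := hp.initial_tendsto
  have h2 := hΨ.tendsto_eLpNorm_sub hU hUb (α := α) (by linarith)
  have h3 := h1.add h2
  rw [add_zero] at h3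
  obtain ⟨t₀, hle, ht₀⟩ := ((ENNReal.tendsto_nhds_zero.1 h3 1 one_pos).and
    (Ioc_mem_nhdsGT ht)).exists
  refine ⟨t₀, ht₀.1, ht₀.2, ?_⟩
  have hα1 : (1 : ℝ≥0∞) ≤ ENNReal.ofReal α := by
    rw [← ENNReal.ofReal_one]; exact ENNReal.ofReal_le_ofReal (by linarith)
  have m1 : AEStronglyMeasurable (fun x => p x t₀) (volume.restrict U) :=
    ((continuousOn_slice (F := p) hp.continuousOn (mem_Ioi.2 ht₀.1)).mono
      subset_closure).aestronglyMeasurable hU.measurableSet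
  have m2 : ∀ s, 0 ≤ s → AEStronglyMeasurable (fun x => Ψ x s) (volume.restrict U) := fun s hs =>
    ((continuousOn_slice (F := Ψ) hΨ.continuousOn (mem_Ici.2 hs)).mono
      subset_closure).aestronglyMeasurable hU.measurableSet
  have m0 := hp.initial_memLp.1
  have e : (fun x => p x t₀ - Ψ x t₀) = (fun x => p₀ x - Ψ x 0) +
      ((fun x => p x t₀ - p₀ x) + (fun x => Ψ x 0 - Ψ x t₀)) := by
    ext x
    simp only [Pi.add_apply]
    ring
  rw [e]
  refine (eLpNorm_add_le (m0.sub (m2 0 le_rfl))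
    ((m1.sub m0).add ((m2 0 le_rfl).sub (m2 t₀ ht₀.1.le))) hα1).trans ?_
  refine add_le_add le_rfl ?_
  exact (eLpNorm_add_le (m1.sub m0) ((m2 0 le_rfl).sub (m2 t₀ ht₀.1.le)) hα1).trans hle

/-! ### Energy bounds -/

/-- If the source is of size X^{α-a}, the constant barrier has size X^α, and X ≥ 1 absorbs the
additive constants. The summand 2 in the factor lets the same bound dominate the initial energy (X +
1)^α. -/
theorem barrier_le {c C X a : ℝ} (hc : 0 < c) (hC : 0 < C) (hX : 1 ≤ X) (hα : 2 ≤ α)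
    (ha1 : a < 1) :
    (C * (1 + X ^ (α - a)) / c + 1) ^ (1 / ((α - a) / α)) ≤
      ((2 + (2 * C / c + 1) ^ (1 / (α - a))) * X) ^ α := by
  have hr : 0 < α - a := by linarith
  have hα0 : 0 < α := by linarith
  have hX0 : 0 < X := by linarith
  have hF : 1 ≤ X ^ (α - a) := Real.one_le_rpow hX hr.le
  have h1 : C * (1 + X ^ (α - a)) / c + 1 ≤ (2 * C / c + 1) * X ^ (α - a) := by
    have e1 : C * (1 + X ^ (α - a)) / c ≤ C * (2 * X ^ (α - a)) / c := by
      gcongr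
      linarith
    have e2 : (2 * C / c + 1) * X ^ (α - a) = C * (2 * X ^ (α - a)) / c + X ^ (α - a) := by ring
    linarith
  have hQ : 0 < 2 * C / c + 1 := by positivity
  set Q := 2 * C / c + 1
  rw [one_div_div]
  calc (C * (1 + X ^ (α - a)) / c + 1) ^ (α / (α - a)) ≤ (Q * X ^ (α - a)) ^ (α / (α - a)) :=
        Real.rpow_le_rpow (by positivity) h1 (by positivity)
    _ = (Q ^ (1 / (α - a)) * X) ^ α := by
        rw [Real.mul_rpow hQ.le (by positivity), Real.mul_rpow (by positivity) hX0.le,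
          ← Real.rpow_mul hX0.le, ← Real.rpow_mul hQ.le, mul_div_cancel₀ _ hr.ne',
          one_div_mul_eq_div]
    _ ≤ _ := by
        refine Real.rpow_le_rpow (by positivity) ?_ hα0.le
        gcongr
        linarith

/-- The energy is bounded on `(0,t]` in terms of the initial data and of `sup A`. -/
theorem exists_globEnergy_le (g : Poly) (hn : 2 ≤ n) (hUb : Bornology.IsBounded U)
    (hU : IsOpen U) (hα : 2 ≤ α) (hκ : g.a < α * ((2 - g.a) / n)) : ∃ B : ℝ, 1 ≤ B ∧
    ∀ {p Ψ : Pt n → ℝ → ℝ} {p₀ : Pt n → ℝ}, IsSolution g U α p p₀ Ψ → IsBoundaryExtension U Ψ →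
    ∀ {X : ℝ}, 1 ≤ X →
      (∀ {t : ℝ}, eLpNorm (fun x => p₀ x - Ψ x 0) (ENNReal.ofReal α) (volume.restrict U) ≤
          ENNReal.ofReal X → (∀ s ∈ Ioc 0 t, A U g.a α Ψ s ≤ ENNReal.ofReal (X ^ (α - g.a))) →
        ∀ s ∈ Ioc 0 t, globEnergy U α p Ψ s ≤ (B * X) ^ α) ∧
      ((∀ᶠ t in atTop, A U g.a α Ψ t ≤ ENNReal.ofReal (X ^ (α - g.a))) →
        ∀ᶠ t in atTop, globEnergy U α p Ψ t ≤ (B * X) ^ α) := by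
  obtain ⟨c, C, hc, hC, h⟩ := exists_hasDerivAt_globEnergy_le g hn hUb hU hα hκ.le
  have ha := g.a_lt_one
  have hr : 0 < α - g.a := by linarith
  have hα0 : 0 < α := by linarith
  have hγ : 0 < (α - g.a) / α := by positivity
  refine ⟨2 + (2 * C / c + 1) ^ (1 / (α - g.a)), ?_, ?_⟩
  · have : 0 ≤ (2 * C / c + 1) ^ (1 / (α - g.a)) := by positivity
    linarith
  intro p Ψ p₀ hp hΨ X hX
  have hX0 : 0 < X := by linarith
  have hF0 : 0 ≤ X ^ (α - g.a) := by positivity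
  have hbar := barrier_le hc hC hX hα ha
  choose! e he hle using fun t (ht : 0 < t) => h hp hΨ ht
  have hle' : ∀ t, 0 < t → A U g.a α Ψ t ≤ ENNReal.ofReal (X ^ (α - g.a)) →
      e t ≤ -(c * globEnergy U α p Ψ t ^ ((α - g.a) / α)) + C * (1 + X ^ (α - g.a)) := by
    intro t ht hA
    have h1 := hle t ht (hA.trans_lt ENNReal.ofReal_lt_top).ne
    have h2 := ENNReal.toReal_le_of_le_ofReal hF0 hA
    have h3 := mul_le_mul_of_nonneg_left h2 hC.le
    linarith
  constructor
  · intro t h0 hA s hs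
    obtain ⟨t₀, ht₀, ht₀s, hn0⟩ := exists_eLpNorm_difference_le hU hUb hα hp hΨ hs.1
    have h1 := le_max_of_deriv_le (y := globEnergy U α p Ψ) (T := s) hc hC hγ hF0
      (fun r hr => he r (ht₀.trans_le hr.1))
      (fun r hr => hle' r (ht₀.trans_le hr.1) (hA r ⟨ht₀.trans_le hr.1, hr.2.trans hs.2⟩))
      (right_mem_Icc.2 ht₀s)
    refine h1.trans (max_le ?_ hbar)
    have h2 : globEnergy U α p Ψ t₀ ≤ (X + 1) ^ α := by
      refine globEnergy_le_of_eLpNorm_le hUb hU hα hp hΨ ht₀ (by positivity) (hn0.trans ?_)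
      rw [ENNReal.ofReal_add hX0.le zero_le_one, ENNReal.ofReal_one]
      gcongr
    refine h2.trans (Real.rpow_le_rpow (by positivity) ?_ hα0.le)
    have : 0 ≤ (2 * C / c + 1) ^ (1 / (α - g.a)) * X := by positivity
    linarith
  · intro hA
    obtain ⟨t₀, ht₀⟩ := eventually_atTop.1 hA
    obtain ⟨T, _, hT⟩ := exists_forall_le_of_deriv_le (y := globEnergy U α p Ψ) (t₀ := max t₀ 1)
      hc hC hγ hF0 (fun r hr => he r (one_pos.trans_le ((le_max_right _ _).trans hr)))
      (fun r hr => hle' r (one_pos.trans_le ((le_max_right _ _).trans hr))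
        (ht₀ r ((le_max_left _ _).trans hr)))
    exact eventually_atTop.2 ⟨T, fun t ht => (hT t ht).trans hbar⟩

/-- The energy is eventually bounded in terms of `A`, if `A'` is bounded from below. -/
theorem exists_globEnergy_le_of_deriv (g : Poly) (hn : 2 ≤ n) (hUb : Bornology.IsBounded U)
    (hU : IsOpen U) (hα : 2 ≤ α) (hκ : g.a < α * ((2 - g.a) / n)) : ∃ B : ℝ, 1 ≤ B ∧
    ∀ {p Ψ : Pt n → ℝ → ℝ} {p₀ : Pt n → ℝ}, IsSolution g U α p p₀ Ψ → IsBoundaryExtension U Ψ →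
    AIsC1 U g.a α Ψ → ∀ {X : ℝ}, 1 ≤ X → beta U g.a α Ψ ≤ ENNReal.ofReal (X ^ (α - 2 * g.a)) →
      ∀ᶠ t in atTop, globEnergy U α p Ψ t ≤
        B * (X ^ α + (A U g.a α Ψ t).toReal ^ (α / (α - g.a))) := by
  obtain ⟨c, C, hc, hC, h⟩ := exists_hasDerivAt_globEnergy_le g hn hUb hU hα hκ.le
  have ha := g.a_lt_one
  have ha0 := g.a_pos
  have hr : 0 < α - g.a := by linarith
  have hr2 : 0 < α - 2 * g.a := by linarith
  have hα0 : 0 < α := by linarith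
  -- Equivalent to α > 2a, which follows from α ≥ 2 and a < 1; the moving barrier depends on it.
  have hγ : 1 / 2 < (α - g.a) / α := by rw [div_lt_div_iff₀ two_pos hα0]; linarith
  have hγ1 : (α - g.a) / α ≤ 1 := by rw [div_le_one hα0]; linarith
  set M := (C + 2) / c with hM
  have hM0 : 0 < M := by positivity
  set θ := α / (α - g.a) with hθ
  have hθ0 : 0 < θ := by positivity
  have hθ2 : 1 / (2 - θ) = (α - g.a) / (α - 2 * g.a) := by
    have : 2 - θ = (α - 2 * g.a) / (α - g.a) := by rw [hθ]; field_simp; ring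
    rw [this, one_div_div]
  set k := (θ * M ^ θ * 2) ^ ((α - g.a) / (α - 2 * g.a)) with hk
  have hk0 : 0 ≤ k := by positivity
  refine ⟨1 + (M * (1 + k)) ^ θ * 2 ^ θ, le_add_of_nonneg_right (by positivity), ?_⟩
  intro p Ψ p₀ hp hΨ hC1 X hX hβ
  have hX0 : 0 < X := by linarith
  choose! e he hle using fun t (ht : 0 < t) => h hp hΨ ht
  have hX2 : 1 ≤ X ^ (α - 2 * g.a) := Real.one_le_rpow hX hr2.le
  -- The factor two leaves strict room above the limit superior, so that A' ≥ -b holds at all large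
  -- times.
  set b := 2 * X ^ (α - 2 * g.a) with hb
  have hev : ∀ᶠ t in atTop, -b ≤ deriv (fun s => (A U g.a α Ψ s).toReal) t := by
    have hlt : beta U g.a α Ψ < ENNReal.ofReal b :=
      hβ.trans_lt ((ENNReal.ofReal_lt_ofReal_iff (by positivity)).2 (by linarith))
    filter_upwards [eventually_lt_of_limsup_lt hlt] with t ht
    have := (ENNReal.ofReal_lt_ofReal_iff (by positivity)).1 ht
    linarith
  obtain ⟨t₀, ht₀⟩ := eventually_atTop.1 hev
  have hpos : ∀ t, max t₀ 1 ≤ t → 0 < t := fun t ht =>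
    one_pos.trans_le ((le_max_right _ _).trans ht)
  obtain ⟨T, hT0, hT⟩ := exists_forall_le_rpow_of_deriv_le (y := globEnergy U α p Ψ)
    (f := fun s => (A U g.a α Ψ s).toReal) (t₀ := max t₀ 1) (b := b) hc hC hγ hγ1 (by positivity)
    hM (fun t ht => he t (hpos t ht)) (fun _ _ => ENNReal.toReal_nonneg)
    (fun t ht => ((hC1.2.differentiableOn one_ne_zero).differentiableAt
      (Ioi_mem_nhds (hpos t ht))).hasDerivAt)
    (fun t ht => ht₀ t ((le_max_left _ _).trans ht))
    (fun t ht => hle t (hpos t ht) (hC1.1 t (hpos t ht)))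
  refine eventually_atTop.2 ⟨T, fun t ht => (hT t ht).trans ?_⟩
  rw [one_div_div, ← hθ, hθ2]
  set f := (A U g.a α Ψ t).toReal
  have hf : 0 ≤ f := ENNReal.toReal_nonneg
  have e1 : (θ * M ^ θ * b) ^ ((α - g.a) / (α - 2 * g.a)) = k * X ^ (α - g.a) := by
    rw [hb, ← mul_assoc, Real.mul_rpow (by positivity) (by positivity), ← Real.rpow_mul hX0.le,
      mul_div_cancel₀ _ hr2.ne']
  rw [e1]
  have hF : 1 ≤ X ^ (α - g.a) := Real.one_le_rpow hX hr.le
  have e2 : M * (1 + k * X ^ (α - g.a) + f) ≤ (M * (1 + k)) * (X ^ (α - g.a) + f) := by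
    rw [mul_assoc]
    refine mul_le_mul_of_nonneg_left ?_ hM0.le
    have : 0 ≤ k * f := by positivity
    linarith
  calc (M * (1 + k * X ^ (α - g.a) + f)) ^ θ ≤ ((M * (1 + k)) * (X ^ (α - g.a) + f)) ^ θ :=
        Real.rpow_le_rpow (by positivity) e2 hθ0.le
    _ = (M * (1 + k)) ^ θ * (X ^ (α - g.a) + f) ^ θ :=
        Real.mul_rpow (by positivity) (by positivity)
    _ ≤ (M * (1 + k)) ^ θ * (2 ^ θ * ((X ^ (α - g.a)) ^ θ + f ^ θ)) := by
        gcongr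
        exact add_rpow_le hθ0.le (by positivity) hf
    _ = (M * (1 + k)) ^ θ * 2 ^ θ * (X ^ α + f ^ θ) := by
        rw [← Real.rpow_mul hX0.le, hθ, mul_div_cancel₀ _ hr.ne', mul_assoc]
    _ ≤ _ := by
        gcongr
        linarith

end Forchheimer

namespace Forchheimer

variable {n : ℕ} {U : Set (Pt n)} {g : Poly} {α : ℝ} {p Ψ : Pt n → ℝ → ℝ} {p₀ : Pt n → ℝ}

/-! ### Interior bounds -/

theorem spaceTimeNorm_mono {s₁ s₂ t₁ t₂ : ℝ} (h₁ : t₁ ≤ s₁) (h₂ : s₂ ≤ t₂) :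
    spaceTimeNorm U α Ψ s₁ s₂ ≤ spaceTimeNorm U α Ψ t₁ t₂ :=
  eLpNorm_mono_measure _ (Measure.restrict_mono (prod_mono subset_rfl (Ioo_subset_Ioo h₁ h₂))
    le_rfl)

theorem eLpNorm_initial_neg : eLpNorm (fun x => -p₀ x - -Ψ x 0) (ENNReal.ofReal α)
    (volume.restrict U) = eLpNorm (fun x => p₀ x - Ψ x 0) (ENNReal.ofReal α)
      (volume.restrict U) := by
  rw [← eLpNorm_neg]
  congr 1
  ext x
  simp only [Pi.neg_apply]
  ring

theorem AIsC1.neg {a : ℝ} (h : AIsC1 U a α Ψ) : AIsC1 U a α (fun x t => -Ψ x t) := by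
  simpa only [AIsC1, A_neg] using h

theorem beta_neg (a : ℝ) : beta U a α (fun x t => -Ψ x t) = beta U a α Ψ := by
  simp only [beta, A_neg]

theorem integral_le_of_forall_le {y : ℝ → ℝ} {s t M : ℝ} (hst : s ≤ t) (hst1 : t - s ≤ 1)
    (hy : ContinuousOn y (Icc s t)) (h : ∀ r ∈ Icc s t, y r ≤ M) (hM : 0 ≤ M) :
    ∫ r in s..t, y r ≤ M := by
  refine (intervalIntegral.integral_mono_on hst
    ((uIcc_of_le hst).symm ▸ hy : ContinuousOn y (uIcc s t)).intervalIntegrable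
    (intervalIntegrable_const (c := M)) h).trans ?_
  rw [intervalIntegral.integral_const, smul_eq_mul]
  exact mul_le_of_le_one_left hM hst1

theorem integral_rpow_toReal_le {f : ℝ → ℝ≥0∞} {q r t₁ t₂ s₁ s₂ X : ℝ} (hq : 0 < q)
    (hr : 0 < r) (hs : s₁ ≤ s₂) (h₁ : t₁ ≤ s₁) (h₂ : s₂ ≤ t₂) (hX : 0 ≤ X)
    (hf : ContinuousOn (fun t => (f t).toReal) (Icc s₁ s₂))
    (h : eLpNorm f (ENNReal.ofReal q) (volume.restrict (Ioo t₁ t₂)) ^ (1 / r) ≤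
      ENNReal.ofReal X) :
    ∫ t in s₁..s₂, (f t).toReal ^ q ≤ X ^ (r * q) := by
  have hm : AEStronglyMeasurable (fun t => (f t).toReal ^ q) (volume.restrict (Ioo s₁ s₂)) :=
    ((hf.mono Ioo_subset_Icc_self).rpow_const fun _ _ => Or.inr hq.le).aestronglyMeasurable
      measurableSet_Ioo
  rw [intervalIntegral.integral_of_le hs, integral_Ioc_eq_integral_Ioo,
    integral_eq_lintegral_of_nonneg_ae (ae_of_all _ fun t => by positivity) hm]
  rw [eLpNorm_eq_lintegral_rpow_enorm_toReal (by simpa using hq) ENNReal.ofReal_ne_top,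
    ENNReal.toReal_ofReal hq.le, one_div, one_div, ENNReal.rpow_inv_le_iff hr,
    ENNReal.rpow_inv_le_iff hq, ← ENNReal.rpow_mul,
    ENNReal.ofReal_rpow_of_nonneg hX (by positivity)] at h
  refine ENNReal.toReal_le_of_le_ofReal (by positivity) (le_trans ?_ h)
  refine (lintegral_mono fun t => ?_).trans
    (lintegral_mono' (Measure.restrict_mono (Ioo_subset_Ioo h₁ h₂) le_rfl) le_rfl)
  rw [← ENNReal.ofReal_rpow_of_nonneg ENNReal.toReal_nonneg hq.le]
  gcongr
  exact ENNReal.ofReal_toReal_le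

/-- The energy estimate behind `L^∞` bounds with arbitrary data, normalized by a number `X` that
dominates the data. -/
theorem exists_supNorm_le (g : Poly) (hn : 2 ≤ n) (hUb : Bornology.IsBounded U)
    (hU : IsOpen U) (hα : 2 ≤ α) (hα' : alphaStar n g.a < α) {U' : Set (Pt n)}
    (hK : IsCompact (closure U')) (hKU : closure U' ⊆ U) : ∃ C : ℝ, 0 < C ∧
    ∀ {p Ψ : Pt n → ℝ → ℝ} {p₀ : Pt n → ℝ}, IsSolution g U α p p₀ Ψ → IsBoundaryExtension U Ψ →
    ∀ {X : ℝ}, 1 ≤ X →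
      (∀ {t τ : ℝ}, 0 < τ → τ ≤ 1 / 4 → 2 * τ < t →
        eLpNorm (fun x => p₀ x - Ψ x 0) (ENNReal.ofReal α) (volume.restrict U) ≤
          ENNReal.ofReal X → (∀ s ∈ Ioc 0 t, A U g.a α Ψ s ≤ ENNReal.ofReal (X ^ (α - g.a))) →
        spaceTimeNorm U α Ψ (t - 2 * τ) t ≤ ENNReal.ofReal X →
        supNorm U' p t ≤ ENNReal.ofReal
          (C * (τ ^ (-(kappa1 n g.a α / (α - g.a))) * X ^ kappa2 n g.a α))) ∧
      ((∀ᶠ t in atTop, A U g.a α Ψ t ≤ ENNReal.ofReal (X ^ (α - g.a))) →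
        (∀ᶠ t in atTop, spaceTimeNorm U α Ψ (t - 1) t ≤ ENNReal.ofReal X) →
        ∀ᶠ t in atTop, supNorm U' p t ≤ ENNReal.ofReal (C * X ^ kappa2 n g.a α)) := by
  have hκ := lt_mul_of_alphaStar_lt g hn hα'
  have hκ2 := kappa2_pos g hn hα hα'
  obtain ⟨C, hC, h⟩ := exists_supNorm_le_of_globEnergy_le g hn hUb hU hα hα' hK hKU
  obtain ⟨B, hB, hE⟩ := exists_globEnergy_le g hn hUb hU hα hκ
  have hB0 : 0 < B := by linarith
  set q := kappa1 n g.a α / (α - g.a)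
  set D : ℝ := (1 / 4) ^ (-q) with hD
  have hD0 : 0 < D := by positivity
  refine ⟨C * B ^ kappa2 n g.a α * (1 + D), by positivity, ?_⟩
  intro p Ψ p₀ hp hΨ X hX
  have hX0 : 0 < X := by linarith
  have hBX : 1 ≤ B * X := one_le_mul_of_one_le_of_one_le hB hX
  have hXBX : X ≤ B * X := le_mul_of_one_le_left hX0.le hB
  have hBXα : 0 ≤ (B * X) ^ α := by positivity
  have hc := continuousOn_globEnergy hn hUb hU hα hκ hp hΨ
  have hc' := continuousOn_globEnergy hn hUb hU hα hκ hp.neg hΨ.neg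
  have hpow : ∀ r : ℝ, C * (r * (B * X) ^ kappa2 n g.a α) =
      C * B ^ kappa2 n g.a α * (r * X ^ kappa2 n g.a α) := fun r => by
    rw [Real.mul_rpow hB0.le hX0.le]; ring
  have hP : 0 ≤ C * B ^ kappa2 n g.a α := by positivity
  constructor
  · intro t τ hτ hτ1 hτt h0 hA hS
    have hI : Icc (t - 2 * τ) t ⊆ Ioc 0 t := fun s hs => ⟨by linarith [hs.1], hs.2⟩
    have e1 := (hE hp hΨ hX).1 h0 hA
    have e2 := (hE hp.neg hΨ.neg hX).1 (eLpNorm_initial_neg.trans_le h0)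
      (fun s hs => (A_neg g.a s).trans_le (hA s hs))
    refine (h hp hΨ hτ hτ1 hτt hBX
      (integral_le_of_forall_le (by linarith) (by linarith)
        (hc.mono fun s hs => (hI hs).1) (fun s hs => e1 s (hI hs)) hBXα)
      (integral_le_of_forall_le (by linarith) (by linarith)
        (hc'.mono fun s hs => (hI hs).1) (fun s hs => e2 s (hI hs)) hBXα)
      (hS.trans (ENNReal.ofReal_le_ofReal hXBX))).trans (ENNReal.ofReal_le_ofReal ?_)
    rw [hpow]
    refine mul_le_mul_of_nonneg_right (le_mul_of_one_le_right hP ?_) (by positivity)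
    linarith
  · intro hA hS
    obtain ⟨T₁, h1⟩ := eventually_atTop.1 ((hE hp hΨ hX).2 hA)
    obtain ⟨T₂, h2⟩ := eventually_atTop.1 ((hE hp.neg hΨ.neg hX).2
      (hA.mono fun s hs => (A_neg g.a s).trans_le hs))
    filter_upwards [hS, eventually_ge_atTop (T₁ + 1), eventually_ge_atTop (T₂ + 1),
      eventually_ge_atTop 1] with t hSt ht1 ht2 ht
    have hI : ∀ s ∈ Icc (t - 2 * (1 / 4)) t, 0 < s ∧ T₁ ≤ s ∧ T₂ ≤ s := fun s hs =>
      ⟨by linarith [hs.1], by linarith [hs.1], by linarith [hs.1]⟩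
    refine (h hp hΨ (by norm_num : (0 : ℝ) < 1 / 4) le_rfl (by linarith) hBX
      (integral_le_of_forall_le (by linarith) (by linarith)
        (hc.mono fun s hs => (hI s hs).1) (fun s hs => h1 s (hI s hs).2.1) hBXα)
      (integral_le_of_forall_le (by linarith) (by linarith)
        (hc'.mono fun s hs => (hI s hs).1) (fun s hs => h2 s (hI s hs).2.2) hBXα)
      ((spaceTimeNorm_mono (by linarith) le_rfl).trans
        (hSt.trans (ENNReal.ofReal_le_ofReal hXBX)))).trans (ENNReal.ofReal_le_ofReal ?_)
    rw [hpow, ← hD, mul_assoc _ (1 + D)]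
    refine mul_le_mul_of_nonneg_left ?_ hP
    refine mul_le_mul_of_nonneg_right ?_ (by positivity)
    linarith

/-- X is quantified after the large time because it has to follow the norms over (t - 1, t); only
`b`, which bounds β, determines when the estimate starts. The energy bound of order b^α +
A^{α/(α-a)} is integrated over the last half unit of time, and this produces the L^{α/(α-a)} norm of
A. -/
theorem exists_supNorm_le_of_beta (g : Poly) (hn : 2 ≤ n) (hUb : Bornology.IsBounded U)
    (hU : IsOpen U) (hα : 2 ≤ α) (hα' : alphaStar n g.a < α) {U' : Set (Pt n)}
    (hK : IsCompact (closure U')) (hKU : closure U' ⊆ U) : ∃ C : ℝ, 0 < C ∧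
    ∀ {p Ψ : Pt n → ℝ → ℝ} {p₀ : Pt n → ℝ}, IsSolution g U α p p₀ Ψ → IsBoundaryExtension U Ψ →
    AIsC1 U g.a α Ψ → ∀ {b : ℝ}, 1 ≤ b → beta U g.a α Ψ ≤ ENNReal.ofReal (b ^ (α - 2 * g.a)) →
    ∀ᶠ t in atTop, ∀ X : ℝ, b ≤ X →
      eLpNorm (A U g.a α Ψ) (ENNReal.ofReal (α / (α - g.a)))
        (volume.restrict (Ioo (t - 1) t)) ^ (1 / (α - g.a)) ≤ ENNReal.ofReal X →
      spaceTimeNorm U α Ψ (t - 1) t ≤ ENNReal.ofReal X →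
      supNorm U' p t ≤ ENNReal.ofReal (C * X ^ kappa2 n g.a α) := by
  have hκ := lt_mul_of_alphaStar_lt g hn hα'
  have hκ2 := kappa2_pos g hn hα hα'
  have ha := g.a_lt_one
  have hr : 0 < α - g.a := by linarith
  have hα0 : 0 < α := by linarith
  obtain ⟨C, hC, h⟩ := exists_supNorm_le_of_globEnergy_le g hn hUb hU hα hα' hK hKU
  obtain ⟨B, hB, hE⟩ := exists_globEnergy_le_of_deriv g hn hUb hU hα hκ
  have hB0 : 0 < B := by linarith
  set θ := α / (α - g.a) with hθ
  have hθ0 : 0 < θ := by positivity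
  set q := kappa1 n g.a α / (α - g.a)
  set D : ℝ := (1 / 4) ^ (-q) with hD
  have hD0 : 0 < D := by positivity
  refine ⟨C * (2 * B) ^ kappa2 n g.a α * D, by positivity, ?_⟩
  intro p Ψ p₀ hp hΨ hC1 b hb hβ
  obtain ⟨T₁, h1⟩ := eventually_atTop.1 (hE hp hΨ hC1 hb hβ)
  obtain ⟨T₂, h2⟩ := eventually_atTop.1 (hE hp.neg hΨ.neg hC1.neg hb ((beta_neg g.a).trans_le hβ))
  simp only [A_neg] at h2
  filter_upwards [eventually_ge_atTop (T₁ + 1), eventually_ge_atTop (T₂ + 1),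
    eventually_ge_atTop 1] with t ht1 ht2 ht
  intro X hbX hAX hS
  have hX : 1 ≤ X := hb.trans hbX
  have hX0 : 0 < X := by linarith
  have hBX : 1 ≤ 2 * B * X := one_le_mul_of_one_le_of_one_le (by linarith) hX
  have hXBX : X ≤ 2 * B * X := le_mul_of_one_le_left hX0.le (by linarith)
  have hI : ∀ s ∈ Icc (t - 2 * (1 / 4)) t, 0 < s ∧ T₁ ≤ s ∧ T₂ ≤ s := fun s hs =>
    ⟨by linarith [hs.1], by linarith [hs.1], by linarith [hs.1]⟩
  have hle : t - 2 * (1 / 4) ≤ t := by linarith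
  have hfc : ContinuousOn (fun s => (A U g.a α Ψ s).toReal) (Icc (t - 2 * (1 / 4)) t) :=
    hC1.2.continuousOn.mono fun s hs => (hI s hs).1
  have hAint : ∫ s in (t - 2 * (1 / 4))..t, (A U g.a α Ψ s).toReal ^ θ ≤ X ^ α := by
    have := integral_rpow_toReal_le hθ0 hr hle (by linarith) le_rfl hX0.le hfc hAX
    rwa [hθ, mul_div_cancel₀ _ hr.ne'] at this
  have iA : IntervalIntegrable (fun s => (A U g.a α Ψ s).toReal ^ θ) volume
      (t - 2 * (1 / 4)) t := by
    refine ContinuousOn.intervalIntegrable ?_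
    rw [uIcc_of_le hle]
    exact hfc.rpow_const fun _ _ => Or.inr hθ0.le
  have key : ∀ y : ℝ → ℝ, ContinuousOn y (Ioi 0) →
      (∀ s ∈ Icc (t - 2 * (1 / 4)) t, y s ≤ B * (b ^ α + (A U g.a α Ψ s).toReal ^ θ)) →
      ∫ s in (t - 2 * (1 / 4))..t, y s ≤ (2 * B * X) ^ α := by
    intro y hy hyle
    have iy : IntervalIntegrable y volume (t - 2 * (1 / 4)) t := by
      refine ContinuousOn.intervalIntegrable ?_
      rw [uIcc_of_le hle]
      exact hy.mono fun s hs => (hI s hs).1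
    refine (intervalIntegral.integral_mono_on hle iy
      (((intervalIntegrable_const (c := b ^ α)).add iA).const_mul B) hyle).trans ?_
    rw [intervalIntegral.integral_const_mul,
      intervalIntegral.integral_add intervalIntegrable_const iA, intervalIntegral.integral_const,
      smul_eq_mul, Real.mul_rpow (by positivity) hX0.le]
    have e1 : b ^ α ≤ X ^ α := Real.rpow_le_rpow (by linarith) hbX hα0.le
    have e2 : 0 ≤ b ^ α := Real.rpow_nonneg (by linarith) _
    have e3 : 2 * B ≤ (2 * B) ^ α := Real.self_le_rpow_of_one_le (by linarith) (by linarith)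
    calc B * ((t - (t - 2 * (1 / 4))) * b ^ α +
          ∫ s in (t - 2 * (1 / 4))..t, (A U g.a α Ψ s).toReal ^ θ) ≤ B * (X ^ α + X ^ α) := by
          refine mul_le_mul_of_nonneg_left (add_le_add ?_ hAint) hB0.le
          linarith
      _ = 2 * B * X ^ α := by ring
      _ ≤ _ := mul_le_mul_of_nonneg_right e3 (by positivity)
  refine (h hp hΨ (by norm_num : (0 : ℝ) < 1 / 4) le_rfl (by linarith) hBX
    (key _ (continuousOn_globEnergy hn hUb hU hα hκ hp hΨ) fun s hs => h1 s (hI s hs).2.1)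
    (key _ (continuousOn_globEnergy hn hUb hU hα hκ hp.neg hΨ.neg) fun s hs =>
      h2 s (hI s hs).2.2)
    ((spaceTimeNorm_mono (by linarith) le_rfl).trans
      (hS.trans (ENNReal.ofReal_le_ofReal hXBX)))).trans (ENNReal.ofReal_le_ofReal ?_)
  rw [Real.mul_rpow (by positivity) hX0.le, ← hD]
  refine le_of_eq ?_
  ring

end Forchheimer

/-! ### Assembly: X stands for the bracket on the right-hand side, up to a factor two in (ii). -/

theorem theorem4p2 {n : ℕ} (hn : 2 ≤ n) (g : Forchheimer.Poly)
    (U : Set (Forchheimer.Pt n)) (hUo : IsOpen U) (hUb : Bornology.IsBounded U)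
    (hUc : IsConnected U)
    (U' : Set (Forchheimer.Pt n)) (hU'c : IsCompact (closure U')) (hU' : closure U' ⊆ U)
    (α : ℝ) (hα : 2 ≤ α) (hα' : Forchheimer.alphaStar n g.a < α) :
    ∃ C : ℝ, 0 < C ∧
      ∀ (p : Forchheimer.Pt n → ℝ → ℝ) (p₀ : Forchheimer.Pt n → ℝ) (Ψ : Forchheimer.Pt n → ℝ → ℝ),
        Forchheimer.IsBoundaryExtension U Ψ → Forchheimer.IsSolution g U α p p₀ Ψ →
        -- (i) all times, for every choice of the envelope of `A(α,·)`
        (∀ EnvA : ℝ → ℝ≥0, Forchheimer.IsEnvelope (Forchheimer.A U g.a α Ψ) EnvA →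
          (∀ t : ℝ, 0 < t → t < 1 →
            Forchheimer.supNorm U' p t ≤
              ENNReal.ofReal (C * t ^ (-(Forchheimer.kappa1 n g.a α / (α - g.a)))) *
                (1 + eLpNorm (fun x => p₀ x - Ψ x 0) (ENNReal.ofReal α) (volume.restrict U)
                  + (EnvA t : ℝ≥0∞) ^ (1 / (α - g.a))
                  + Forchheimer.spaceTimeNorm U α Ψ 0 t) ^ Forchheimer.kappa2 n g.a α) ∧
          (∀ t : ℝ, 1 ≤ t →
            Forchheimer.supNorm U' p t ≤
              ENNReal.ofReal C *
                (1 + eLpNorm (fun x => p₀ x - Ψ x 0) (ENNReal.ofReal α) (volume.restrict U)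
                  + (EnvA t : ℝ≥0∞) ^ (1 / (α - g.a))
                  + Forchheimer.spaceTimeNorm U α Ψ (t - 1) t) ^ Forchheimer.kappa2 n g.a α)) ∧
        -- (ii) limit superior as `t → ∞`
        (Forchheimer.Alim U g.a α Ψ < ∞ →
          limsup (fun t => Forchheimer.supNorm U' p t) atTop ≤
            ENNReal.ofReal C *
              (1 + Forchheimer.Alim U g.a α Ψ ^ (1 / (α - g.a))
                + limsup (fun t => Forchheimer.spaceTimeNorm U α Ψ (t - 1) t) atTop)
              ^ Forchheimer.kappa2 n g.a α) ∧
        -- (iii) large times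
        (Forchheimer.AIsC1 U g.a α Ψ → Forchheimer.beta U g.a α Ψ < ∞ →
          ∃ T : ℝ, 0 < T ∧ ∀ t : ℝ, T ≤ t →
            Forchheimer.supNorm U' p t ≤
              ENNReal.ofReal C *
                (1 + Forchheimer.beta U g.a α Ψ ^ (1 / (α - 2 * g.a))
                  + eLpNorm (Forchheimer.A U g.a α Ψ) (ENNReal.ofReal (α / (α - g.a)))
                      (volume.restrict (Ioo (t - 1) t)) ^ (1 / (α - g.a))
                  + Forchheimer.spaceTimeNorm U α Ψ (t - 1) t) ^ Forchheimer.kappa2 n g.a α) := by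
  have ha := g.a_lt_one
  have ha0 := g.a_pos
  have hr : 0 < α - g.a := by linarith
  have hr2 : 0 < α - 2 * g.a := by linarith
  have hκ2 := Forchheimer.kappa2_pos g hn hα hα'
  obtain ⟨C₁, hC₁, h₁⟩ := Forchheimer.exists_supNorm_le g hn hUb hUo hα hα' hU'c hU'
  obtain ⟨C₃, hC₃, h₃⟩ := Forchheimer.exists_supNorm_le_of_beta g hn hUb hUo hα hα' hU'c hU'
  set κ := Forchheimer.kappa2 n g.a α
  set q := Forchheimer.kappa1 n g.a α / (α - g.a)
  -- 4^q comes from the windows τ = t/4 and τ = 1/4 in (i), 2^κ from doubling X in (ii), and C₃ from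
  -- (iii).
  set C := C₁ * 4 ^ q + C₁ * 2 ^ κ + C₃ with hC
  have hC0 : 0 < C := by positivity
  have hC1 : C₁ * 4 ^ q ≤ C := by
    have : 0 < C₁ * 2 ^ κ + C₃ := by positivity
    linarith
  have hC2 : C₁ * 2 ^ κ ≤ C := by
    have : 0 < C₁ * 4 ^ q + C₃ := by positivity
    linarith
  have hC3 : C₃ ≤ C := by
    have : 0 < C₁ * 4 ^ q + C₁ * 2 ^ κ := by positivity
    linarith
  -- it suffices to treat a finite right-hand side
  have hfin : ∀ {S Z : ℝ≥0∞} {D : ℝ}, 0 < D → (1 : ℝ≥0∞) ≤ Z →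
      (∀ X : ℝ, 1 ≤ X → ENNReal.ofReal X = Z → S ≤ ENNReal.ofReal (D * X ^ κ)) →
      S ≤ ENNReal.ofReal D * Z ^ κ := by
    intro S Z D hD hZ h
    rcases eq_or_ne Z ∞ with rfl | hZt
    · rw [ENNReal.top_rpow_of_pos hκ2, ENNReal.mul_top (by simpa using hD)]
      exact le_top
    · have hX : 1 ≤ Z.toReal := by
        rw [← ENNReal.toReal_one]; exact ENNReal.toReal_mono hZt hZ
      have := h Z.toReal hX (ENNReal.ofReal_toReal hZt)
      rwa [ENNReal.ofReal_mul hD.le,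
        ← ENNReal.ofReal_rpow_of_nonneg ENNReal.toReal_nonneg hκ2.le,
        ENNReal.ofReal_toReal hZt] at this
  have hroot : ∀ {N : ℝ≥0∞} {X r : ℝ}, 0 < r → 0 ≤ X → N ^ (1 / r) ≤ ENNReal.ofReal X →
      N ≤ ENNReal.ofReal (X ^ r) := by
    intro N X r hr hX h
    rwa [one_div, ENNReal.rpow_inv_le_iff hr, ENNReal.ofReal_rpow_of_nonneg hX hr.le] at h
  refine ⟨C, hC0, ?_⟩
  intro p p₀ Ψ hΨ hp
  refine ⟨fun EnvA hEnv => ⟨fun t ht ht1 => ?_, fun t ht => ?_⟩, fun hA => ?_, fun hAC hβ => ?_⟩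
  · refine hfin (by positivity) (by simp only [add_assoc]; exact le_self_add) fun X hX hXZ => ?_
    have hX0 : 0 < X := by linarith
    have hN2 : (EnvA t : ℝ≥0∞) ^ (1 / (α - g.a)) ≤ ENNReal.ofReal X := by
      rw [hXZ]; exact le_add_right (le_add_left le_rfl)
    -- The window (t/2, t) stays away from time zero, and its length proportional to t creates the
    -- singular power of t.
    refine ((h₁ hp hΨ hX).1 (τ := t / 4) (by positivity) (by linarith) (by linarith) ?_
      (fun s hs => ?_) ?_).trans (ENNReal.ofReal_le_ofReal ?_)
    · rw [hXZ]; exact le_add_right (le_add_right (le_add_left le_rfl))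
    · refine (hEnv.2.2 s hs.1.le).trans (le_trans ?_ (hroot hr hX0.le hN2))
      exact_mod_cast hEnv.2.1 hs.1.le ht.le hs.2
    · rw [hXZ]
      exact (Forchheimer.spaceTimeNorm_mono (by linarith) le_rfl).trans (le_add_left le_rfl)
    · have e : (t / 4) ^ (-q) = 4 ^ q * t ^ (-q) := by
        rw [Real.div_rpow ht.le (by norm_num), Real.rpow_neg (by norm_num : (0 : ℝ) ≤ 4),
          div_inv_eq_mul, mul_comm]
      rw [e]
      calc C₁ * (4 ^ q * t ^ (-q) * X ^ κ) = (C₁ * 4 ^ q) * (t ^ (-q) * X ^ κ) := by ring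
        _ ≤ C * (t ^ (-q) * X ^ κ) := mul_le_mul_of_nonneg_right hC1 (by positivity)
        _ = _ := by ring
  · refine hfin hC0 (by simp only [add_assoc]; exact le_self_add) fun X hX hXZ => ?_
    have hX0 : 0 < X := by linarith
    have hN2 : (EnvA t : ℝ≥0∞) ^ (1 / (α - g.a)) ≤ ENNReal.ofReal X := by
      rw [hXZ]; exact le_add_right (le_add_left le_rfl)
    refine ((h₁ hp hΨ hX).1 (τ := 1 / 4) (by norm_num) le_rfl (by linarith) ?_
      (fun s hs => ?_) ?_).trans (ENNReal.ofReal_le_ofReal ?_)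
    · rw [hXZ]; exact le_add_right (le_add_right (le_add_left le_rfl))
    · refine (hEnv.2.2 s hs.1.le).trans (le_trans ?_ (hroot hr hX0.le hN2))
      exact_mod_cast hEnv.2.1 hs.1.le (zero_le_one.trans ht) hs.2
    · rw [hXZ]
      exact (Forchheimer.spaceTimeNorm_mono (by linarith) le_rfl).trans (le_add_left le_rfl)
    · have e : (1 / 4 : ℝ) ^ (-q) = 4 ^ q := by
        rw [Real.rpow_neg (by norm_num), one_div, Real.inv_rpow (by norm_num), inv_inv]
      rw [e, ← mul_assoc]
      exact mul_le_mul_of_nonneg_right hC1 (by positivity)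
  · refine hfin hC0 (by simp only [add_assoc]; exact le_self_add) fun X hX hXZ => ?_
    have hX0 : 0 < X := by linarith
    have hN2 : Forchheimer.Alim U g.a α Ψ ^ (1 / (α - g.a)) ≤ ENNReal.ofReal X := by
      rw [hXZ]; exact le_add_right (le_add_left le_rfl)
    have hXr : 0 < X ^ (α - g.a) := by positivity
    -- X is doubled because a bound on a limit superior holds at all large times only with strict
    -- room; X > 0 provides it.
    have e1 : ∀ᶠ t in atTop, Forchheimer.A U g.a α Ψ t ≤
        ENNReal.ofReal ((2 * X) ^ (α - g.a)) := by
      have hlt : Forchheimer.Alim U g.a α Ψ < ENNReal.ofReal ((2 * X) ^ (α - g.a)) := by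
        refine (hroot hr hX0.le hN2).trans_lt
          ((ENNReal.ofReal_lt_ofReal_iff (by positivity)).2 ?_)
        exact Real.rpow_lt_rpow hX0.le (by linarith) hr
      exact (eventually_lt_of_limsup_lt hlt).mono fun _ h => h.le
    have e2 : ∀ᶠ t in atTop, Forchheimer.spaceTimeNorm U α Ψ (t - 1) t ≤
        ENNReal.ofReal (2 * X) := by
      have hlt : limsup (fun t => Forchheimer.spaceTimeNorm U α Ψ (t - 1) t) atTop <
          ENNReal.ofReal (2 * X) := by
        refine lt_of_le_of_lt ?_ ((ENNReal.ofReal_lt_ofReal_iff (by positivity)).2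
          (by linarith : X < 2 * X))
        rw [hXZ]
        exact le_add_left le_rfl
      exact (eventually_lt_of_limsup_lt hlt).mono fun _ h => h.le
    refine (limsup_le_of_le (h := (h₁ hp hΨ (by linarith : 1 ≤ 2 * X)).2 e1 e2)).trans
      (ENNReal.ofReal_le_ofReal ?_)
    rw [Real.mul_rpow (by norm_num) hX0.le, ← mul_assoc]
    exact mul_le_mul_of_nonneg_right hC2 (by positivity)
  · have hβt : Forchheimer.beta U g.a α Ψ ^ (1 / (α - 2 * g.a)) ≠ ∞ :=
      ENNReal.rpow_ne_top_of_nonneg (by positivity) hβ.ne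
    set b := (Forchheimer.beta U g.a α Ψ ^ (1 / (α - 2 * g.a))).toReal with hb
    have hb0 : 0 ≤ b := ENNReal.toReal_nonneg
    have hb1 : Forchheimer.beta U g.a α Ψ ^ (1 / (α - 2 * g.a)) = ENNReal.ofReal b :=
      (ENNReal.ofReal_toReal hβt).symm
    -- 1 + b does not depend on t, so T is fixed before the bracket at time t is considered; that
    -- bracket always exceeds 1 + b.
    have hev := h₃ hp hΨ hAC (b := 1 + b) (by linarith)
      (hroot hr2 (by linarith) (hb1.trans_le (ENNReal.ofReal_le_ofReal (by linarith))))
    obtain ⟨T, hT⟩ := eventually_atTop.1 hev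
    refine ⟨max T 1, by positivity, fun t ht => ?_⟩
    refine hfin hC0 (by simp only [add_assoc]; exact le_self_add) fun X hX hXZ => ?_
    refine (hT t ((le_max_left _ _).trans ht) X ?_ ?_ ?_).trans
      (ENNReal.ofReal_le_ofReal (mul_le_mul_of_nonneg_right hC3 (by positivity)))
    · rw [← ENNReal.ofReal_le_ofReal_iff (by linarith), hXZ,
        ENNReal.ofReal_add zero_le_one hb0, ENNReal.ofReal_one, hb1, add_assoc]
      exact le_self_add
    · rw [hXZ]; exact le_add_right (le_add_left le_rfl)
    · rw [hXZ]; exact le_add_left le_rfl
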